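/- Let $l>1$ be an integer. Let $M=H_1(X_1(l),\partial X_1(l);\mathbb C)$ be the space of modular symbols for $\Gamma_1(l)$, that is, the complex vector space generated by symbols $\{P,Q\}$ with $P,Q\in\mathbb P^1(\mathbb Q)$, subject to $\{P,Q\}+\{Q,R\}=\{P,R\}$ and $\{\gamma P,\gamma Q\}=\{P,Q\}$ for $\gamma\in\Gamma_1(l)$. For integers $a,b$ with $\gcd(a,b,l)=1$ the Manin symbol $(a,b)\in M$ is $\{g0,g\infty\}$ for any $g\in SL_2(\mathbb Z)$ whose bottom row is congruent to $(a,b)$ modulo $l$. Let $\iota$ be the involution $\{P,Q\}\mapsto\{-P,-Q\}$ of $M$, so that $\iota(a,b)=(-a,b)$; put $M_-=\{x\in M:\iota(x)=-x\}$ and $(a,b)_-=\tfrac12\big((a,b)-(-a,b)\big)\in M_-$. Let $\mathscr M(l)$ be the space of holomorphic modular forms of weight two for $\Gamma_1(l)$, and let $\mathscr E(l)\subset\mathscr M(l)$ be the subspace of Eisenstein series, that is, of those forms that are linear combinations of the series $G_v(\tau)=\sum_{c\equiv v_1\,(l)}\Big(\sum_{d\equiv v_2\,(l),\ (c,d)\ne(0,0)}(c\tau+d)^{-2}\Big)$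 with $v=(v_1,v_2)\in(\mathbb Z/l\mathbb Z)^2$. For an integer $a$ not divisible by $l$ let $s_{a/l}(\tau)=\frac1{2\pi i}\,\partial_z(\log\theta)(a/l,\tau)$, where $\theta(z,\tau)=-i\sum_{n\in\mathbb Z}(-1)^n e^{\pi i(n+1/2)^2\tau}e^{\pi i(2n+1)z}$. For a prime $p$ not dividing $l$, let $T_p$ be the Hecke operator of the double coset $\Gamma_1(l)\left(\begin{smallmatrix}1&0\\0&p\end{smallmatrix}\right)\Gamma_1(l)=\bigsqcup_i\Gamma_1(l)\delta_i$. It acts on $M$ by $T_p\{P,Q\}=\sum_i\{\delta_iP,\delta_iQ\}$ and on $\mathscr M(l)$ by $(T_pf)(\tau)=\sum_i p\,(c_i\tau+d_i)^{-2}f(\delta_i\tau)$, where $(c_i,d_i)$ is the bottom row of $\delta_i$. **Theorem.** There is a unique linear map $\mu\colon M_-\to\mathscr M(l)/\mathscr E(l)$ such that, for all integers $a,b$ with $\gcd(a,b,l)=1$, $$\mu\big((a,b)_-\big)=s_{a/l}\,s_{b/l}\bmod\mathscr E(l)\quad\text{if } l\nmid a \text{ and } l\nmid b,$$ where in particular $s_{a/l}s_{b/l}\in\mathscr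 M(l)$, and $\mu((a,b)_-)=0$ otherwise. For every prime $p$ not dividing $l$, the operator $T_p$ preserves $M_-$ and $\mathscr E(l)$, and $\mu(T_px)=T_p\,\mu(x)$ for all $x\in M_-$. -/

import Mathlib

open scoped MatrixGroups Pointwise ModularForm

noncomputable section

namespace ToricHecke

open Matrix Matrix.SpecialLinearGroup CongruenceSubgroup ConjAct UpperHalfPlane

/-! ### Modular symbols for `Γ₁(l)` -/

/-- The projective line over `ℚ`, that is, `ℚ` together with one point at infinity. The group
`GL₂(ℚ)` acts on it by Möbius transformations. -/
abbrev P1 : Type := OnePoint ℚ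

/-- The relations between the symbols `{P, Q}`, where `P, Q ∈ ℙ¹(ℚ)`: first
`{P, Q} + {Q, R} = {P, R}`, and second `{γP, γQ} = {P, Q}` for `γ ∈ Γ₁(l)`. -/
def symbolRelations (l : ℕ) : Submodule ℂ (P1 × P1 →₀ ℂ) :=
  Submodule.span ℂ
    ({x | ∃ P Q R : P1, x = Finsupp.single (P, Q) 1 + Finsupp.single (Q, R) 1
        - Finsupp.single (P, R) 1} ∪
     {x | ∃ γ ∈ Gamma1 l, ∃ P Q : P1,
        x = Finsupp.single (mapGL ℚ γ • P, mapGL ℚ γ • Q) 1 - Finsupp.single (P, Q) 1})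

/-- The space `M` of weight two modular symbols for `Γ₁(l)` with complex coefficients: the relative
homology `H₁(X₁(l), ∂X₁(l); ℂ)` of the modular curve with respect to its cusps, presented as the
space generated by the classes `{P, Q}` of paths between points of `ℙ¹(ℚ)`. -/
abbrev ModSym (l : ℕ) : Type := (P1 × P1 →₀ ℂ) ⧸ symbolRelations l

/-- The class `{P, Q}` in `M` of a path from `P` to `Q`. -/
def symb (l : ℕ) (P Q : P1) : ModSym l :=
  (symbolRelations l).mkQ (Finsupp.single (P, Q) 1)

lemma symb_add (l : ℕ) (P Q R : P1) : symb l P Q + symb l Q R = symb l P R := by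
  rw [← sub_eq_zero]
  simp only [symb, ← map_add, ← map_sub]
  rw [Submodule.mkQ_apply, Submodule.Quotient.mk_eq_zero]
  exact Submodule.subset_span (Or.inl ⟨P, Q, R, rfl⟩)

lemma symb_smul (l : ℕ) {γ : SL(2, ℤ)} (hγ : γ ∈ Gamma1 l) (P Q : P1) :
    symb l (mapGL ℚ γ • P) (mapGL ℚ γ • Q) = symb l P Q := by
  rw [← sub_eq_zero]
  simp only [symb, ← map_sub]
  rw [Submodule.mkQ_apply, Submodule.Quotient.mk_eq_zero]
  exact Submodule.subset_span (Or.inr ⟨γ, hγ, P, Q, rfl⟩)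

/-- The linear map on `M` with prescribed values on the symbols `{P, Q}`. -/
def liftSymb (l : ℕ) {V : Type*} [AddCommGroup V] [Module ℂ V] (φ : P1 → P1 → V)
    (hadd : ∀ P Q R, φ P Q + φ Q R = φ P R)
    (hinv : ∀ γ ∈ Gamma1 l, ∀ P Q, φ (mapGL ℚ γ • P) (mapGL ℚ γ • Q) = φ P Q) :
    ModSym l →ₗ[ℂ] V :=
  (symbolRelations l).liftQ (Finsupp.linearCombination ℂ fun x : P1 × P1 => φ x.1 x.2) (by
    rw [symbolRelations, Submodule.span_le]
    rintro x (⟨P, Q, R, rfl⟩ | ⟨γ, hγ, P, Q, rfl⟩)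
    · simp [hadd]
    · simp [hinv γ hγ])

@[simp]
lemma liftSymb_symb (l : ℕ) {V : Type*} [AddCommGroup V] [Module ℂ V] (φ : P1 → P1 → V)
    (hadd : ∀ P Q R, φ P Q + φ Q R = φ P R)
    (hinv : ∀ γ ∈ Gamma1 l, ∀ P Q, φ (mapGL ℚ γ • P) (mapGL ℚ γ • Q) = φ P Q) (P Q : P1) :
    liftSymb l φ hadd hinv (symb l P Q) = φ P Q := by
  simp [liftSymb, symb]

/-! ### Manin symbols, the involution, and minus symbols -/

/-- The Manin symbol `(a, b)`, where `a, b` matter modulo `l` only: the class `{g0, g∞}` for any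
`g ∈ SL₂(ℤ)` whose bottom row is congruent to `(a, b)` modulo `l`. Such a `g` exists if and only if
`gcd(a, b, l) = 1`; a degenerate pair gets the value `0`. -/
def maninSymbol (l : ℕ) (a b : ℤ) : ModSym l :=
  open Classical in
  if h : ∃ g : SL(2, ℤ), (g 1 0 : ZMod l) = a ∧ (g 1 1 : ZMod l) = b then
    symb l (mapGL ℚ h.choose • ((0 : ℚ) : P1)) (mapGL ℚ h.choose • (OnePoint.infty : P1))
  else 0

lemma maninSymbol_eq (l : ℕ) (a b : ℤ) (g : SL(2, ℤ)) (ha : (g 1 0 : ZMod l) = a)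
    (hb : (g 1 1 : ZMod l) = b) :
    maninSymbol l a b =
      symb l (mapGL ℚ g • ((0 : ℚ) : P1)) (mapGL ℚ g • (OnePoint.infty : P1)) := by
  have h : ∃ g : SL(2, ℤ), (g 1 0 : ZMod l) = a ∧ (g 1 1 : ZMod l) = b := ⟨g, ha, hb⟩
  rw [maninSymbol, dif_pos h]
  obtain ⟨hk0, hk1⟩ := h.choose_spec
  set k := h.choose
  have hmem : k * g⁻¹ ∈ Gamma1 l := by
    have hdk : ((k 0 0 * k 1 1 - k 0 1 * k 1 0 : ℤ) : ZMod l) = 1 := by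
      rw [← Matrix.det_fin_two]; simp
    have hdg : ((g 0 0 * g 1 1 - g 0 1 * g 1 0 : ℤ) : ZMod l) = 1 := by
      rw [← Matrix.det_fin_two]; simp
    push_cast at hdk hdg
    have hmul (i j : Fin 2) : (k * g⁻¹) i j =
        k i 0 * (g.1.adjugate) 0 j + k i 1 * (g.1.adjugate) 1 j := by
      change ((k : Matrix (Fin 2) (Fin 2) ℤ) * (g : Matrix (Fin 2) (Fin 2) ℤ).adjugate) i j = _
      rw [Matrix.mul_apply, Fin.sum_univ_two]
    rw [Gamma1_mem]
    simp only [hmul, Matrix.adjugate_fin_two, Matrix.of_apply, Matrix.cons_val_zero,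
      Matrix.cons_val_one, Matrix.cons_val', Matrix.cons_val_fin_one]
    push_cast
    refine ⟨?_, ?_, ?_⟩
    · rw [ha, hb, ← hk0, ← hk1]; linear_combination hdk
    · rw [hk0, hk1, ← ha, ← hb]; linear_combination hdg
    · rw [hk0, hk1, ha, hb]; ring
  have := symb_smul l hmem (mapGL ℚ g • ((0 : ℚ) : P1)) (mapGL ℚ g • (OnePoint.infty : P1))
  simpa [← mul_smul, ← map_mul] using this

/-- The matrix `diag(-1, 1)`, which acts on `ℙ¹(ℚ)` by `x ↦ -x`. -/
def epsilon : GL (Fin 2) ℚ :=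
  GeneralLinearGroup.mkOfDetNeZero !![-1, 0; 0, 1] (by simp)

/-- Conjugation by `diag(-1, 1)` on `SL₂(ℤ)`. -/
def conjEps (g : SL(2, ℤ)) : SL(2, ℤ) :=
  ⟨!![g 0 0, -g 0 1; -g 1 0, g 1 1], by
    have := g.det_coe
    rw [Matrix.det_fin_two] at this
    rw [Matrix.det_fin_two_of]; linarith⟩

lemma conjEps_apply (g : SL(2, ℤ)) (i j : Fin 2) :
    conjEps g i j = !![g 0 0, -g 0 1; -g 1 0, g 1 1] i j := rfl

lemma epsilon_mul (g : SL(2, ℤ)) :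
    epsilon * mapGL ℚ g = mapGL ℚ (conjEps g) * epsilon := by
  ext i j
  fin_cases i <;> fin_cases j <;>
    simp [epsilon, conjEps_apply, Matrix.mul_apply, Fin.sum_univ_two,
      GeneralLinearGroup.mkOfDetNeZero]

lemma conjEps_mem {l : ℕ} {g : SL(2, ℤ)} (hg : g ∈ Gamma1 l) : conjEps g ∈ Gamma1 l := by
  rw [Gamma1_mem] at *
  simpa [conjEps] using hg

/-- The involution `ι` of `M`, induced by `τ ↦ -τ̄` on the upper half plane:
`{P, Q} ↦ {-P, -Q}`. On Manin symbols it is `(a, b) ↦ (-a, b)`. -/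
def iota (l : ℕ) : ModSym l →ₗ[ℂ] ModSym l :=
  liftSymb l (fun P Q => symb l (epsilon • P) (epsilon • Q))
    (fun P Q R => symb_add l _ _ _)
    (fun γ hγ P Q => by
      simp only [← mul_smul, epsilon_mul]
      simp only [mul_smul, symb_smul l (conjEps_mem hγ)])

lemma iota_maninSymbol (l : ℕ) (a b : ℤ) :
    iota l (maninSymbol l a b) = maninSymbol l (-a) b := by
  by_cases h : ∃ g : SL(2, ℤ), (g 1 0 : ZMod l) = a ∧ (g 1 1 : ZMod l) = b
  · obtain ⟨g, ha, hb⟩ := h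
    have e0 : epsilon • ((0 : ℚ) : P1) = ((0 : ℚ) : P1) := by
      rw [OnePoint.smul_some_eq_ite]
      simp [epsilon, GeneralLinearGroup.mkOfDetNeZero]
    have ei : epsilon • (OnePoint.infty : P1) = OnePoint.infty := by
      rw [OnePoint.smul_infty_eq_ite]
      simp [epsilon, GeneralLinearGroup.mkOfDetNeZero]
    rw [maninSymbol_eq l a b g ha hb,
      maninSymbol_eq l (-a) b (conjEps g) (by simp [conjEps, ha]) (by simp [conjEps, hb]), iota,
      liftSymb_symb]
    simp only [← mul_smul, epsilon_mul]
    simp only [mul_smul, e0, ei]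
  · have h' : ¬ ∃ g : SL(2, ℤ), (g 1 0 : ZMod l) = (-a : ℤ) ∧ (g 1 1 : ZMod l) = b := by
      rintro ⟨g, ha, hb⟩
      exact h ⟨conjEps g, by simp [conjEps, ha], by simp [conjEps, hb]⟩
    rw [maninSymbol, maninSymbol, dif_neg h, dif_neg h', map_zero]

/-- The space `M₋` of minus symbols: the elements `x` of `M` with `ι(x) = -x`. -/
def minusSymbols (l : ℕ) : Submodule ℂ (ModSym l) where
  carrier := {x | iota l x = -x}
  add_mem' {x y} hx hy := by
    simp only [Set.mem_ofPred_eq] at *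
    rw [map_add, hx, hy]; abel
  zero_mem' := by simp
  smul_mem' c x hx := by
    simp only [Set.mem_ofPred_eq] at *
    rw [map_smul, hx, smul_neg]

/-- The symbol `(a, b)₋ = ((a, b) - (-a, b)) / 2` in `M₋`. -/
def maninMinus (l : ℕ) (a b : ℤ) : minusSymbols l :=
  ⟨(1 / 2 : ℂ) • (maninSymbol l a b - maninSymbol l (-a) b), by
    change iota l _ = _
    rw [map_smul, map_sub, iota_maninSymbol, iota_maninSymbol, neg_neg, ← smul_neg, neg_sub]⟩

/-! ### Modular forms and Eisenstein series -/

/-- The space `𝓜(l)` of weight two holomorphic modular forms for `Γ₁(l)`. -/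
abbrev MForm (l : ℕ) : Type :=
  ModularForm ((Gamma1 l).map (mapGL ℝ) : Subgroup (GL (Fin 2) ℝ)) 2

/-- The weight two Eisenstein series of level `l` attached to a pair `v` of residue classes,
`G_v(τ) = ∑_{c ≡ v₁} ∑_{d ≡ v₂} (cτ + d)⁻²`, where `(c, d) = (0, 0)` contributes zero. The sums are
taken in this order, and each of them converges absolutely. -/
def eisG (l : ℕ) (v : ZMod l × ZMod l) (τ : ℍ) : ℂ :=
  ∑' c : {c : ℤ // (c : ZMod l) = v.1}, ∑' d : {d : ℤ // (d : ZMod l) = v.2},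
    (((c : ℤ) : ℂ) * (τ : ℂ) + ((d : ℤ) : ℂ)) ^ (-2 : ℤ)

/-- The space `𝓔(l)` of Eisenstein series in `𝓜(l)`: the modular forms of weight two for `Γ₁(l)`
that are linear combinations of the series `G_v`. -/
def eisSpace (l : ℕ) : Submodule ℂ (MForm l) where
  carrier := {f | (f : ℍ → ℂ) ∈ Submodule.span ℂ (Set.range (eisG l))}
  add_mem' {f g} hf hg := by
    simpa using Submodule.add_mem _ hf hg
  zero_mem' := by simp
  smul_mem' c f hf := by
    simpa using Submodule.smul_mem _ c hf

/-! ### Hecke operators -/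

/-- The matrix `diag(1, p)`. -/
def alpha (p : ℕ) [NeZero p] : GL (Fin 2) ℚ :=
  GeneralLinearGroup.mkOfDetNeZero !![1, 0; 0, (p : ℚ)] (by simp [NeZero.ne p])

/-- The matrix `diag(1, p)` over the real numbers. -/
def alphaR (p : ℕ) [NeZero p] : GL (Fin 2) ℝ := (alpha p).map (Rat.castHom ℝ)

lemma det_alphaR_pos (p : ℕ) [NeZero p] : 0 < (alphaR p).det.val := by
  have : 0 < p := Nat.pos_of_ne_zero (NeZero.ne p)
  simp [alphaR, alpha, GeneralLinearGroup.mkOfDetNeZero, Matrix.det_fin_two, this]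

instance finite_relIndex_real (l p : ℕ) [NeZero l] [NeZero p] :
    (toConjAct (alphaR p)⁻¹ • (Gamma1 l).map (mapGL ℝ)).IsFiniteRelIndex
      ((Gamma1 l).map (mapGL ℝ)) := by
  have h1 := Subgroup.IsArithmetic.conj ((Gamma1 l).map (mapGL ℝ)) (alpha p)⁻¹
  have h2 : (toConjAct (alphaR p)⁻¹ • (Gamma1 l).map (mapGL ℝ)).IsArithmetic := by
    simpa [alphaR] using h1
  exact ⟨(h2.is_commensurable.trans
    (Subgroup.IsArithmetic.is_commensurable (𝒢 := (Gamma1 l).map (mapGL ℝ))).symm).1⟩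

/-- The Hecke operator `T_p` on `𝓜(l)`, given by the double coset of `α = diag(1, p)`:
it sends `f` to the sum of `f ∣₂ δ` over representatives `δ = α γ⁻¹` of `Γ₁(l) \ Γ₁(l) α Γ₁(l)`,
where `γ` runs over `Γ₁(l) / (Γ₁(l) ∩ α⁻¹ Γ₁(l) α)`. -/
def heckeForm (l p : ℕ) [NeZero l] [NeZero p] : MForm l →ₗ[ℂ] MForm l where
  toFun f := ModularForm.trace ((Gamma1 l).map (mapGL ℝ)) (ModularForm.translate f (alphaR p))
  map_add' f g := by
    apply DFunLike.coe_injective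
    simp only [ModularForm.coe_trace, FunLike.coe_add]
    rw [← Finset.sum_add_distrib]
    refine Finset.sum_congr rfl fun q _ => ?_
    induction q using Quotient.inductionOn with
    | h r =>
      change ((⇑(f + g) : ℍ → ℂ) ∣[(2 : ℤ)] alphaR p) ∣[(2 : ℤ)] r.val⁻¹ =
        ((⇑f : ℍ → ℂ) ∣[(2 : ℤ)] alphaR p) ∣[(2 : ℤ)] r.val⁻¹ +
          ((⇑g : ℍ → ℂ) ∣[(2 : ℤ)] alphaR p) ∣[(2 : ℤ)] r.val⁻¹
      rw [FunLike.coe_add, SlashAction.add_slash, SlashAction.add_slash]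
  map_smul' c f := by
    apply DFunLike.coe_injective
    simp only [ModularForm.coe_trace, FunLike.coe_smul, RingHom.id_apply]
    rw [Finset.smul_sum]
    refine Finset.sum_congr rfl fun q _ => ?_
    induction q using Quotient.inductionOn with
    | h r =>
      have hr : 0 < (r.val⁻¹).det.val := by
        obtain ⟨g, -, hg⟩ := r.2
        rw [← hg]; simp
      have e1 : UpperHalfPlane.σ (alphaR p) c = c := by
        rw [UpperHalfPlane.σ, if_pos (det_alphaR_pos p)]; rfl
      have e2 : UpperHalfPlane.σ (r.val⁻¹) c = c := by
        rw [UpperHalfPlane.σ, if_pos hr]; rfl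
      change ((⇑(c • f) : ℍ → ℂ) ∣[(2 : ℤ)] alphaR p) ∣[(2 : ℤ)] r.val⁻¹ =
        c • (((⇑f : ℍ → ℂ) ∣[(2 : ℤ)] alphaR p) ∣[(2 : ℤ)] r.val⁻¹)
      rw [FunLike.coe_smul, ModularForm.smul_slash, e1, ModularForm.smul_slash, e2]

/-- `Γ₁(l)` as a subgroup of `GL₂(ℚ)`. -/
abbrev GammaQ (l : ℕ) : Subgroup (GL (Fin 2) ℚ) := (Gamma1 l).map (mapGL ℚ)

/-- The quotient `Γ₁(l) / (Γ₁(l) ∩ α⁻¹ Γ₁(l) α)`, where `α = diag(1, p)`. By `γ ↦ α γ⁻¹` it is in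
bijection with `Γ₁(l) \ Γ₁(l) α Γ₁(l)`. -/
abbrev HeckeCosets (l p : ℕ) [NeZero p] : Type :=
  GammaQ l ⧸ (toConjAct (alpha p)⁻¹ • GammaQ l).subgroupOf (GammaQ l)

instance finite_heckeCosets (l p : ℕ) [NeZero l] [NeZero p] : Finite (HeckeCosets l p) := by
  obtain ⟨N, hN, h⟩ := exists_Gamma_le_conj (alpha p) l
  have : NeZero N := ⟨hN⟩
  have hle : Gamma N ≤ (toConjAct (alpha p)⁻¹ • GammaQ l).comap (mapGL ℚ) := by
    intro x hx
    obtain ⟨y, hy, hxy⟩ := h x hx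
    rw [Subgroup.mem_comap, toConjAct_inv, Subgroup.mem_inv_pointwise_smul_iff, toConjAct_smul,
      ← hxy]
    refine ⟨y, ?_, rfl⟩
    have hy' : y ∈ Gamma l := hy
    rw [Gamma_mem] at hy'
    show y ∈ Gamma1 l
    rw [Gamma1_mem]
    tauto
  have h1 : ((toConjAct (alpha p)⁻¹ • GammaQ l).comap (mapGL ℚ)).FiniteIndex :=
    Subgroup.finiteIndex_of_le hle
  have h2 : (toConjAct (alpha p)⁻¹ • GammaQ l).relIndex (GammaQ l) ≠ 0 := by
    rw [GammaQ, ← Subgroup.relIndex_comap]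
    exact Subgroup.FiniteIndex.index_ne_zero
  have h3 : ((toConjAct (alpha p)⁻¹ • GammaQ l).subgroupOf (GammaQ l)).FiniteIndex := ⟨h2⟩
  exact Subgroup.finite_quotient_of_finiteIndex

instance fintype_heckeCosets (l p : ℕ) [NeZero l] [NeZero p] : Fintype (HeckeCosets l p) :=
  Fintype.ofFinite _

/-- The symbol `{αγ⁻¹P, αγ⁻¹Q}` in `M`, which depends on the coset of `γ` only. -/
def heckeTerm (l p : ℕ) [NeZero p] (P Q : P1) (q : HeckeCosets l p) : ModSym l :=
  q.liftOn (fun γ => symb l ((alpha p * (γ : GL (Fin 2) ℚ)⁻¹) • P)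
      ((alpha p * (γ : GL (Fin 2) ℚ)⁻¹) • Q)) (by
    intro γ γ' h
    rw [← Quotient.eq_iff_equiv, Quotient.eq, QuotientGroup.leftRel_apply] at h
    have h' : (γ : GL (Fin 2) ℚ)⁻¹ * γ' ∈ toConjAct (alpha p)⁻¹ • GammaQ l := h
    rw [toConjAct_inv, Subgroup.mem_inv_pointwise_smul_iff, toConjAct_smul] at h'
    obtain ⟨y, hy, hxy⟩ := h'
    have e : alpha p * (γ : GL (Fin 2) ℚ)⁻¹ =
        mapGL ℚ y * (alpha p * (γ' : GL (Fin 2) ℚ)⁻¹) := by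
      rw [hxy]; group
    change symb l _ _ = symb l _ _
    rw [e, mul_smul, mul_smul (mapGL ℚ y), symb_smul l hy])

lemma heckeTerm_smul (l p : ℕ) [NeZero p] {γ : SL(2, ℤ)} (hγ : γ ∈ Gamma1 l) (P Q : P1)
    (q : HeckeCosets l p) :
    heckeTerm l p (mapGL ℚ γ • P) (mapGL ℚ γ • Q) q =
      heckeTerm l p P Q ((⟨mapGL ℚ γ, γ, hγ, rfl⟩ : GammaQ l)⁻¹ • q) := by
  induction q using Quotient.inductionOn with
  | h r =>
    change symb l _ _ = symb l _ _
    simp [← mul_smul, mul_assoc]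

/-- The Hecke operator `T_p` on the space `M` of modular symbols, given by the double coset of
`α = diag(1, p)`: it sends `{P, Q}` to the sum of `{δP, δQ}` over representatives `δ` of
`Γ₁(l) \ Γ₁(l) α Γ₁(l)`. -/
def heckeSymb (l p : ℕ) [NeZero l] [NeZero p] : ModSym l →ₗ[ℂ] ModSym l :=
  liftSymb l (fun P Q => ∑ q : HeckeCosets l p, heckeTerm l p P Q q)
    (fun P Q R => by
      rw [← Finset.sum_add_distrib]
      refine Finset.sum_congr rfl fun q _ => ?_
      induction q using Quotient.inductionOn with
      | h r => exact symb_add l _ _ _)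
    (fun γ hγ P Q => by
      simp only [heckeTerm_smul l p hγ]
      exact Equiv.sum_comp (MulAction.toPerm ((⟨mapGL ℚ γ, γ, hγ, rfl⟩ : GammaQ l)⁻¹))
        (heckeTerm l p P Q))

/-! ### The forms `s_{a/l}` and the map `μ` -/

/-- The standard odd theta function
`θ(z, τ) = -i ∑_{n ∈ ℤ} (-1)ⁿ exp(πi (n + 1/2)² τ) exp(πi (2n + 1) z)`. -/
def theta (z τ : ℂ) : ℂ :=
  -Complex.I * ∑' n : ℤ, (-1 : ℂ) ^ n *
    Complex.exp (Real.pi * Complex.I * ((n : ℂ) + 1 / 2) ^ 2 * τ) *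
    Complex.exp (Real.pi * Complex.I * (2 * (n : ℂ) + 1) * z)

/-- `s_{a/l}(τ) = (2πi)⁻¹ ∂_z (log θ)(a/l, τ)`. -/
def s (l : ℕ) (a : ℤ) (τ : ℍ) : ℂ :=
  (2 * Real.pi * Complex.I)⁻¹ * logDeriv (fun z : ℂ => theta z τ) ((a : ℂ) / (l : ℂ))

/-- The linear map `μ : M₋ → 𝓜(l) / 𝓔(l)` satisfies `μ((a, b)₋) = s_{a/l} s_{b/l} mod 𝓔(l)` if
neither `a` nor `b` is divisible by `l`, and `μ((a, b)₋) = 0` otherwise. -/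
def IsToricMap (l : ℕ) (μ : minusSymbols l →ₗ[ℂ] MForm l ⧸ eisSpace l) : Prop :=
  ∀ a b : ℤ, Int.gcd (Int.gcd a b) l = 1 →
    ((l : ℤ) ∣ a ∨ (l : ℤ) ∣ b → μ (maninMinus l a b) = 0) ∧
    (¬ (l : ℤ) ∣ a → ¬ (l : ℤ) ∣ b →
      ∃ F : MForm l, (∀ τ : ℍ, F τ = s l a τ * s l b τ) ∧
        μ (maninMinus l a b) = (eisSpace l).mkQ F)

end ToricHecke

end

open ToricHecke

/-! The map `μ` comes from a map `symbolMap` defined on all symbols {P, Q} at once, with values in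
functions on the upper half plane modulo the span of the G_v. No presentation of M by Manin symbols
is needed, and no formula for T_p on Manin symbols.

Functions of τ are indexed by points x = (a, b) of the torus (ℝ/ℤ)², which stand for aτ + b. `St x`
is the logarithmic derivative of theta made doubly periodic, a weight one series. `Et` and `Pt` are
weight two companions: `Pt` at l-torsion points gives the G_v up to a factor, and `Et (0, b/l)` is a
finite Fourier combination of them. Three facts carry the proof. (1) Distribution relations: `St`,
`Et`, `Pt` summed over the n-division points of x give n, 1 and n² times the value at x. (2) The
three-term relation: if x + y + z = 0, then St x St y + St y St z + St z St x is a sum of values of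
`Et` and `Pt` (`St_three_term`). (3) SL₂(ℤ) acts by moving the torsion point, up to a quasi-modular
defect common to all the `Pt` (`St_slash`, `Pt_slash`).

For an integral matrix M of non-zero determinant and a pair x of points, `pairForm M x` is -1/det M
times the sum of St z₁ St z₂ over the solutions z of adj(M)ᵀ z = x. By (1) it does not change when a
column of M is scaled, so it depends only on the two cusps given by the columns. Scaling the vectors
of three cusps to have sum zero, (2) turns additivity into a statement about the correction terms,
which (1) and a triangular form of M place in the Eisenstein span. At the base point (0, (0, 1/l)),
which Γ₁(l) fixes, the symbol {g0, g∞} with bottom row (a, b) gets the value St(0, a/l) St(0, b/l),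
which is s_{a/l} s_{b/l}, or 0 if l divides a or b. Uniqueness holds because Manin symbols span M.

For Hecke equivariance, put Th(w, e) = St(x + w₁e) St(y + w₂e) with w and e in 𝔽_p². A coset of T_p
is a line in 𝔽_p². On symbols it fixes w up to scaling and sums over e; on forms it fixes e and sums
over w. Since Th(cw, e) = Th(w, ce), summing over lines yields in both cases the same double sum
minus the same degenerate term. Finally T_p preserves the Eisenstein forms by the distribution
relation for `Pt`: modularity forces the coefficients of the `Pt` to have sum zero, so the defects
cancel. -/

noncomputable section

/-! ### Cotangent series: convergence, quasi-periods and multiplication formulas. -/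

namespace ToricHecke

open Complex Filter Topology

/-! ### The series `J` and `K` -/

/-- The exponential `w ↦ exp(2πi w)`. -/
def ee (w : ℂ) : ℂ := cexp (2 * Real.pi * I * w)

lemma ee_add (a b : ℂ) : ee (a + b) = ee a * ee b := by
  simp [ee, mul_add, Complex.exp_add]

lemma ee_neg (a : ℂ) : ee (-a) = (ee a)⁻¹ := by
  simp [ee, Complex.exp_neg]

lemma ee_ne_zero (a : ℂ) : ee a ≠ 0 := Complex.exp_ne_zero _

@[simp] lemma ee_zero : ee 0 = 1 := by simp [ee]

@[simp] lemma ee_int (n : ℤ) : ee n = 1 := by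
  rw [ee, Complex.exp_eq_one_iff]; exact ⟨n, by ring⟩

lemma ee_eq_one_iff (w : ℂ) : ee w = 1 ↔ ∃ n : ℤ, w = n := by
  rw [ee, Complex.exp_eq_one_iff]
  have : (2 * Real.pi * I : ℂ) ≠ 0 := by simp [Real.pi_ne_zero]
  refine exists_congr fun n => ⟨fun h => mul_left_cancel₀ this (by rw [h]; ring), fun h => by
    rw [h]; ring⟩

lemma ee_int_mul (n : ℤ) (w : ℂ) : ee (n * w) = ee w ^ n := by
  rw [ee, ee, ← Complex.exp_int_mul]; congr 1; ring

lemma ee_nat_mul (n : ℕ) (w : ℂ) : ee (n * w) = ee w ^ n := by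
  exact_mod_cast ee_int_mul n w

lemma norm_ee (w : ℂ) : ‖ee w‖ = Real.exp (-2 * Real.pi * w.im) := by
  rw [ee, Complex.norm_exp]; simp

lemma hasDerivAt_ee (w : ℂ) : HasDerivAt ee (2 * Real.pi * I * ee w) w := by
  have h : HasDerivAt (fun w : ℂ => 2 * Real.pi * I * w) (2 * Real.pi * I) w := by
    simpa using (hasDerivAt_id w).const_mul (2 * Real.pi * I : ℂ)
  exact h.cexp.congr_deriv (mul_comm _ _)

/-- The function `(X + 1) / (2 (X - 1))`, which is `cot (π z) / (2i)` for `X = exp(2πi z)`. -/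
def cth (X : ℂ) : ℂ := (X + 1) / (X - 1) / 2

-- Division by zero gives the pole the value 0. This keeps `cth` odd under X ↦ X⁻¹ and lets the
-- multiplication formula hold at roots of unity too, so that the distribution relations later need
-- no exception at lattice points.
@[simp] lemma cth_one : cth 1 = 0 := by simp [cth]

lemma cth_inv {X : ℂ} (h0 : X ≠ 0) : cth X⁻¹ = -cth X := by
  by_cases h1 : X = 1
  · simp [h1]
  have h1' : X - 1 ≠ 0 := sub_ne_zero.mpr h1
  have h2 : X⁻¹ - 1 ≠ 0 := by
    rw [sub_ne_zero]; simpa using h1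
  have h3 : 1 - X ≠ 0 := by rw [← neg_sub]; exact neg_ne_zero.mpr h1'
  have h4 : X⁻¹ - 1 = (1 - X) / X := by field_simp
  rw [cth, cth, h4]
  field_simp
  ring

lemma cth_add_half {X : ℂ} (h : X ≠ 1) : cth X + 1 / 2 = X / (X - 1) := by
  have : X - 1 ≠ 0 := sub_ne_zero.mpr h
  rw [cth]; field_simp; ring

lemma cth_sub_half {X : ℂ} (h : X ≠ 1) : cth X - 1 / 2 = 1 / (X - 1) := by
  have : X - 1 ≠ 0 := sub_ne_zero.mpr h
  rw [cth]; field_simp; ring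

lemma norm_cth_add_half {X : ℂ} (h : ‖X‖ ≤ 1 / 2) : ‖cth X + 1 / 2‖ ≤ 2 * ‖X‖ := by
  have h1 : X ≠ 1 := by rintro rfl; norm_num at h
  rw [cth_add_half h1, norm_div, div_le_iff₀ (norm_pos_iff.mpr (sub_ne_zero.mpr h1))]
  have : ‖(1 : ℂ)‖ - ‖X‖ ≤ ‖X - 1‖ := by rw [norm_sub_rev]; exact norm_sub_norm_le 1 X
  rw [norm_one] at this
  nlinarith [norm_nonneg X]

lemma norm_cth_sub_half {X : ℂ} (h0 : X ≠ 0) (h : ‖X⁻¹‖ ≤ 1 / 2) : ‖cth X - 1 / 2‖ ≤ 2 * ‖X⁻¹‖ := by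
  have := norm_cth_add_half h
  rwa [cth_inv h0, ← norm_neg, neg_add, neg_neg, ← sub_eq_add_neg] at this

/-- The sign of an integer, with the convention that zero is positive. -/
def sg (c : ℤ) : ℂ := if 0 ≤ c then 1 else -1

/-- The terms of the series `J` and `K`. -/
def kterm (τ z : ℂ) (c : ℤ) : ℂ := cth (ee (z + c * τ)) + sg c / 2

/-- The series `∑ w(c) (cot(π (z + cτ)) / 2i + sg(c) / 2)`. -/
def kser (w : ℤ → ℂ) (τ z : ℂ) : ℂ := ∑' c : ℤ, w c * kterm τ z c

/-- The lattice `ℤτ + ℤ`. -/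
def latt (τ : ℂ) : Set ℂ := {z | ∃ c d : ℤ, z = c * τ + d}

lemma ee_ne_one_of_notMem {τ z : ℂ} (hz : z ∉ latt τ) (c : ℤ) : ee (z + c * τ) ≠ 1 := by
  rw [Ne, ee_eq_one_iff]
  rintro ⟨n, hn⟩
  exact hz ⟨-c, n, by push_cast; linear_combination hn⟩

/-- A summable bound for the terms of the series on a horizontal strip. -/
def kbound (τ : ℂ) (M : ℝ) (c : ℤ) : ℝ :=
  (1 + |(c : ℝ)|) * (2 * Real.exp (2 * Real.pi * M) * Real.exp (-2 * Real.pi * τ.im) ^ c.natAbs)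

lemma summable_kbound {τ : ℂ} (hτ : 0 < τ.im) (M : ℝ) : Summable (kbound τ M) := by
  have hr : Real.exp (-2 * Real.pi * τ.im) < 1 := by
    rw [Real.exp_lt_one_iff]; nlinarith [Real.pi_pos]
  have hr0 : 0 < Real.exp (-2 * Real.pi * τ.im) := Real.exp_pos _
  have key : Summable fun n : ℕ => (1 + (n : ℝ)) *
      (2 * Real.exp (2 * Real.pi * M) * Real.exp (-2 * Real.pi * τ.im) ^ n) := by
    have h1 := (summable_geometric_of_lt_one hr0.le hr).mul_left (2 * Real.exp (2 * Real.pi * M))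
    have h2 := (summable_pow_mul_geometric_of_norm_lt_one 1
      (r := Real.exp (-2 * Real.pi * τ.im)) (by rwa [Real.norm_of_nonneg hr0.le])).mul_left
      (2 * Real.exp (2 * Real.pi * M))
    refine (h1.add h2).congr fun n => ?_
    ring
  apply Summable.of_nat_of_neg
  · simpa [kbound] using key
  · simpa [kbound] using key

/-- For c ≥ 0 the term is X/(X - 1) with X = e(z + cτ) exponentially small, and for c < 0 the same
holds with X⁻¹. The estimate needs |X| ≤ 1/2, hence the finitely many exceptions. The weight 1 + |c|
serves both `J` and `K`. -/
lemma kterm_le_kbound {τ : ℂ} (hτ : 0 < τ.im) (M : ℝ) {w : ℤ → ℂ}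
    (hw : ∀ c, ‖w c‖ ≤ 1 + |(c : ℝ)|) :
    ∀ᶠ c : ℤ in cofinite, ∀ z : ℂ, |z.im| ≤ M → ‖w c * kterm τ z c‖ ≤ kbound τ M c := by
  set r := Real.exp (-2 * Real.pi * τ.im) with hr
  have hr1 : r < 1 := by
    rw [hr, Real.exp_lt_one_iff]; nlinarith [Real.pi_pos]
  have hr0 : 0 < r := Real.exp_pos _
  have hlim : Tendsto (fun n : ℕ => Real.exp (2 * Real.pi * M) * r ^ n) atTop (𝓝 0) := by
    simpa using (tendsto_pow_atTop_nhds_zero_of_lt_one hr0.le hr1).const_mul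
      (Real.exp (2 * Real.pi * M))
  have hev : ∀ᶠ n : ℕ in atTop, Real.exp (2 * Real.pi * M) * r ^ n ≤ 1 / 2 :=
    hlim.eventually_le_const (by norm_num)
  obtain ⟨N, hN⟩ := eventually_atTop.mp hev
  have hfin : {c : ℤ | ¬ N ≤ c.natAbs}.Finite := by
    refine (Set.finite_Icc (-(N : ℤ)) N).subset fun c hc => ?_
    simp only [Set.mem_ofPred_eq, not_le] at hc
    exact ⟨by omega, by omega⟩
  filter_upwards [show ∀ᶠ c : ℤ in cofinite, N ≤ c.natAbs from hfin] with c hc z hz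
  have hpow : ∀ n : ℕ, r ^ n = Real.exp (n * (-2 * Real.pi * τ.im)) := fun n => by
    rw [hr, ← Real.exp_nat_mul]
  rw [norm_mul, kbound]
  refine mul_le_mul (hw c) ?_ (norm_nonneg _) (by positivity)
  rw [abs_le] at hz
  rw [kterm, sg]
  split_ifs with h0
  · have hX : ‖ee (z + c * τ)‖ ≤ Real.exp (2 * Real.pi * M) * r ^ c.natAbs := by
      rw [norm_ee, hpow, ← Real.exp_add, Real.exp_le_exp]
      have : ((c.natAbs : ℕ) : ℝ) = c := by
        rw [← Int.cast_natCast, Int.natAbs_of_nonneg h0]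
      rw [this]
      simp only [add_im, mul_im, intCast_re, intCast_im, zero_mul, add_zero]
      nlinarith [Real.pi_pos]
    have := norm_cth_add_half (hX.trans (hN _ hc))
    linarith
  · have hX : ‖(ee (z + c * τ))⁻¹‖ ≤ Real.exp (2 * Real.pi * M) * r ^ c.natAbs := by
      rw [← ee_neg, norm_ee, hpow, ← Real.exp_add, Real.exp_le_exp]
      have : ((c.natAbs : ℕ) : ℝ) = -c := by
        rw [← Int.cast_natCast, Int.ofNat_natAbs_of_nonpos (by omega), Int.cast_neg]
      rw [this]
      simp only [neg_im, add_im, mul_im, intCast_re, intCast_im, zero_mul, add_zero]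
      nlinarith [Real.pi_pos]
    have := norm_cth_sub_half (ee_ne_zero _) (hX.trans (hN _ hc))
    rw [neg_div, ← sub_eq_add_neg]
    linarith

lemma summable_norm_kterm {τ : ℂ} (hτ : 0 < τ.im) (z : ℂ) {w : ℤ → ℂ}
    (hw : ∀ c, ‖w c‖ ≤ 1 + |(c : ℝ)|) : Summable fun c => ‖w c * kterm τ z c‖ := by
  refine Summable.of_norm_bounded_eventually (summable_kbound hτ |z.im|) ?_
  filter_upwards [kterm_le_kbound hτ |z.im| hw] with c hc
  simpa using hc z le_rfl

lemma summable_kterm {τ : ℂ} (hτ : 0 < τ.im) (z : ℂ) {w : ℤ → ℂ}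
    (hw : ∀ c, ‖w c‖ ≤ 1 + |(c : ℝ)|) : Summable fun c => w c * kterm τ z c :=
  (summable_norm_kterm hτ z hw).of_norm

/-- The finitely many exceptional terms are bounded by compactness, which makes the Weierstrass test
applicable to all terms at once. -/
lemma exists_summable_bound {F : ℤ → ℂ → ℂ} {C : Set ℂ} (hC : IsCompact C)
    (hF : ∀ c, ContinuousOn (F c) C) {g : ℤ → ℝ} (hg : Summable g)
    (h : ∀ᶠ c in cofinite, ∀ z ∈ C, ‖F c z‖ ≤ g c) :
    ∃ u : ℤ → ℝ, Summable u ∧ ∀ c, ∀ z ∈ C, ‖F c z‖ ≤ u c := by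
  classical
  choose b hb using fun c => hC.exists_bound_of_continuousOn (hF c)
  refine ⟨fun c => if ∀ z ∈ C, ‖F c z‖ ≤ g c then g c else b c, ?_, fun c z hz => ?_⟩
  · refine hg.congr_cofinite ?_
    filter_upwards [h] with c hc
    rw [if_pos hc]
  · dsimp only
    split_ifs with hc
    · exact hc z hz
    · exact hb c z hz

lemma isClosed_latt {τ : ℂ} (hτ : 0 < τ.im) : IsClosed (latt τ) := by
  have : latt τ = {z : ℂ | ∃ n : ℤ, (n : ℝ) = z.im / τ.im} ∩
      {z : ℂ | ∃ n : ℤ, (n : ℝ) = z.re - z.im / τ.im * τ.re} := by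
    ext z
    constructor
    · rintro ⟨c, d, rfl⟩
      have : τ.im ≠ 0 := hτ.ne'
      refine ⟨⟨c, ?_⟩, ⟨d, ?_⟩⟩
      · simp; field_simp
      · simp; field_simp; ring
    · rintro ⟨⟨c, hc⟩, ⟨d, hd⟩⟩
      refine ⟨c, d, Complex.ext ?_ ?_⟩
      · simp; rw [hc, hd]; ring
      · simp; rw [hc]; field_simp
  rw [this]
  refine IsClosed.inter ?_ ?_
  · exact Int.isClosedEmbedding_coe_real.isClosed_range.preimage
      (f := fun z : ℂ => z.im / τ.im) (by fun_prop)
  · exact Int.isClosedEmbedding_coe_real.isClosed_range.preimage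
      (f := fun z : ℂ => z.re - z.im / τ.im * τ.re) (by fun_prop)

lemma countable_latt (τ : ℂ) : (latt τ).Countable := by
  have : latt τ = Set.range fun p : ℤ × ℤ => (p.1 : ℂ) * τ + p.2 := by
    ext z
    constructor
    · rintro ⟨c, d, rfl⟩; exact ⟨(c, d), rfl⟩
    · rintro ⟨⟨c, d⟩, rfl⟩; exact ⟨c, d, rfl⟩
  rw [this]
  exact Set.countable_range _

/-- The derivative of a term of the series. -/
def ktermD (τ z : ℂ) (c : ℤ) : ℂ :=
  -(2 * Real.pi * I) * (ee (z + c * τ) / (ee (z + c * τ) - 1) ^ 2)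

lemma hasDerivAt_kterm {τ z : ℂ} {c : ℤ} (h : ee (z + c * τ) ≠ 1) :
    HasDerivAt (fun z => kterm τ z c) (ktermD τ z c) z := by
  have h' : ee (z + c * τ) - 1 ≠ 0 := sub_ne_zero.mpr h
  have h1 : HasDerivAt (fun z => ee (z + c * τ)) (2 * Real.pi * I * ee (z + c * τ)) z := by
    exact (HasDerivAt.comp z (hasDerivAt_ee (z + c * τ))
      ((hasDerivAt_id z).add_const (c * τ))).congr_deriv (mul_one _)
  have h2 := (((h1.add_const 1).div (h1.sub_const 1) h').div_const 2).add_const (sg c / 2)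
  refine h2.congr_deriv ?_
  rw [ktermD]
  field_simp
  ring

/-- Near a point off the lattice, the series converges normally. -/
lemma exists_nhds_bound {τ : ℂ} (hτ : 0 < τ.im) {w : ℤ → ℂ}
    (hw : ∀ c, ‖w c‖ ≤ 1 + |(c : ℝ)|) {z₀ : ℂ} (hz : z₀ ∉ latt τ) :
    ∃ U : Set ℂ, IsOpen U ∧ z₀ ∈ U ∧ (∀ z ∈ U, z ∉ latt τ) ∧ ∃ u : ℤ → ℝ, Summable u ∧
      ∀ c, ∀ z ∈ U, ‖w c * kterm τ z c‖ ≤ u c := by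
  obtain ⟨ε, hε, hball⟩ := Metric.isOpen_iff.mp (isClosed_latt hτ).isOpen_compl z₀ hz
  have hsub : Metric.closedBall z₀ (ε / 2) ⊆ (latt τ)ᶜ :=
    (Metric.closedBall_subset_ball (by linarith)).trans hball
  obtain ⟨u, hu, hb⟩ := exists_summable_bound (F := fun c z => w c * kterm τ z c)
    (isCompact_closedBall z₀ (ε / 2))
    (fun c z hz' => ((hasDerivAt_kterm
      (ee_ne_one_of_notMem (hsub hz') c)).continuousAt.const_mul _ ).continuousWithinAt)
    (summable_kbound hτ (|z₀.im| + ε / 2))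
    (by
      filter_upwards [kterm_le_kbound hτ (|z₀.im| + ε / 2) hw] with c hc z hz'
      refine hc z ?_
      have h1 : |(z - z₀).im| ≤ ε / 2 := (Complex.abs_im_le_norm _).trans
        (by rwa [← dist_eq_norm])
      rw [sub_im] at h1
      have := abs_add_le (z.im - z₀.im) z₀.im
      rw [sub_add_cancel] at this
      linarith)
  exact ⟨Metric.ball z₀ (ε / 2), Metric.isOpen_ball, Metric.mem_ball_self (by linarith),
    fun z hz' => hsub (Metric.ball_subset_closedBall hz'), u, hu,
    fun c z hz' => hb c z (Metric.ball_subset_closedBall hz')⟩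

lemma hasDerivAt_kser {τ : ℂ} (hτ : 0 < τ.im) {w : ℤ → ℂ}
    (hw : ∀ c, ‖w c‖ ≤ 1 + |(c : ℝ)|) {z : ℂ} (hz : z ∉ latt τ) :
    (Summable fun c => w c * ktermD τ z c) ∧
    HasDerivAt (kser w τ) (∑' c, w c * ktermD τ z c) z := by
  obtain ⟨U, hU, hzU, hUl, u, hu, hb⟩ := exists_nhds_bound hτ hw hz
  have hd : ∀ c, DifferentiableOn ℂ (fun z => w c * kterm τ z c) U := fun c z hz =>
    ((hasDerivAt_kterm (ee_ne_one_of_notMem (hUl z hz) c)).const_mul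
      (w c)).differentiableAt.differentiableWithinAt
  have h1 := Complex.differentiableOn_tsum_of_summable_norm hu hd hU hb
  have h2 := Complex.hasSum_deriv_of_summable_norm hu hd hU hb hzU
  have h3 : ∀ c, deriv (fun z => w c * kterm τ z c) z = w c * ktermD τ z c := fun c =>
    ((hasDerivAt_kterm (ee_ne_one_of_notMem (hUl z hzU) c)).const_mul (w c)).deriv
  simp only [h3] at h2
  refine ⟨h2.summable, ?_⟩
  have h4 := (h1.differentiableAt (hU.mem_nhds hzU)).hasDerivAt
  rw [← h2.tsum_eq] at h4
  exact h4

lemma one_weight (c : ℤ) : ‖(1 : ℂ)‖ ≤ 1 + |(c : ℝ)| := by simp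

lemma id_weight (c : ℤ) : ‖(c : ℂ)‖ ≤ 1 + |(c : ℝ)| := by simp

/-- The function `(2πi)⁻¹ ∂_z log θ + 1/2`. -/
def J (τ z : ℂ) : ℂ := kser (fun _ => 1) τ z

/-- The first moment of the series defining `J`. -/
def K (τ z : ℂ) : ℂ := kser (fun c => c) τ z

lemma J_def (τ z : ℂ) : J τ z = ∑' c, kterm τ z c := by simp [J, kser]

lemma differentiableAt_J {τ : ℂ} (hτ : 0 < τ.im) {z : ℂ} (hz : z ∉ latt τ) :
    DifferentiableAt ℂ (J τ) z := (hasDerivAt_kser hτ one_weight hz).2.differentiableAt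

lemma differentiableAt_K {τ : ℂ} (hτ : 0 < τ.im) {z : ℂ} (hz : z ∉ latt τ) :
    DifferentiableAt ℂ (K τ) z := (hasDerivAt_kser hτ id_weight hz).2.differentiableAt

/-- The shift by τ moves the index by one, and `sg` jumps between -1 and 0. This single jump is the
source of the quasi-periods of `J` and `K`. -/
lemma kterm_add_tau (τ z : ℂ) (c : ℤ) :
    kterm τ (z + τ) c = kterm τ z (c + 1) - (if c + 1 = 0 then 1 else 0) := by
  have : z + τ + c * τ = z + (c + 1 : ℤ) * τ := by push_cast; ring
  rw [kterm, kterm, this, sg, sg]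
  split_ifs <;> first | omega | ring

lemma hasSum_kterm {τ : ℂ} (hτ : 0 < τ.im) (z : ℂ) : HasSum (kterm τ z) (J τ z) := by
  have := (summable_kterm hτ z one_weight).hasSum
  simpa [J, kser] using this

lemma hasSum_mul_kterm {τ : ℂ} (hτ : 0 < τ.im) (z : ℂ) :
    HasSum (fun c : ℤ => (c : ℂ) * kterm τ z c) (K τ z) :=
  (summable_kterm hτ z id_weight).hasSum

lemma J_add_tau {τ : ℂ} (hτ : 0 < τ.im) (z : ℂ) : J τ (z + τ) = J τ z - 1 := by
  have h1 : HasSum (fun c : ℤ => kterm τ z c - (if c = 0 then 1 else 0)) (J τ z - 1) :=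
    (hasSum_kterm hτ z).sub (hasSum_ite_eq 0 1)
  have h2 := (Equiv.addRight (1 : ℤ)).hasSum_iff.mpr h1
  rw [J_def, ← h2.tsum_eq]
  exact tsum_congr fun c => by simp [kterm_add_tau]

lemma K_add_tau {τ : ℂ} (hτ : 0 < τ.im) (z : ℂ) : K τ (z + τ) = K τ z - J τ z + 1 := by
  have h1 : HasSum (fun c : ℤ => (c : ℂ) * kterm τ z c - kterm τ z c + (if c = 0 then 1 else 0))
      (K τ z - J τ z + 1) :=
    ((hasSum_mul_kterm hτ z).sub (hasSum_kterm hτ z)).add (hasSum_ite_eq 0 1)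
  have h2 := (Equiv.addRight (1 : ℤ)).hasSum_iff.mpr h1
  rw [K, kser, ← h2.tsum_eq]
  refine tsum_congr fun c => ?_
  simp only [kterm_add_tau, Function.comp_apply, Equiv.coe_addRight]
  split_ifs with h
  · have : (c : ℂ) = -1 := by rw [eq_neg_iff_add_eq_zero]; exact_mod_cast h
    rw [this]; push_cast; rw [this]; ring
  · push_cast; ring

lemma kterm_add_int (τ z : ℂ) (n : ℤ) (c : ℤ) : kterm τ (z + n) c = kterm τ z c := by
  rw [kterm, kterm, show z + n + c * τ = z + c * τ + n by ring, ee_add _ (n : ℂ), ee_int, mul_one]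

lemma kser_add_int (w : ℤ → ℂ) (τ z : ℂ) (n : ℤ) : kser w τ (z + n) = kser w τ z := by
  simp only [kser, kterm_add_int]

lemma J_add_int (τ z : ℂ) (n : ℤ) : J τ (z + n) = J τ z := kser_add_int _ τ z n

lemma K_add_int (τ z : ℂ) (n : ℤ) : K τ (z + n) = K τ z := kser_add_int _ τ z n

lemma kser_add_one_tau (w : ℤ → ℂ) (τ z : ℂ) : kser w (τ + 1) z = kser w τ z := by
  simp only [kser, kterm]
  refine tsum_congr fun c => ?_
  rw [show z + c * (τ + 1) = z + c * τ + c by ring, ee_add _ (c : ℂ), ee_int, mul_one]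

/-- Every term is odd under (z, c) ↦ (-z, -c) except at c = 0, where the convention `sg 0 = 1`
produces the 1. -/
lemma J_neg {τ : ℂ} (hτ : 0 < τ.im) (z : ℂ) : J τ (-z) = 1 - J τ z := by
  have h1 : HasSum (fun c : ℤ => -kterm τ z c + (if c = 0 then 1 else 0)) (-J τ z + 1) :=
    (hasSum_kterm hτ z).neg.add (hasSum_ite_eq 0 1)
  have h2 := (Equiv.neg ℤ).hasSum_iff.mpr h1
  rw [J_def, sub_eq_neg_add, ← h2.tsum_eq]
  refine tsum_congr fun c => ?_
  simp only [kterm, Function.comp_apply, Equiv.neg_apply, sg]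
  rw [show -z + c * τ = -(z + (-c : ℤ) * τ) by push_cast; ring, ee_neg, cth_inv (ee_ne_zero _)]
  split_ifs <;> first | omega | ring

/-- Multiplication formula for the cotangent. -/
lemma sum_cth_root {n : ℕ} (hn : n ≠ 0) (X : ℂ) :
    ∑ j ∈ Finset.range n, cth (X * ee (j / n)) = n * cth (X ^ n) := by
  have hn' : (n : ℂ) ≠ 0 := by exact_mod_cast hn
  set ζ : ℂ := ee (1 / n) with hζ
  have hpr : IsPrimitiveRoot ζ n := by
    have := Complex.isPrimitiveRoot_exp n hn
    rw [hζ, ee]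
    convert this using 2
    ring
  have hj : ∀ j : ℕ, ee (j / n) = ζ ^ j := fun j => by
    rw [hζ, ← ee_nat_mul]; congr 1; ring
  simp only [hj]
  -- If X is an n-th root of unity, the sum runs over all n-th roots and cancels in pairs by
  -- oddness, the pole contributing 0.
  by_cases hX : X ^ n = 1
  · have : NeZero n := ⟨hn⟩
    obtain ⟨i, hi, rfl⟩ := hpr.eq_pow_of_pow_eq_one hX
    rw [hX, cth_one, mul_zero]
    have hfun : ∀ m : ℤ, ∀ m' : ℤ, (m : ZMod n) = m' → ζ ^ m = ζ ^ m' := by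
      intro m m' h
      rw [ZMod.intCast_eq_intCast_iff] at h
      obtain ⟨k, hk⟩ := h.dvd
      rw [show m' = m + n * k by linarith, zpow_add₀ (ee_ne_zero _), zpow_mul, zpow_natCast,
        hpr.pow_eq_one, one_zpow, mul_one]
    have hz : ∑ j ∈ Finset.range n, cth (ζ ^ i * ζ ^ j) =
        ∑ x : ZMod n, cth (ζ ^ ((x.val : ℤ))) := by
      rw [← Fin.sum_univ_eq_sum_range (fun j => cth (ζ ^ i * ζ ^ j)) n]
      refine Fintype.sum_equiv
        (((ZMod.finEquiv n).toEquiv).trans (Equiv.addRight (i : ZMod n))) _ _ fun j => ?_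
      rw [← pow_add, ← zpow_natCast]
      congr 1
      apply hfun
      have : ((ZMod.finEquiv n j : ZMod n)) = ((j : ℕ) : ZMod n) := by
        obtain ⟨m, rfl⟩ := Nat.exists_eq_succ_of_ne_zero hn
        exact (Fin.cast_val_eq_self j).symm
      simp [this, add_comm]
    rw [hz]
    have hneg : ∑ x : ZMod n, cth (ζ ^ ((x.val : ℤ))) =
        ∑ x : ZMod n, -cth (ζ ^ ((x.val : ℤ))) := by
      refine Fintype.sum_equiv (Equiv.neg (ZMod n)) _ _ fun x => ?_
      rw [Equiv.neg_apply, ← cth_inv (zpow_ne_zero _ (ee_ne_zero _)), ← zpow_neg]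
      congr 1
      apply hfun
      simp
    rw [Finset.sum_neg_distrib] at hneg
    linear_combination hneg / 2
  -- Otherwise write 1/(Xζʲ - 1) as a finite geometric sum over Xⁿ - 1. Summation over j kills every
  -- power of X except the zeroth.
  · have hX1 : ∀ j, X * ζ ^ j ≠ 1 := by
      intro j hj
      apply hX
      have := congrArg (· ^ n) hj
      simp only [mul_pow, one_pow, ← pow_mul, mul_comm j n] at this
      rwa [pow_mul, hpr.pow_eq_one, one_pow, mul_one] at this
    have h1 : ∀ j, cth (X * ζ ^ j) = 1 / 2 + 1 / (X * ζ ^ j - 1) := fun j => by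
      rw [← cth_sub_half (hX1 j)]; ring
    have h2 : ∀ j, 1 / (X * ζ ^ j - 1) =
        (∑ k ∈ Finset.range n, X ^ k * (ζ ^ k) ^ j) / (X ^ n - 1) := by
      intro j
      have hd : X * ζ ^ j - 1 ≠ 0 := sub_ne_zero.mpr (hX1 j)
      have hd' : X ^ n - 1 ≠ 0 := sub_ne_zero.mpr hX
      rw [div_eq_div_iff hd hd', one_mul]
      have hg := geom_sum_mul (X * ζ ^ j) n
      rw [mul_pow, ← pow_mul, mul_comm j n, pow_mul ζ n j, hpr.pow_eq_one, one_pow, mul_one] at hg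
      rw [← hg]
      congr 1
      refine Finset.sum_congr rfl fun k _ => ?_
      rw [mul_pow, ← pow_mul, ← pow_mul, mul_comm j k]
    have h3 : ∑ j ∈ Finset.range n, ∑ k ∈ Finset.range n, X ^ k * (ζ ^ k) ^ j = n := by
      rw [Finset.sum_comm]
      rw [Finset.sum_eq_single 0]
      · simp
      · intro k hk hk0
        rw [← Finset.mul_sum]
        have hne : ζ ^ k ≠ 1 := hpr.pow_ne_one_of_pos_of_lt hk0 (Finset.mem_range.mp hk)
        have := geom_sum_mul (ζ ^ k) n
        rw [← pow_mul, mul_comm k n, pow_mul, hpr.pow_eq_one, one_pow, sub_self] at this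
        rw [(mul_eq_zero.mp this).resolve_right (sub_ne_zero.mpr hne), mul_zero]
      · intro h; simp [Nat.pos_of_ne_zero hn] at h
    have h4 := congrArg (· / (X ^ n - 1)) h3
    simp only [Finset.sum_div (Finset.range n) (fun j => ∑ k ∈ Finset.range n, _)] at h4
    simp only [h1, h2]
    rw [Finset.sum_add_distrib, h4, show cth (X ^ n) =
      1 / 2 + 1 / (X ^ n - 1) by rw [← cth_sub_half hX]; ring]
    simp
    ring

lemma kser_sum_root {n : ℕ} (hn : n ≠ 0) {w : ℤ → ℂ} (hw : ∀ c, ‖w c‖ ≤ 1 + |(c : ℝ)|)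
    {τ : ℂ} (hτ : 0 < τ.im) (z : ℂ) :
    ∑ j ∈ Finset.range n, kser w τ (z + j / n) = n * kser w (n * τ) (n * z) := by
  simp only [kser]
  rw [← Summable.tsum_finsetSum fun j _ => summable_kterm hτ _ hw, ← tsum_mul_left]
  refine tsum_congr fun c => ?_
  rw [← Finset.mul_sum]
  simp only [kterm]
  rw [Finset.sum_add_distrib]
  have : ∀ j : ℕ, z + j / n + c * τ = z + c * τ + j / n := fun j => by ring
  simp only [this, ee_add _ ((_ : ℂ) / (n : ℂ))]
  rw [sum_cth_root hn, ← ee_nat_mul]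
  simp
  rw [show (n : ℂ) * (z + c * τ) = n * z + c * (n * τ) by ring]
  ring

lemma tsum_int_split {n : ℕ} (hn : n ≠ 0) {f : ℤ → ℂ} (hf : Summable f) :
    ∑' c, f c = ∑ j ∈ Finset.range n, ∑' c : ℤ, f (n * c + j) := by
  have : NeZero n := ⟨hn⟩
  rw [← (Int.divModEquiv n).symm.tsum_eq f]
  have hs := (Int.divModEquiv n).symm.summable_iff.mpr hf
  rw [Function.comp_def] at hs
  rw [hs.tsum_prod' (fun c => Summable.of_finite) , ← Fin.sum_univ_eq_sum_range
    (fun j => ∑' c : ℤ, f (n * c + j)) n]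
  simp only [tsum_fintype]
  rw [Summable.tsum_finsetSum]
  · refine Finset.sum_congr rfl fun j _ => tsum_congr fun c => ?_
    congr 1
    simp [Int.divModEquiv]; ring
  · intro j _
    exact hs.comp_injective (fun a b h => (Prod.ext_iff.mp h).1)

/-- With residues taken in 0 ≤ j < n, the integers nc + j and c have the same `sg`, so no correction
arises. -/
lemma kterm_div {n : ℕ} (hn : n ≠ 0) (τ z : ℂ) (c : ℤ) {j : ℕ} (hj : j < n) :
    kterm (τ / n) z (n * c + j) = kterm τ (z + j * τ / n) c := by
  have hn' : (n : ℂ) ≠ 0 := by exact_mod_cast hn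
  rw [kterm, kterm]
  congr 2
  · congr 1; push_cast; field_simp; ring
  · have : 0 ≤ (n * c + j : ℤ) ↔ 0 ≤ c := by
      have hn0 : (0 : ℤ) < n := by exact_mod_cast Nat.pos_of_ne_zero hn
      have hj' : (j : ℤ) < n := by exact_mod_cast hj
      constructor
      · intro h; by_contra hc; nlinarith
      · intro h; positivity
    simp only [sg, this]

lemma im_div_pos {τ : ℂ} (hτ : 0 < τ.im) {n : ℕ} (hn : n ≠ 0) : 0 < (τ / n).im := by
  rw [Complex.div_natCast_im]
  positivity

end ToricHecke

/-! ### Doubly periodic functions of torsion points and their distribution relations. -/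

namespace ToricHecke

open Complex Filter Topology

/-! ### The weight one series `S` and the weight two series `E` -/

/-- The weight one Eisenstein series attached to the torsion point `aτ + b`. -/
def S (τ : ℂ) (a b : ℝ) : ℂ := J τ (a * τ + b) + a - 1 / 2

/-- The weight two Eisenstein series attached to the character given by `(a, b)`. -/
def E (τ : ℂ) (a b : ℝ) : ℂ :=
  -(K τ (a * τ + b) + a * J τ (a * τ + b) + (a ^ 2 - a + 1 / 6) / 2)

lemma S_add_one_left {τ : ℂ} (hτ : 0 < τ.im) (a b : ℝ) : S τ (a + 1) b = S τ a b := by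
  rw [S, S, show ((a + 1 : ℝ) : ℂ) * τ + b = a * τ + b + τ by push_cast; ring, J_add_tau hτ]
  push_cast; ring

lemma S_add_one_right (τ : ℂ) (a b : ℝ) : S τ a (b + 1) = S τ a b := by
  rw [S, S, show (a : ℂ) * τ + ((b + 1 : ℝ) : ℂ) = a * τ + b + (1 : ℤ) by push_cast; ring,
    J_add_int]

/-- The terms aJ and B₂(a)/2, with B₂(a) = a² - a + 1/6, compensate the quasi-periods of `K` and
`J`. Periodicity would allow any constant; 1/6 is the one required by `E_div`. -/
lemma E_add_one_left {τ : ℂ} (hτ : 0 < τ.im) (a b : ℝ) : E τ (a + 1) b = E τ a b := by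
  rw [E, E, show ((a + 1 : ℝ) : ℂ) * τ + b = a * τ + b + τ by push_cast; ring, J_add_tau hτ,
    K_add_tau hτ]
  push_cast; ring

lemma E_add_one_right (τ : ℂ) (a b : ℝ) : E τ a (b + 1) = E τ a b := by
  rw [E, E, show (a : ℂ) * τ + ((b + 1 : ℝ) : ℂ) = a * τ + b + (1 : ℤ) by push_cast; ring,
    J_add_int, K_add_int]

lemma S_neg {τ : ℂ} (hτ : 0 < τ.im) (a b : ℝ) : S τ (-a) (-b) = -S τ a b := by
  rw [S, S, show ((-a : ℝ) : ℂ) * τ + ((-b : ℝ) : ℂ) = -(a * τ + b) by push_cast; ring, J_neg hτ]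
  push_cast; ring

lemma S_zero {τ : ℂ} (hτ : 0 < τ.im) : S τ 0 0 = 0 := by
  have := S_neg hτ 0 0
  rw [neg_zero] at this
  linear_combination this / 2

lemma S_tau_add_one (τ : ℂ) (a b : ℝ) : S (τ + 1) a b = S τ a (a + b) := by
  rw [S, S, J, J, kser_add_one_tau]
  push_cast
  ring_nf

lemma J_div {τ : ℂ} (hτ : 0 < τ.im) {n : ℕ} (hn : n ≠ 0) (z : ℂ) :
    J (τ / n) z = ∑ j ∈ Finset.range n, J τ (z + j * τ / n) := by
  rw [J_def, tsum_int_split hn (hasSum_kterm (im_div_pos hτ hn) z).summable]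
  refine Finset.sum_congr rfl fun j hj => ?_
  rw [J_def]
  exact tsum_congr fun c => kterm_div hn τ z c (Finset.mem_range.mp hj)

lemma K_div {τ : ℂ} (hτ : 0 < τ.im) {n : ℕ} (hn : n ≠ 0) (z : ℂ) :
    K (τ / n) z = ∑ j ∈ Finset.range n, (n * K τ (z + j * τ / n) + j * J τ (z + j * τ / n)) := by
  rw [K, kser, tsum_int_split hn (hasSum_mul_kterm (im_div_pos hτ hn) z).summable]
  refine Finset.sum_congr rfl fun j hj => ?_
  rw [← (((hasSum_mul_kterm hτ _).mul_left (n : ℂ)).add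
    ((hasSum_kterm hτ _).mul_left (j : ℂ))).tsum_eq]
  refine tsum_congr fun c => ?_
  rw [kterm_div hn τ z c (Finset.mem_range.mp hj)]
  push_cast
  ring

lemma S_div {τ : ℂ} (hτ : 0 < τ.im) {n : ℕ} (hn : n ≠ 0) (a b : ℝ) :
    S (τ / n) a b = ∑ j ∈ Finset.range n, S τ ((a + j) / n) b := by
  have hn' : (n : ℂ) ≠ 0 := by exact_mod_cast hn
  have h1 : ∀ j : ℕ, (((a + j) / n : ℝ) : ℂ) * τ + b = a * (τ / n) + b + j * τ / n := fun j => by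
    push_cast; field_simp; ring
  have h2 : ∑ j ∈ Finset.range n, ((((a + j) / n : ℝ) : ℂ) - 1 / 2) = a - 1 / 2 := by
    -- The upper limit is freed from n so that induction applies; at m = n this is the distribution
    -- relation of B₁. The same device gives that of B₂ in `E_div`.
    have : ∀ m : ℕ, ∑ j ∈ Finset.range m, ((((a + j) / n : ℝ) : ℂ) - 1 / 2) =
        (m * a + m * (m - 1) / 2) / n - m / 2 := by
      intro m
      induction m with
      | zero => simp
      | succ m ih => rw [Finset.sum_range_succ, ih]; push_cast; field_simp; ring
    rw [this]; field_simp; ring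
  simp only [S, h1]
  rw [J_div hτ hn]
  simp only [add_sub_assoc]
  rw [Finset.sum_add_distrib, h2]

lemma E_div {τ : ℂ} (hτ : 0 < τ.im) {n : ℕ} (hn : n ≠ 0) (a b : ℝ) :
    E (τ / n) a b = n * ∑ j ∈ Finset.range n, E τ ((a + j) / n) b := by
  have hn' : (n : ℂ) ≠ 0 := by exact_mod_cast hn
  have h1 : ∀ j : ℕ, (((a + j) / n : ℝ) : ℂ) * τ + b = a * (τ / n) + b + j * τ / n := fun j => by
    push_cast; field_simp; ring
  have h2 : ∑ j ∈ Finset.range n, (n * (((((a + j) / n : ℝ) : ℂ) ^ 2 -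
      (((a + j) / n : ℝ) : ℂ) + 1 / 6) / 2)) = ((a : ℂ) ^ 2 - a + 1 / 6) / 2 := by
    have : ∀ m : ℕ, ∑ j ∈ Finset.range m, (n * (((((a + j) / n : ℝ) : ℂ) ^ 2 -
      (((a + j) / n : ℝ) : ℂ) + 1 / 6) / 2)) = ((m * (a : ℂ) ^ 2 + a * m * (m - 1) +
        m * (m - 1) * (2 * m - 1) / 6) / n - (m * a + m * (m - 1) / 2) + n * m / 6) / 2 := by
      intro m
      induction m with
      | zero => simp
      | succ m ih => rw [Finset.sum_range_succ, ih]; push_cast; field_simp; ring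
    rw [this]; field_simp; ring
  simp only [E, h1]
  rw [J_div hτ hn, K_div hτ hn, ← h2, Finset.mul_sum, Finset.mul_sum, ← Finset.sum_add_distrib,
    ← Finset.sum_add_distrib, ← Finset.sum_neg_distrib]
  refine Finset.sum_congr rfl fun j _ => ?_
  push_cast
  field_simp
  ring

lemma S_root {τ : ℂ} (hτ : 0 < τ.im) {n : ℕ} (hn : n ≠ 0) (a b : ℝ) :
    ∑ j ∈ Finset.range n, S τ a (b + j / n) = n * S (n * τ) a (n * b) := by
  have h1 : ∀ j : ℕ, (a : ℂ) * τ + ((b + j / n : ℝ) : ℂ) = a * τ + b + j / n := fun j => by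
    push_cast; ring
  simp only [S, h1, add_sub_assoc]
  rw [Finset.sum_add_distrib]
  have := kser_sum_root hn one_weight hτ (a * τ + b)
  rw [show (n : ℂ) * (a * τ + b) = a * (n * τ) + ((n * b : ℝ) : ℂ) by push_cast; ring] at this
  simp only [J]
  rw [this]
  simp
  ring

lemma E_root {τ : ℂ} (hτ : 0 < τ.im) {n : ℕ} (hn : n ≠ 0) (a b : ℝ) :
    ∑ j ∈ Finset.range n, E τ a (b + j / n) = n * E (n * τ) a (n * b) := by
  have h1 : ∀ j : ℕ, (a : ℂ) * τ + ((b + j / n : ℝ) : ℂ) = a * τ + b + j / n := fun j => by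
    push_cast; ring
  simp only [E, h1]
  rw [Finset.sum_neg_distrib, Finset.sum_add_distrib, Finset.sum_add_distrib, ← Finset.mul_sum]
  have h2 := kser_sum_root hn one_weight hτ (a * τ + b)
  have h3 := kser_sum_root hn id_weight hτ (a * τ + b)
  rw [show (n : ℂ) * (a * τ + b) = a * (n * τ) + ((n * b : ℝ) : ℂ) by push_cast; ring] at h2 h3
  simp only [J, K]
  rw [h2, h3]
  simp
  ring

lemma im_mul_pos {τ : ℂ} (hτ : 0 < τ.im) {n : ℕ} (hn : n ≠ 0) : 0 < ((n : ℂ) * τ).im := by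
  have : ((n : ℂ) * τ).im = n * τ.im := by simp
  rw [this]
  positivity

/-- The distribution relation for `S`. -/
lemma S_distribution {τ : ℂ} (hτ : 0 < τ.im) {n : ℕ} (hn : n ≠ 0) (a b : ℝ) :
    ∑ i ∈ Finset.range n, ∑ j ∈ Finset.range n, S τ ((a + i) / n) ((b + j) / n) = n * S τ a b := by
  have hn' : (n : ℂ) ≠ 0 := by exact_mod_cast hn
  have hn'' : (n : ℝ) ≠ 0 := by exact_mod_cast hn
  have h1 : ∀ i : ℕ, ∑ j ∈ Finset.range n, S τ ((a + i) / n) ((b + j) / n) =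
      n * S (n * τ) ((a + i) / n) b := fun i => by
    have := S_root hτ hn ((a + i) / n) (b / n)
    rw [show n * (b / n) = b by field_simp] at this
    simpa only [← add_div] using this
  have h2 := S_div (im_mul_pos hτ hn) hn a b
  rw [show (n : ℂ) * τ / n = τ by field_simp] at h2
  rw [Finset.sum_congr rfl fun i _ => h1 i, ← Finset.mul_sum, h2]

/-- The distribution relation for `E`. -/
lemma E_distribution {τ : ℂ} (hτ : 0 < τ.im) {n : ℕ} (hn : n ≠ 0) (a b : ℝ) :
    ∑ i ∈ Finset.range n, ∑ j ∈ Finset.range n, E τ ((a + i) / n) ((b + j) / n) = E τ a b := by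
  have hn' : (n : ℂ) ≠ 0 := by exact_mod_cast hn
  have hn'' : (n : ℝ) ≠ 0 := by exact_mod_cast hn
  have h1 : ∀ i : ℕ, ∑ j ∈ Finset.range n, E τ ((a + i) / n) ((b + j) / n) =
      n * E (n * τ) ((a + i) / n) b := fun i => by
    have := E_root hτ hn ((a + i) / n) (b / n)
    rw [show n * (b / n) = b by field_simp] at this
    simpa only [← add_div] using this
  have h2 := E_div (im_mul_pos hτ hn) hn a b
  rw [show (n : ℂ) * τ / n = τ by field_simp] at h2
  rw [Finset.sum_congr rfl fun i _ => h1 i, ← Finset.mul_sum, h2]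

/-! ### The weight two series `P` -/

/-- The series `∑ (u + d)⁻²`. -/
def psum (u : ℂ) : ℂ := ∑' d : ℤ, (u + d) ^ (-2 : ℤ)

lemma summable_psum (u : ℂ) : Summable fun d : ℤ => (u + d) ^ (-2 : ℤ) := by
  have := EisensteinSeries.linear_right_summable u 1 (k := 2) (by norm_num)
  simpa [zpow_neg] using this

lemma psum_add_int (u : ℂ) (n : ℤ) : psum (u + n) = psum u := by
  rw [psum, psum, ← (Equiv.addLeft n).tsum_eq fun d : ℤ => (u + d) ^ (-2 : ℤ)]
  refine tsum_congr fun d => ?_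
  simp only [Equiv.coe_addLeft]
  push_cast
  ring_nf

lemma psum_neg (u : ℂ) : psum (-u) = psum u := by
  rw [psum, psum, ← (Equiv.neg ℤ).tsum_eq fun d : ℤ => (u + d) ^ (-2 : ℤ)]
  refine tsum_congr fun d => ?_
  simp only [Equiv.neg_apply]
  rw [show -u + d = -(u + (-d : ℤ)) by push_cast; ring, Even.neg_zpow (by decide)]

/-- Lipschitz's formula, with the q-series Σ n qⁿ summed in closed form. -/
lemma psum_of_im_pos {u : ℂ} (hu : 0 < u.im) :
    psum u = (2 * Real.pi * I) ^ 2 * (ee u / (ee u - 1) ^ 2) := by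
  have h := EisensteinSeries.qExpansion_identity (k := 1) le_rfl ⟨u, hu⟩
  have hlt : ‖ee u‖ < 1 := by
    rw [norm_ee, Real.exp_lt_one_iff]; nlinarith [Real.pi_pos]
  have h2 := tsum_coe_mul_geometric_of_norm_lt_one hlt
  have h3 : ∀ n : ℕ, (n : ℂ) ^ 1 * cexp (2 * Real.pi * I * u) ^ n = n * ee u ^ n := fun n => by
    rw [pow_one, ee]
  simp only [h3, h2] at h
  rw [psum]
  refine (tsum_congr fun d => ?_).trans (h.trans ?_)
  · change _ = 1 / (u + d) ^ 2
    rw [zpow_neg, one_div]; rfl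
  · simp only [Nat.reduceAdd, Nat.factorial_one, Nat.cast_one, div_one]
    rw [show (1 - ee u) ^ 2 = (ee u - 1) ^ 2 by ring]
    ring

lemma psum_of_im_ne_zero {u : ℂ} (hu : u.im ≠ 0) :
    psum u = (2 * Real.pi * I) ^ 2 * (ee u / (ee u - 1) ^ 2) := by
  rcases lt_or_gt_of_ne hu with h | h
  · rw [← psum_neg, psum_of_im_pos (by simpa using h), ee_neg]
    have h0 := ee_ne_zero u
    have h1 : ee u - 1 ≠ 0 := by
      rw [sub_ne_zero]
      intro h1
      have := norm_ee u
      rw [h1, norm_one, eq_comm, Real.exp_eq_one_iff] at this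
      simp [Real.pi_ne_zero, hu] at this
    have h2 : (ee u)⁻¹ - 1 = -(ee u - 1) / ee u := by field_simp; ring
    rw [h2]
    field_simp
  · exact psum_of_im_pos h

/-- Needed to pass from non-real u, where the q-expansion applies, to real non-integral u. -/
lemma psum_continuousAt {u₀ : ℂ} (hu : ∀ n : ℤ, u₀ ≠ n) : ContinuousAt psum u₀ := by
  have hopen : IsOpen (Set.range ((↑) : ℤ → ℂ))ᶜ := Complex.isOpen_compl_range_intCast
  obtain ⟨ε, hε, hball⟩ := Metric.isOpen_iff.mp hopen u₀ (by
    rintro ⟨n, hn⟩; exact hu n hn.symm)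
  have hsub : Metric.closedBall u₀ (ε / 2) ⊆ (Set.range ((↑) : ℤ → ℂ))ᶜ :=
    (Metric.closedBall_subset_ball (by linarith)).trans hball
  have hne : ∀ u ∈ Metric.closedBall u₀ (ε / 2), ∀ d : ℤ, u + d ≠ 0 := by
    intro u hu' d h
    refine hsub hu' ⟨-d, ?_⟩
    push_cast; linear_combination -h
  have hs : Summable fun d : ℤ => 4 * ((|(d : ℝ)|) ^ 2)⁻¹ := by
    have := (Real.summable_one_div_int_pow.mpr (show 1 < 2 by norm_num)).mul_left 4
    simpa [sq_abs] using this
  obtain ⟨b, hb, hbd⟩ := exists_summable_bound (F := fun (d : ℤ) u => (u + d) ^ (-2 : ℤ))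
    (isCompact_closedBall u₀ (ε / 2))
    (fun d u hu' => ((continuousAt_id.add continuousAt_const).zpow₀ _
      (Or.inl (hne u hu' d))).continuousWithinAt) hs (by
      set M := ‖u₀‖ + ε / 2 with hM
      have hfin : {d : ℤ | ¬ 2 * M < |(d : ℝ)|}.Finite := by
        refine (Set.finite_Icc (-⌈2 * M⌉) ⌈2 * M⌉).subset fun d hd => ?_
        simp only [Set.mem_ofPred_eq, not_lt] at hd
        rw [abs_le] at hd
        have := Int.le_ceil (2 * M)
        constructor
        · have : (((-⌈2 * M⌉ : ℤ)) : ℝ) ≤ d := by push_cast; linarith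
          exact_mod_cast this
        · have : (d : ℝ) ≤ ⌈2 * M⌉ := by linarith
          exact_mod_cast this
      filter_upwards [show ∀ᶠ d : ℤ in cofinite, 2 * M < |(d : ℝ)| from hfin] with d hd u hu'
      have hu1 : ‖u‖ ≤ M := by
        have := norm_add_le u₀ (u - u₀)
        rw [add_sub_cancel, ← dist_eq_norm] at this
        have h2 := Metric.mem_closedBall.mp hu'
        linarith
      have hd2 : |(d : ℝ)| / 2 ≤ ‖u + d‖ := by
        have h1 := norm_sub_norm_le (d : ℂ) (-u)
        rw [sub_neg_eq_add, norm_neg, Complex.norm_intCast, add_comm] at h1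
        linarith
      have hd0 : 0 < |(d : ℝ)| := by
        have : 0 ≤ M := (norm_nonneg u).trans hu1
        linarith
      rw [norm_zpow, zpow_neg, show (4 : ℝ) * (|(d : ℝ)| ^ 2)⁻¹ = ((|(d : ℝ)| / 2) ^ 2)⁻¹ by
        field_simp; norm_num]
      exact inv_anti₀ (by positivity) (pow_le_pow_left₀ (by positivity) hd2 2))
  have hcont : ContinuousOn psum (Metric.closedBall u₀ (ε / 2)) :=
    continuousOn_tsum (fun d u hu' => ((continuousAt_id.add continuousAt_const).zpow₀ _
      (Or.inl (hne u hu' d))).continuousWithinAt) hb hbd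
  exact hcont.continuousAt (Metric.closedBall_mem_nhds _ (by linarith))

/-- The partial fraction expansion of `π² / sin²(πu)`. -/
lemma psum_eq {u : ℂ} (hu : ee u ≠ 1) :
    psum u = (2 * Real.pi * I) ^ 2 * (ee u / (ee u - 1) ^ 2) := by
  have hu' : ∀ n : ℤ, u ≠ n := fun n hn => hu ((ee_eq_one_iff u).mpr ⟨n, hn⟩)
  -- A real u is approached vertically, through points at which the formula is already known.
  have hpath : Tendsto (fun ε : ℝ => u + ε * I) (𝓝[≠] 0) (𝓝 u) := by
    have : Tendsto (fun ε : ℝ => u + ε * I) (𝓝 0) (𝓝 (u + (0 : ℝ) * I)) :=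
      Continuous.tendsto (by fun_prop) 0
    simp only [ofReal_zero, zero_mul, add_zero] at this
    exact this.mono_left nhdsWithin_le_nhds
  have h1 := (psum_continuousAt hu').tendsto.comp hpath
  have hc : ContinuousAt (fun u => (2 * Real.pi * I) ^ 2 * (ee u / (ee u - 1) ^ 2)) u := by
    have := (hasDerivAt_ee u).continuousAt
    exact continuousAt_const.mul (this.div ((this.sub continuousAt_const).pow 2)
      (pow_ne_zero 2 (sub_ne_zero.mpr hu)))
  have h2 := hc.tendsto.comp hpath
  refine tendsto_nhds_unique h1 (h2.congr' ?_)
  by_cases h0 : u.im = 0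
  · filter_upwards [self_mem_nhdsWithin] with ε hε
    exact (psum_of_im_ne_zero (by simpa [h0] using hε)).symm
  · have : ∀ᶠ z in 𝓝 u, z.im ≠ 0 := Complex.continuous_im.continuousAt.eventually_ne h0
    filter_upwards [hpath.eventually this] with ε hε
    exact (psum_of_im_ne_zero hε).symm

/-- A mere regrouping of the sum by residues modulo n. It holds at integers as well, since 0 ^ (-2)
= 0 on both sides. -/
lemma psum_root {n : ℕ} (hn : n ≠ 0) (u : ℂ) :
    ∑ j ∈ Finset.range n, psum (u + j / n) = n ^ 2 * psum (n * u) := by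
  have hn' : (n : ℂ) ≠ 0 := by exact_mod_cast hn
  rw [psum, tsum_int_split hn (summable_psum _), Finset.mul_sum]
  refine Finset.sum_congr rfl fun j _ => ?_
  rw [psum, ← tsum_mul_left]
  refine tsum_congr fun d => ?_
  rw [show (n : ℂ) * u + ((n * d + j : ℤ) : ℂ) = n * (u + j / n + d) by
    push_cast; field_simp; ring, mul_zpow]
  rw [zpow_neg (n : ℂ), ← mul_assoc]
  rw [show (n : ℂ) ^ 2 * ((n : ℂ) ^ (2 : ℤ))⁻¹ = 1 from mul_inv_cancel₀ (pow_ne_zero 2 hn'), one_mul]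

/-- Indeed X/(X - 1)² = cth(X)² - 1/4. Written in `kterm`, this deduces the summability of `P` from
that of `J`. -/
lemma psum_eq_kterm {τ z : ℂ} {c : ℤ} (h : ee (z + c * τ) ≠ 1) :
    psum (z + c * τ) = (2 * Real.pi * I) ^ 2 *
      (kterm τ z c ^ 2 - sg c * kterm τ z c) := by
  rw [psum_eq h]
  congr 1
  have h' := sub_ne_zero.mpr h
  have : sg c ^ 2 = 1 := by rw [sg]; split_ifs <;> norm_num
  rw [kterm, cth]
  field_simp
  linear_combination ((ee (z + c * τ) - 1) ^ 2) * this

lemma summable_psum_outer {τ : ℂ} (hτ : 0 < τ.im) (z : ℂ) :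
    Summable fun c : ℤ => psum (z + c * τ) := by
  have hs := summable_norm_kterm hτ z one_weight
  simp only [one_mul] at hs
  have hev : ∀ᶠ c : ℤ in cofinite, ‖kterm τ z c‖ ≤ 1 :=
    hs.tendsto_cofinite_zero.eventually_le_const one_pos
  have hone : ∀ᶠ c : ℤ in cofinite, ee (z + c * τ) ≠ 1 := by
    have : {c : ℤ | ¬ ee (z + c * τ) ≠ 1}.Subsingleton := by
      intro c hc c' hc'
      simp only [ne_eq, not_not, Set.mem_ofPred_eq] at hc hc'
      obtain ⟨m, hm⟩ := (ee_eq_one_iff _).mp hc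
      obtain ⟨m', hm'⟩ := (ee_eq_one_iff _).mp hc'
      have h1 := congrArg Complex.im hm
      have h2 := congrArg Complex.im hm'
      simp at h1 h2
      have : ((c : ℝ) - c') * τ.im = 0 := by linarith
      have := (mul_eq_zero.mp this).resolve_right hτ.ne'
      exact_mod_cast sub_eq_zero.mp this
    exact this.finite
  refine Summable.of_norm_bounded_eventually
    (g := fun c => ‖(2 * Real.pi * I : ℂ) ^ 2‖ * (2 * ‖kterm τ z c‖)) ((hs.mul_left 2).mul_left _) ?_
  filter_upwards [hev, hone] with c hc h1
  rw [psum_eq_kterm h1, norm_mul]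
  refine mul_le_mul_of_nonneg_left ?_ (norm_nonneg _)
  have hsg : ‖sg c‖ = 1 := by rw [sg]; split_ifs <;> simp
  refine (norm_sub_le _ _).trans ?_
  rw [norm_pow, norm_mul, hsg]
  nlinarith [norm_nonneg (kterm τ z c)]

/-- The weight two Eisenstein series attached to the torsion point `aτ + b`, that is, up to
normalization, the value there of the Weierstrass function. -/
def P (τ : ℂ) (a b : ℝ) : ℂ := (4 * Real.pi ^ 2 : ℂ)⁻¹ * ∑' c : ℤ, psum ((a * τ + b) + c * τ)

lemma P_add_one_left (τ : ℂ) (a b : ℝ) : P τ (a + 1) b = P τ a b := by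
  rw [P, P, ← (Equiv.addRight (1 : ℤ)).tsum_eq fun c : ℤ => psum ((a * τ + b) + c * τ)]
  congr 1
  refine tsum_congr fun c => ?_
  simp only [Equiv.coe_addRight]
  push_cast
  ring_nf

lemma P_add_one_right (τ : ℂ) (a b : ℝ) : P τ a (b + 1) = P τ a b := by
  rw [P, P]
  congr 1
  refine tsum_congr fun c => ?_
  rw [← psum_add_int ((a : ℂ) * τ + b + c * τ) 1]
  push_cast
  ring_nf

lemma P_tau_add_one (τ : ℂ) (a b : ℝ) : P (τ + 1) a b = P τ a (a + b) := by
  rw [P, P]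
  congr 1
  refine tsum_congr fun c => ?_
  rw [← psum_add_int ((a : ℂ) * τ + ((a + b : ℝ) : ℂ) + c * τ) c]
  push_cast
  ring_nf

lemma P_div {τ : ℂ} (hτ : 0 < τ.im) {n : ℕ} (hn : n ≠ 0) (a b : ℝ) :
    P (τ / n) a b = ∑ j ∈ Finset.range n, P τ ((a + j) / n) b := by
  have hn' : (n : ℂ) ≠ 0 := by exact_mod_cast hn
  simp only [P]
  rw [tsum_int_split hn (summable_psum_outer (im_div_pos hτ hn) _), Finset.mul_sum]
  refine Finset.sum_congr rfl fun j _ => ?_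
  congr 1
  refine tsum_congr fun c => ?_
  congr 1
  push_cast
  field_simp
  ring

lemma P_root {τ : ℂ} (hτ : 0 < τ.im) {n : ℕ} (hn : n ≠ 0) (a b : ℝ) :
    ∑ j ∈ Finset.range n, P τ a (b + j / n) = n ^ 2 * P (n * τ) a (n * b) := by
  simp only [P]
  rw [← Finset.mul_sum, ← Summable.tsum_finsetSum fun j _ => summable_psum_outer hτ _,
    mul_left_comm]
  congr 1
  rw [← tsum_mul_left]
  refine tsum_congr fun c => ?_
  have := psum_root hn (a * τ + b + c * τ)
  rw [show (a : ℂ) * (n * τ) + ((n * b : ℝ) : ℂ) + c * (n * τ) = n * (a * τ + b + c * τ) by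
    push_cast; ring, ← this]
  refine Finset.sum_congr rfl fun j _ => ?_
  congr 1
  push_cast
  ring

/-- The distribution relation for `P`. -/
lemma P_distribution {τ : ℂ} (hτ : 0 < τ.im) {n : ℕ} (hn : n ≠ 0) (a b : ℝ) :
    ∑ i ∈ Finset.range n, ∑ j ∈ Finset.range n, P τ ((a + i) / n) ((b + j) / n) =
      n ^ 2 * P τ a b := by
  have hn' : (n : ℂ) ≠ 0 := by exact_mod_cast hn
  have hn'' : (n : ℝ) ≠ 0 := by exact_mod_cast hn
  have h1 : ∀ i : ℕ, ∑ j ∈ Finset.range n, P τ ((a + i) / n) ((b + j) / n) =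
      n ^ 2 * P (n * τ) ((a + i) / n) b := fun i => by
    have := P_root hτ hn ((a + i) / n) (b / n)
    rw [show n * (b / n) = b by field_simp] at this
    simpa only [← add_div] using this
  have h2 := P_div (im_mul_pos hτ hn) hn a b
  rw [show (n : ℂ) * τ / n = τ by field_simp] at h2
  rw [Finset.sum_congr rfl fun i _ => h1 i, ← Finset.mul_sum, h2]

/-- The series `P` is the derivative of `J`. -/
lemma hasDerivAt_J {τ : ℂ} (hτ : 0 < τ.im) (a b : ℝ) (hz : a * τ + b ∉ latt τ) :
    HasDerivAt (J τ) (2 * Real.pi * I * P τ a b) (a * τ + b) := by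
  have h := (hasDerivAt_kser (w := fun _ => 1) hτ one_weight hz).2
  refine HasDerivAt.congr_deriv (f := J τ) h ?_
  rw [P, ← tsum_mul_left, ← tsum_mul_left]
  refine tsum_congr fun c => ?_
  rw [psum_eq (ee_ne_one_of_notMem hz c), ktermD]
  have : (Real.pi : ℂ) ≠ 0 := by simp [Real.pi_ne_zero]
  field_simp
  ring_nf
  simp

end ToricHecke

/-! ### The addition formula for `J`, by Laurent expansion in a strip and analytic continuation. -/

namespace ToricHecke

open Complex Filter Topology

/-! ### The three-term relation -/

lemma sg_natCast (n : ℕ) : sg n = 1 := by simp [sg]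

lemma sg_neg_succ (n : ℕ) : sg (-(n + 1)) = -1 := by
  rw [sg, if_neg (by omega)]

lemma norm_ee_lt_one {τ : ℂ} (hτ : 0 < τ.im) : ‖ee τ‖ < 1 := by
  rw [norm_ee, Real.exp_lt_one_iff]; nlinarith [Real.pi_pos]

lemma kterm_natCast {τ z : ℂ} (hz : ∀ c : ℤ, 0 ≤ c → ee (z + c * τ) ≠ 1) (n : ℕ) :
    kterm τ z n = -(ee τ ^ n * ee z / (1 - ee τ ^ n * ee z)) := by
  have h := hz n (by simp)
  have h1 : ee (z + ((n : ℤ) : ℂ) * τ) = ee τ ^ n * ee z := by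
    rw [Int.cast_natCast, ee_add, ee_nat_mul, mul_comm]
  rw [h1] at h
  rw [kterm, sg_natCast, h1, cth_add_half h, ← div_neg, neg_sub]

lemma kterm_neg_succ {τ z : ℂ} (hz : ∀ c : ℤ, c < 0 → ee (z + c * τ) ≠ 1) (n : ℕ) :
    kterm τ z (-(n + 1)) = ee τ ^ n * (ee τ / ee z) / (1 - ee τ ^ n * (ee τ / ee z)) := by
  have h := hz (-(n + 1)) (by omega)
  have h1 : ee (z + ((-(n + 1) : ℤ) : ℂ) * τ) = (ee τ ^ n * (ee τ / ee z))⁻¹ := by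
    rw [ee_add, ee_int_mul, zpow_neg]
    have := ee_ne_zero z
    have := ee_ne_zero τ
    rw [show ((n : ℤ) + 1) = ((n + 1 : ℕ) : ℤ) by push_cast; ring, zpow_natCast, pow_succ]
    field_simp
  rw [h1] at h
  have h0 : ee τ ^ n * (ee τ / ee z) ≠ 0 :=
    mul_ne_zero (pow_ne_zero _ (ee_ne_zero _)) (div_ne_zero (ee_ne_zero _) (ee_ne_zero _))
  rw [kterm, sg_neg_succ, h1, neg_div, ← sub_eq_add_neg, cth_sub_half h]
  set Y := ee τ ^ n * (ee τ / ee z)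
  have h2 : Y⁻¹ - 1 ≠ 0 := sub_ne_zero.mpr h
  have h3 : Y⁻¹ - 1 = (1 - Y) / Y := by field_simp
  rw [h3, one_div_div]

lemma summable_weight_geometric {q Y : ℂ} (hq : ‖q‖ < 1) (hY : ‖Y‖ < 1) {u : ℕ → ℂ}
    (hu : ∀ n, ‖u n‖ ≤ 2 + n) :
    Summable fun p : ℕ × ℕ => u p.1 * (q ^ p.1 * Y) ^ (p.2 + 1) := by
  have h1 : Summable fun n : ℕ => (2 + (n : ℝ)) * ‖q‖ ^ n := by
    have h1 := (summable_geometric_of_lt_one (norm_nonneg q) hq).mul_left 2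
    have h2 := summable_pow_mul_geometric_of_norm_lt_one 1 (r := ‖q‖) (by simpa using hq)
    exact (h1.add h2).congr fun n => by ring
  have h2 : Summable fun n : ℕ => ‖Y‖ ^ (n + 1) :=
    (summable_nat_add_iff 1).mpr (summable_geometric_of_lt_one (norm_nonneg Y) hY)
  refine Summable.of_norm_bounded (h1.mul_of_nonneg h2 (fun n => by positivity)
    (fun n => by positivity)) fun p => ?_
  rw [norm_mul, mul_pow, norm_mul, norm_pow, norm_pow, norm_pow, ← mul_assoc]
  refine mul_le_mul_of_nonneg_right (mul_le_mul (hu _) ?_ (by positivity) (by positivity))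
    (by positivity)
  rw [← pow_mul]
  exact pow_le_pow_of_le_one (norm_nonneg q) hq.le (by nlinarith)

lemma norm_pow_mul_lt_one {q Y : ℂ} (hq : ‖q‖ < 1) (hY : ‖Y‖ < 1) (n : ℕ) : ‖q ^ n * Y‖ < 1 := by
  rw [norm_mul, norm_pow]
  have : ‖q‖ ^ n ≤ 1 := pow_le_one₀ (norm_nonneg q) hq.le
  nlinarith [norm_nonneg Y, norm_nonneg q]

/-- Expand each fraction as a geometric series and interchange the two absolutely convergent
summations. -/
lemma hasSum_lambert {q Y : ℂ} (hq : ‖q‖ < 1) (hY : ‖Y‖ < 1) {u : ℕ → ℂ}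
    (hu : ∀ n, ‖u n‖ ≤ 2 + n) :
    HasSum (fun k : ℕ => Y ^ (k + 1) * ∑' n : ℕ, u n * (q ^ (k + 1)) ^ n)
      (∑' n : ℕ, u n * (q ^ n * Y / (1 - q ^ n * Y))) := by
  have hs := summable_weight_geometric hq hY hu
  have h1 : ∑' n : ℕ, u n * (q ^ n * Y / (1 - q ^ n * Y)) =
      ∑' p : ℕ × ℕ, u p.1 * (q ^ p.1 * Y) ^ (p.2 + 1) := by
    rw [hs.tsum_prod]
    refine tsum_congr fun n => ?_
    have := tsum_geometric_of_norm_lt_one (norm_pow_mul_lt_one hq hY n)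
    simp only [pow_succ]
    rw [tsum_mul_left, tsum_mul_right, this]
    ring
  rw [h1]
  have hs' : Summable fun p : ℕ × ℕ => u p.2 * (q ^ p.2 * Y) ^ (p.1 + 1) := hs.prod_symm
  have h2 : ∑' p : ℕ × ℕ, u p.1 * (q ^ p.1 * Y) ^ (p.2 + 1) =
      ∑' p : ℕ × ℕ, u p.2 * (q ^ p.2 * Y) ^ (p.1 + 1) :=
    ((Equiv.prodComm ℕ ℕ).tsum_eq fun p : ℕ × ℕ => u p.1 * (q ^ p.1 * Y) ^ (p.2 + 1)).symm
  rw [h2]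
  have h3 := hs'.hasSum.prod_fiberwise fun k => (hs'.prod_factor k).hasSum
  refine h3.congr_fun fun k => ?_
  rw [← tsum_mul_left]
  refine tsum_congr fun n => ?_
  rw [mul_pow, ← pow_mul, ← pow_mul, mul_comm n (k + 1)]
  ring

lemma kser_eq_lambert {τ z : ℂ} (hτ : 0 < τ.im) {w : ℤ → ℂ} (hw : ∀ c, ‖w c‖ ≤ 1 + |(c : ℝ)|)
    (hz : z ∉ latt τ) :
    kser w τ z = -(∑' n : ℕ, w n * (ee τ ^ n * ee z / (1 - ee τ ^ n * ee z))) +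
      ∑' n : ℕ, w (-(n + 1)) *
        (ee τ ^ n * (ee τ / ee z) / (1 - ee τ ^ n * (ee τ / ee z))) := by
  have hs := summable_kterm hτ z hw
  rw [kser, tsum_of_nat_of_neg_add_one]
  · rw [← tsum_neg]
    congr 1
    · refine tsum_congr fun n => ?_
      rw [kterm_natCast (fun c _ => ee_ne_one_of_notMem hz c), mul_neg]
    · refine tsum_congr fun n => ?_
      rw [kterm_neg_succ (fun c _ => ee_ne_one_of_notMem hz c)]
  · exact hs.comp_injective Nat.cast_injective
  · exact hs.comp_injective fun a b h => by simpa using h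

/-- The coefficients of the Laurent expansion of `J`; the value for `k = 0` is zero. -/
def lc (q : ℂ) (k : ℤ) : ℂ := 1 / (1 - q ^ k)

lemma lc_zero (q : ℂ) : lc q 0 = 0 := by simp [lc]

lemma zpow_ne_one {q : ℂ} (hq : ‖q‖ < 1) {k : ℤ} (hk : k ≠ 0) : q ^ k ≠ 1 := by
  intro h
  have := congrArg norm h
  rw [norm_zpow, norm_one] at this
  rw [zpow_eq_one_iff_right₀ (norm_nonneg q) hq.ne] at this
  exact hk this

lemma lc_neg {q : ℂ} (hq0 : q ≠ 0) (hq : ‖q‖ < 1) {k : ℤ} (hk : k ≠ 0) :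
    lc q (-k) = 1 - lc q k := by
  have h1 : 1 - q ^ k ≠ 0 := sub_ne_zero.mpr (zpow_ne_one hq hk).symm
  have h2 : 1 - q ^ (-k) ≠ 0 := sub_ne_zero.mpr (zpow_ne_one hq (neg_ne_zero.mpr hk)).symm
  have h0 : q ^ k ≠ 0 := zpow_ne_zero _ hq0
  have h3 : 1 - q ^ (-k) = -(1 - q ^ k) / q ^ k := by rw [zpow_neg]; field_simp; ring
  rw [lc, lc, h3]
  field_simp
  ring

/-- A partial fraction identity in qⁱ and qʲ. It is the generic coefficient of the addition formula,
and the whole algebraic content of it. -/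
lemma lc_three_term {q : ℂ} (hq0 : q ≠ 0) (hq : ‖q‖ < 1) {i j : ℤ} (hi : i ≠ 0) (hj : j ≠ 0)
    (hij : i ≠ j) :
    lc q i * lc q j - lc q j * lc q (i - j) - lc q i * lc q (j - i) = 0 := by
  have h1 : 1 - q ^ i ≠ 0 := sub_ne_zero.mpr (zpow_ne_one hq hi).symm
  have h2 : 1 - q ^ j ≠ 0 := sub_ne_zero.mpr (zpow_ne_one hq hj).symm
  have h0 : q ^ i ≠ 0 := zpow_ne_zero _ hq0
  have h0' : q ^ j ≠ 0 := zpow_ne_zero _ hq0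
  have h3 : q ^ j - q ^ i ≠ 0 := by
    intro h
    have : q ^ (i - j) = 1 := by
      rw [zpow_sub₀ hq0, ← sub_eq_zero.mp h, div_self h0']
    exact zpow_ne_one hq (sub_ne_zero.mpr hij) this
  have h3' : q ^ i - q ^ j ≠ 0 := by rw [← neg_sub]; exact neg_ne_zero.mpr h3
  have h4 : 1 - q ^ (i - j) = (q ^ j - q ^ i) / q ^ j := by rw [zpow_sub₀ hq0]; field_simp
  have h5 : 1 - q ^ (j - i) = -(q ^ j - q ^ i) / q ^ i := by
    rw [zpow_sub₀ hq0]; field_simp; ring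
  simp only [lc]
  rw [h4, h5]
  field_simp
  ring

lemma norm_natWeight {w : ℤ → ℂ} (hw : ∀ c, ‖w c‖ ≤ 1 + |(c : ℝ)|) (n : ℕ) :
    ‖w n‖ ≤ 2 + n := by
  have := hw n
  simp at this
  linarith

lemma norm_negWeight {w : ℤ → ℂ} (hw : ∀ c, ‖w c‖ ≤ 1 + |(c : ℝ)|) (n : ℕ) :
    ‖w (-(n + 1))‖ ≤ 2 + n := by
  have := hw (-(n + 1))
  have h2 : |((-(n + 1) : ℤ) : ℝ)| = n + 1 := by
    push_cast; rw [abs_of_nonpos] <;> linarith [(Nat.cast_nonneg n : (0 : ℝ) ≤ n)]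
  rw [h2] at this
  linarith

lemma ee_strip {τ z : ℂ} (h1 : 0 < z.im) (h2 : z.im < τ.im) :
    ‖ee z‖ < 1 ∧ ‖ee τ / ee z‖ < 1 := by
  refine ⟨norm_ee_lt_one h1, ?_⟩
  rw [div_eq_mul_inv, ← ee_neg, ← ee_add]
  exact norm_ee_lt_one (by simpa using h2)

lemma notMem_latt_of_strip {τ z : ℂ} (h1 : 0 < z.im) (h2 : z.im < τ.im) : z ∉ latt τ := by
  have hτ : 0 < τ.im := h1.trans h2
  rintro ⟨c, d, rfl⟩
  simp at h1 h2
  have h3 : (0 : ℝ) < c := by by_contra h; push Not at h; nlinarith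
  have h4 : (c : ℝ) < 1 := by by_contra h; push Not at h; nlinarith
  have h5 : 0 < c := by exact_mod_cast h3
  have h6 : c < 1 := by exact_mod_cast h4
  omega

/-- The terms with c ≥ 0 form a Lambert series in e(z), those with c < 0 one in e(τ)/e(z). Both
arguments lie in the unit disc exactly in the strip. -/
lemma hasSum_laurent {τ z : ℂ} {w : ℤ → ℂ} (hw : ∀ c, ‖w c‖ ≤ 1 + |(c : ℝ)|)
    (h1 : 0 < z.im) (h2 : z.im < τ.im) {cf : ℤ → ℂ} (h0 : cf 0 = 0)
    (hpos : ∀ k : ℕ, cf (k + 1) = ∑' n : ℕ, w n * (ee τ ^ (k + 1)) ^ n)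
    (hneg : ∀ k : ℕ, cf (-(k + 1)) =
      -(ee τ ^ (k + 1) * ∑' n : ℕ, w (-(n + 1)) * (ee τ ^ (k + 1)) ^ n)) :
    HasSum (fun k : ℤ => cf k * ee z ^ k) (-kser w τ z) := by
  have hτ : 0 < τ.im := h1.trans h2
  obtain ⟨hX, hY⟩ := ee_strip h1 h2
  have hq := norm_ee_lt_one hτ
  rw [kser_eq_lambert hτ hw (notMem_latt_of_strip h1 h2), neg_add, neg_neg]
  refine HasSum.of_nat_of_neg_add_one ?_ ?_
  · have := hasSum_lambert hq hX (norm_natWeight hw)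
    rw [← hasSum_nat_add_iff' (f := fun n : ℕ => cf n * ee z ^ (n : ℤ)) 1]
    simp only [Finset.range_one, Finset.sum_singleton, Nat.cast_zero, h0, zero_mul, sub_zero]
    refine this.congr_fun fun k => ?_
    push_cast
    rw [hpos, mul_comm, ← zpow_natCast]
    push_cast
    rfl
  · have := (hasSum_lambert hq hY (norm_negWeight hw)).neg
    refine this.congr_fun fun k => ?_
    rw [hneg, zpow_neg, div_pow, ← zpow_natCast (ee z)]
    push_cast
    ring

lemma hasSum_laurent_J {τ z : ℂ} (h1 : 0 < z.im) (h2 : z.im < τ.im) :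
    HasSum (fun k : ℤ => lc (ee τ) k * ee z ^ k) (-J τ z) := by
  have hq := norm_ee_lt_one (h1.trans h2)
  have hqk : ∀ k : ℕ, ‖ee τ ^ (k + 1)‖ < 1 := fun k => by
    rw [norm_pow]; exact pow_lt_one₀ (norm_nonneg _) hq (by omega)
  have hpos : ∀ k : ℕ, lc (ee τ) (k + 1) = (1 - ee τ ^ (k + 1))⁻¹ := fun k => by
    rw [lc, one_div]; norm_cast
  have hne : ∀ k : ℕ, 1 - ee τ ^ (k + 1) ≠ 0 := fun k h => by
    have := hqk k; rw [← sub_eq_zero.mp h] at this; simp at this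
  refine hasSum_laurent one_weight h1 h2 (lc_zero _) (fun k => ?_) (fun k => ?_)
  · simp only [one_mul]
    rw [tsum_geometric_of_norm_lt_one (hqk k), hpos]
  · simp only [one_mul]
    rw [tsum_geometric_of_norm_lt_one (hqk k), lc_neg (ee_ne_zero _) hq (by omega), hpos]
    have := hne k
    field_simp
    ring

/-- For k ≠ 0 the coefficient is qᵏ/(1 - qᵏ)², the effect of the weight c. In terms of `lc` it can
be compared with products of coefficients of `J`. -/
lemma hasSum_laurent_K {τ z : ℂ} (h1 : 0 < z.im) (h2 : z.im < τ.im) :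
    HasSum (fun k : ℤ => (lc (ee τ) k ^ 2 - lc (ee τ) k) * ee z ^ k) (-K τ z) := by
  have hq := norm_ee_lt_one (h1.trans h2)
  have hqk : ∀ k : ℕ, ‖ee τ ^ (k + 1)‖ < 1 := fun k => by
    rw [norm_pow]; exact pow_lt_one₀ (norm_nonneg _) hq (by omega)
  have hpos : ∀ k : ℕ, lc (ee τ) (k + 1) = (1 - ee τ ^ (k + 1))⁻¹ := fun k => by
    rw [lc, one_div]; norm_cast
  have hne : ∀ k : ℕ, 1 - ee τ ^ (k + 1) ≠ 0 := fun k h => by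
    have := hqk k; rw [← sub_eq_zero.mp h] at this; simp at this
  refine hasSum_laurent id_weight h1 h2 (by simp [lc_zero]) (fun k => ?_) (fun k => ?_)
  · have := tsum_coe_mul_geometric_of_norm_lt_one (hqk k)
    simp only [Int.cast_natCast]
    rw [this, hpos]
    have := hne k
    field_simp
    ring
  · have hh := (hasSum_coe_mul_geometric_of_norm_lt_one (hqk k)).add
      (hasSum_geometric_of_norm_lt_one (hqk k))
    have : ∑' n : ℕ, ((-((n : ℤ) + 1) : ℤ) : ℂ) * (ee τ ^ (k + 1)) ^ n =
        -(ee τ ^ (k + 1) / (1 - ee τ ^ (k + 1)) ^ 2 + (1 - ee τ ^ (k + 1))⁻¹) := by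
      rw [← hh.tsum_eq, ← tsum_neg]
      refine tsum_congr fun n => ?_
      push_cast; ring
    rw [this, lc_neg (ee_ne_zero _) hq (by omega), hpos]
    have := hne k
    field_simp
    ring

/-- Since `lc q 0 = 0`, the generic identity fails on the lines i = j, j = 0 and i = 0. The defects
there sum to -K(z + w) - J(z + w), -K(z) and -K(w). -/
lemma three_term_coeff {q X Y : ℂ} (hq0 : q ≠ 0) (hq : ‖q‖ < 1) (hX : X ≠ 0) (hY : Y ≠ 0)
    (i j : ℤ) :
    lc q i * X ^ i * (lc q j * Y ^ j) -
      lc q j * (X * Y) ^ j * (lc q (i - j) * X ^ (i - j)) -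
      lc q i * (X * Y) ^ i * (lc q (j - i) * Y ^ (j - i)) =
    (if i = j then lc q i ^ 2 * (X * Y) ^ i else 0) +
      (if j = 0 then (lc q i ^ 2 - lc q i) * X ^ i else 0) +
      (if i = 0 then (lc q j ^ 2 - lc q j) * Y ^ j else 0) := by
  have e1 : (X * Y) ^ j * X ^ (i - j) = X ^ i * Y ^ j := by
    rw [mul_zpow, zpow_sub₀ hX]
    have := zpow_ne_zero j hX
    field_simp
  have e2 : (X * Y) ^ i * Y ^ (j - i) = X ^ i * Y ^ j := by
    rw [mul_zpow, zpow_sub₀ hY]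
    have := zpow_ne_zero i hY
    field_simp
  have e3 : lc q i * X ^ i * (lc q j * Y ^ j) -
      lc q j * (X * Y) ^ j * (lc q (i - j) * X ^ (i - j)) -
      lc q i * (X * Y) ^ i * (lc q (j - i) * Y ^ (j - i)) =
      (lc q i * lc q j - lc q j * lc q (i - j) - lc q i * lc q (j - i)) * (X ^ i * Y ^ j) := by
    linear_combination (-lc q j * lc q (i - j)) * e1 - (lc q i * lc q (j - i)) * e2
  rw [e3]
  by_cases hi : i = 0
  · subst hi
    by_cases hj : j = 0
    · subst hj; simp [lc_zero]
    · rw [if_neg (Ne.symm hj), if_neg hj, if_pos rfl, lc_zero, zero_sub,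
        lc_neg hq0 hq hj, zpow_zero]
      ring
  · by_cases hj : j = 0
    · subst hj
      rw [if_neg hi, if_pos rfl, if_neg hi, lc_zero, zero_sub, lc_neg hq0 hq hi, zpow_zero]
      ring
    · by_cases hij : i = j
      · subst hij
        rw [if_pos rfl, if_neg hi, if_neg hi, sub_self, lc_zero, mul_zpow]
        ring
      · rw [if_neg hij, if_neg hj, if_neg hi, lc_three_term hq0 hq hi hj hij]
        ring

/-- The change of summation variables `(i, j) ↦ (j, i - j)`. -/
def sumEquivLeft : ℤ × ℤ ≃ ℤ × ℤ :=
  ⟨fun p => (p.2, p.1 - p.2), fun p => (p.1 + p.2, p.1), fun p => by simp, fun p => by simp⟩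

/-- The change of summation variables `(i, j) ↦ (i, j - i)`. -/
def sumEquivRight : ℤ × ℤ ≃ ℤ × ℤ :=
  ⟨fun p => (p.1, p.2 - p.1), fun p => (p.1, p.1 + p.2), fun p => by simp, fun p => by simp⟩

lemma hasSum_diagonal {f : ℤ → ℂ} {a : ℂ} (h : HasSum f a) :
    HasSum (fun p : ℤ × ℤ => if p.1 = p.2 then f p.1 else 0) a := by
  have hinj : Function.Injective fun i : ℤ => (i, i) := fun a b h => (Prod.ext_iff.mp h).1
  rw [← hinj.hasSum_iff]
  · exact h.congr_fun fun i => by simp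
  · rintro ⟨i, j⟩ h
    rw [if_neg]
    intro hij
    exact h ⟨i, Prod.ext rfl hij⟩

lemma hasSum_axis_left {f : ℤ → ℂ} {a : ℂ} (h : HasSum f a) :
    HasSum (fun p : ℤ × ℤ => if p.2 = 0 then f p.1 else 0) a := by
  have hinj : Function.Injective fun i : ℤ => (i, (0 : ℤ)) := fun a b h => (Prod.ext_iff.mp h).1
  rw [← hinj.hasSum_iff]
  · exact h.congr_fun fun i => by simp
  · rintro ⟨i, j⟩ h
    rw [if_neg]
    rintro rfl
    exact h ⟨i, rfl⟩

lemma hasSum_axis_right {f : ℤ → ℂ} {a : ℂ} (h : HasSum f a) :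
    HasSum (fun p : ℤ × ℤ => if p.1 = 0 then f p.2 else 0) a := by
  have hinj : Function.Injective fun i : ℤ => ((0 : ℤ), i) := fun a b h => (Prod.ext_iff.mp h).2
  rw [← hinj.hasSum_iff]
  · exact h.congr_fun fun i => by simp
  · rintro ⟨i, j⟩ h
    rw [if_neg]
    rintro rfl
    exact h ⟨j, rfl⟩

/-- The left hand side of the three-term relation. -/
def threeTerm (τ z w : ℂ) : ℂ :=
  J τ z * J τ w - J τ (z + w) * (J τ z + J τ w) + K τ z + K τ w + K τ (z + w) + J τ (z + w)

lemma hasSum_mul_prod {f g : ℤ → ℂ} {a b : ℂ} (hf : HasSum f a) (hg : HasSum g b) :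
    HasSum (fun p : ℤ × ℤ => f p.1 * g p.2) (a * b) :=
  hf.mul hg (summable_mul_of_summable_norm hf.summable.norm hg.summable.norm)

lemma three_term_sums {q X Y a b c a' b' c' : ℂ} (hq0 : q ≠ 0) (hq : ‖q‖ < 1) (hX : X ≠ 0)
    (hY : Y ≠ 0) (j1 : HasSum (fun k : ℤ => lc q k * X ^ k) a)
    (j2 : HasSum (fun k : ℤ => lc q k * Y ^ k) b)
    (j3 : HasSum (fun k : ℤ => lc q k * (X * Y) ^ k) c)
    (k1 : HasSum (fun k : ℤ => (lc q k ^ 2 - lc q k) * X ^ k) a')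
    (k2 : HasSum (fun k : ℤ => (lc q k ^ 2 - lc q k) * Y ^ k) b')
    (k3 : HasSum (fun k : ℤ => (lc q k ^ 2 - lc q k) * (X * Y) ^ k) c') :
    a * b - c * a - c * b = c' + c + a' + b' := by
  have p12 := hasSum_mul_prod j1 j2
  have p31 := hasSum_mul_prod j3 j1
  have p32 := hasSum_mul_prod j3 j2
  have p31' : HasSum (fun p : ℤ × ℤ =>
      lc q p.2 * (X * Y) ^ p.2 * (lc q (p.1 - p.2) * X ^ (p.1 - p.2))) (c * a) :=
    sumEquivLeft.hasSum_iff.mpr p31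
  have p32' : HasSum (fun p : ℤ × ℤ =>
      lc q p.1 * (X * Y) ^ p.1 * (lc q (p.2 - p.1) * Y ^ (p.2 - p.1))) (c * b) :=
    sumEquivRight.hasSum_iff.mpr p32
  have hL := (p12.sub p31').sub p32'
  have d3' : HasSum (fun k : ℤ => lc q k ^ 2 * (X * Y) ^ k) (c' + c) :=
    (k3.add j3).congr_fun fun i => by ring
  have hR := ((hasSum_diagonal d3').add (hasSum_axis_left k1)).add (hasSum_axis_right k2)
  have hfun := funext fun p : ℤ × ℤ => three_term_coeff hq0 hq hX hY p.1 p.2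
  rw [← hfun] at hR
  exact hL.unique hR

lemma three_term_strip {τ z w : ℂ} (hz : 0 < z.im) (hw : 0 < w.im) (hzw : (z + w).im < τ.im) :
    threeTerm τ z w = 0 := by
  have him : (z + w).im = z.im + w.im := add_im z w
  have hzw0 : 0 < (z + w).im := by linarith
  have hz' : z.im < τ.im := by linarith
  have hw' : w.im < τ.im := by linarith
  have j3 := hasSum_laurent_J hzw0 hzw
  have k3 := hasSum_laurent_K hzw0 hzw
  rw [ee_add] at j3 k3
  have := three_term_sums (ee_ne_zero τ) (norm_ee_lt_one (hz.trans hz')) (ee_ne_zero z)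
    (ee_ne_zero w) (hasSum_laurent_J hz hz') (hasSum_laurent_J hw hw') j3
    (hasSum_laurent_K hz hz') (hasSum_laurent_K hw hw') k3
  rw [threeTerm]
  linear_combination this

lemma isPreconnected_compl_latt (τ z : ℂ) :
    IsPreconnected (latt τ ∪ {w | z + w ∈ latt τ})ᶜ := by
  have h2 : {w | z + w ∈ latt τ}.Countable :=
    (countable_latt τ).preimage (f := fun w => z + w) (add_right_injective z)
  exact (((countable_latt τ).union h2).isConnected_compl_of_one_lt_rank
    (by rw [Complex.rank_real_complex]; norm_num)).isPreconnected

lemma isOpen_compl_latt {τ : ℂ} (hτ : 0 < τ.im) (z : ℂ) :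
    IsOpen (latt τ ∪ {w | z + w ∈ latt τ})ᶜ :=
  ((isClosed_latt hτ).union ((isClosed_latt hτ).preimage (f := fun w => z + w)
    (by fun_prop))).isOpen_compl

lemma threeTerm_comm (τ z w : ℂ) : threeTerm τ z w = threeTerm τ w z := by
  rw [threeTerm, threeTerm, add_comm w z]; ring

lemma differentiableOn_threeTerm {τ z : ℂ} (hτ : 0 < τ.im) :
    DifferentiableOn ℂ (threeTerm τ z) (latt τ ∪ {w | z + w ∈ latt τ})ᶜ := by
  intro w hw
  rw [Set.mem_compl_iff, Set.mem_union, not_or] at hw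
  have h1 := differentiableAt_J hτ hw.1
  have h2 := differentiableAt_K hτ hw.1
  have h3 : DifferentiableAt ℂ (fun w => J τ (z + w)) w :=
    (differentiableAt_J hτ hw.2).comp w (by fun_prop)
  have h4 : DifferentiableAt ℂ (fun w => K τ (z + w)) w :=
    (differentiableAt_K hτ hw.2).comp w (by fun_prop)
  have : DifferentiableAt ℂ (threeTerm τ z) w := by
    unfold threeTerm
    fun_prop
  exact this.differentiableWithinAt

/-- The identity theorem in w: removing a countable closed set leaves the plane connected, and V
meets what remains. -/
lemma three_term_extend {τ z : ℂ} (hτ : 0 < τ.im) {V : Set ℂ} (hV : IsOpen V) (hne : V.Nonempty)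
    (h : ∀ w ∈ V, w ∉ latt τ → z + w ∉ latt τ → threeTerm τ z w = 0) {w : ℂ}
    (hw : w ∉ latt τ) (hzw : z + w ∉ latt τ) : threeTerm τ z w = 0 := by
  have hopen := isOpen_compl_latt hτ z
  have hcount : (latt τ ∪ {w | z + w ∈ latt τ}).Countable :=
    (countable_latt τ).union ((countable_latt τ).preimage (f := fun w => z + w)
      (add_right_injective z))
  obtain ⟨w₀, hw₀, hw₀V⟩ := (hcount.dense_compl ℝ).exists_mem_open hV hne
  have hev : threeTerm τ z =ᶠ[𝓝 w₀] 0 := by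
    filter_upwards [hV.mem_nhds hw₀V, hopen.mem_nhds hw₀] with w hw1 hw2
    rw [Set.mem_compl_iff, Set.mem_union, not_or] at hw2
    exact h w hw1 hw2.1 hw2.2
  refine ((differentiableOn_threeTerm hτ).analyticOnNhd
    hopen).eqOn_zero_of_preconnected_of_eventuallyEq_zero (isPreconnected_compl_latt τ z) hw₀ hev ?_
  rw [Set.mem_compl_iff, Set.mem_union, not_or]
  exact ⟨hw, hzw⟩

/-- The three-term relation for `J`. -/
lemma three_term {τ z w : ℂ} (hτ : 0 < τ.im) (hz : z ∉ latt τ) (hw : w ∉ latt τ)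
    (hzw : z + w ∉ latt τ) : threeTerm τ z w = 0 := by
  -- The continuation has two stages: in w while z stays in the strip, then for arbitrary z,
  -- starting from w in the strip and using symmetry.
  have hstrip : ∀ z : ℂ, 0 < z.im → z.im < τ.im → ∀ w, w ∉ latt τ → z + w ∉ latt τ →
      threeTerm τ z w = 0 := by
    intro z hz0 hz1 w hw hzw
    refine three_term_extend (V := {w | 0 < w.im} ∩ {w | w.im < τ.im - z.im}) hτ
      ((isOpen_lt continuous_const Complex.continuous_im).inter
        (isOpen_lt Complex.continuous_im continuous_const)) ?_ ?_ hw hzw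
    · refine ⟨((τ.im - z.im) / 2 : ℝ) * I, ?_, ?_⟩ <;> simp <;> linarith
    · rintro w ⟨h1, h2⟩ - -
      refine three_term_strip hz0 h1 ?_
      rw [add_im]
      have : w.im < τ.im - z.im := h2
      linarith
  refine three_term_extend (V := {w | 0 < w.im} ∩ {w | w.im < τ.im}) hτ
      ((isOpen_lt continuous_const Complex.continuous_im).inter
        (isOpen_lt Complex.continuous_im continuous_const)) ?_ ?_ hw hzw
  · refine ⟨(τ.im / 2 : ℝ) * I, ?_, ?_⟩ <;> simp <;> linarith
  · rintro w ⟨h1, h2⟩ - h3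
    rw [threeTerm_comm]
    refine hstrip w h1 h2 z hz ?_
    rwa [add_comm]

end ToricHecke

/-! ### The addition formula on the boundary, and `E` at real points as a Fourier series. -/

namespace ToricHecke

open Complex Filter Topology

/-! ### The degenerate three-term relation -/

lemma ee_ne_one_of_im_ne_zero {u : ℂ} (hu : u.im ≠ 0) : ee u ≠ 1 := by
  rw [Ne, ee_eq_one_iff]
  rintro ⟨n, rfl⟩
  simp at hu

/-- Only the term c = 0 has a pole at the origin, and the weight removes it. -/
lemma continuousAt_kser_zero {τ : ℂ} (hτ : 0 < τ.im) {w : ℤ → ℂ}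
    (hw : ∀ c, ‖w c‖ ≤ 1 + |(c : ℝ)|) (hw0 : w 0 = 0) : ContinuousAt (kser w τ) 0 := by
  set B := Metric.closedBall (0 : ℂ) (τ.im / 2) with hB
  have him : ∀ z ∈ B, |z.im| ≤ τ.im / 2 := fun z hz =>
    (Complex.abs_im_le_norm z).trans (by simpa [hB] using hz)
  have hcont : ∀ c, ContinuousOn (fun z => w c * kterm τ z c) B := by
    intro c
    rcases eq_or_ne c 0 with rfl | hc
    · simp only [hw0, zero_mul]; exact continuousOn_const
    · intro z hz
      refine ((hasDerivAt_kterm (ee_ne_one_of_im_ne_zero ?_)).continuousAt.const_mul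
        _).continuousWithinAt
      have h1 := him z hz
      have h2 : (z + c * τ).im = z.im + c * τ.im := by simp
      rw [h2]
      intro h0
      have h3 : (1 : ℝ) ≤ |(c : ℝ)| := by exact_mod_cast Int.one_le_abs hc
      have h4 : |(c : ℝ)| * τ.im = |z.im| := by
        rw [show z.im = -(c * τ.im) by linarith, abs_neg, abs_mul, abs_of_pos hτ]
      nlinarith
  obtain ⟨u, hu, hb⟩ := exists_summable_bound (isCompact_closedBall _ _) hcont
    (summable_kbound hτ (τ.im / 2)) (by
      filter_upwards [kterm_le_kbound hτ (τ.im / 2) hw] with c hc z hz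
      exact hc z (him z hz))
  have := continuousOn_tsum hcont hu hb
  exact this.continuousAt (Metric.closedBall_mem_nhds _ (by linarith))

lemma continuousAt_K_zero {τ : ℂ} (hτ : 0 < τ.im) : ContinuousAt (K τ) 0 :=
  continuousAt_kser_zero hτ id_weight (by simp)

lemma tendsto_mul_cth : Tendsto (fun z : ℂ => z * cth (ee z)) (𝓝[≠] 0) (𝓝 (2 * Real.pi * I)⁻¹) := by
  have h1 := hasDerivAt_iff_tendsto_slope.mp (hasDerivAt_ee 0)
  have hpi : (2 * Real.pi * I : ℂ) ≠ 0 := by simp [Real.pi_ne_zero]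
  rw [ee_zero, mul_one] at h1
  have h2 : Tendsto (fun z => (ee z + 1) / 2) (𝓝[≠] 0) (𝓝 1) := by
    have : ContinuousAt (fun z => (ee z + 1) / 2) 0 :=
      ((hasDerivAt_ee 0).continuousAt.add_const 1).div_const 2
    have h := this.tendsto
    simp only [ee_zero] at h
    norm_num at h
    exact h.mono_left nhdsWithin_le_nhds
  have h3 := h2.mul (h1.inv₀ hpi)
  rw [one_mul] at h3
  refine h3.congr' ?_
  filter_upwards [self_mem_nhdsWithin] with z hz
  rw [slope_def_field, sub_zero, ee_zero, inv_div, cth]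
  ring

lemma tendsto_mul_J {τ : ℂ} (hτ : 0 < τ.im) :
    Tendsto (fun z : ℂ => z * J τ z) (𝓝[≠] 0) (𝓝 (2 * Real.pi * I)⁻¹) := by
  set w : ℤ → ℂ := fun c => if c = 0 then 0 else 1 with hw
  have hwb : ∀ c, ‖w c‖ ≤ 1 + |(c : ℝ)| := by
    intro c
    rw [hw]
    dsimp only
    split_ifs
    · rw [norm_zero]; positivity
    · rw [norm_one]; linarith [abs_nonneg (c : ℝ)]
  have hJ : ∀ z, J τ z = cth (ee z) + (1 / 2 + kser w τ z) := by
    intro z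
    have h1 := hasSum_kterm hτ z
    have h2 := (summable_kterm hτ z hwb).hasSum
    have h3 := hasSum_ite_eq (0 : ℤ) (kterm τ z 0)
    have h4 := (h3.add h2).congr_fun (g := fun c => kterm τ z c) fun c => by
      rcases eq_or_ne c 0 with rfl | hc <;> simp [*]
    rw [h1.unique h4, kterm, kser]
    simp [sg]
    ring
  have hc := (continuousAt_kser_zero hτ hwb (by simp [hw])).tendsto
  have h1 : Tendsto (fun z : ℂ => z * (1 / 2 + kser w τ z)) (𝓝[≠] 0) (𝓝 0) := by
    have := (continuousAt_id.tendsto (x := (0 : ℂ))).mul (hc.const_add (1 / 2 : ℂ))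
    simp only [id, zero_mul] at this
    exact this.mono_left nhdsWithin_le_nhds
  have h2 := tendsto_mul_cth.add h1
  rw [add_zero] at h2
  refine h2.congr fun z => ?_
  rw [hJ]; ring

/-- The limit of the three-term relation as one of the variables tends to zero. -/
lemma J_sq {τ w D : ℂ} (hτ : 0 < τ.im) (hw : w ∉ latt τ) (hD : HasDerivAt (J τ) D w) :
    J τ w ^ 2 = -D / (2 * Real.pi * I) + K τ 0 + 2 * K τ w + J τ w := by
  have h0 : ∀ᶠ z in 𝓝[≠] (0 : ℂ), threeTerm τ z w = 0 := by
    have h1 : ∀ᶠ z in 𝓝[≠] (0 : ℂ), z + w ∉ latt τ := by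
      have : ContinuousAt (fun z : ℂ => z + w) 0 := by fun_prop
      exact (this.eventually ((isClosed_latt hτ).isOpen_compl.mem_nhds
        (by simpa using hw))).filter_mono nhdsWithin_le_nhds
    have h2 : ∀ᶠ z in 𝓝[≠] (0 : ℂ), z ∉ latt τ := by
      have hw' : ∀ᶠ z in 𝓝 (0 : ℂ), |z.im| < τ.im := by
        have : ContinuousAt (fun z : ℂ => |z.im|) 0 := by fun_prop
        exact this.eventually (gt_mem_nhds (by simpa using hτ))
      have hw'' : ∀ᶠ z in 𝓝 (0 : ℂ), |z.re| < 1 := by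
        have : ContinuousAt (fun z : ℂ => |z.re|) 0 := by fun_prop
        exact this.eventually (gt_mem_nhds (by simp))
      filter_upwards [nhdsWithin_le_nhds hw', nhdsWithin_le_nhds hw'', self_mem_nhdsWithin]
        with z h1 h2 h3
      rintro ⟨c, d, rfl⟩
      have hc : c = 0 := by
        by_contra hc
        have h3 : (1 : ℝ) ≤ |(c : ℝ)| := by exact_mod_cast Int.one_le_abs hc
        have h4 : ((c : ℂ) * τ + d).im = c * τ.im := by simp
        rw [h4, abs_mul, abs_of_pos hτ] at h1
        nlinarith
      subst hc
      have hd : d = 0 := by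
        by_contra hd
        have h3 : (1 : ℝ) ≤ |(d : ℝ)| := by exact_mod_cast Int.one_le_abs hd
        simp at h2
        linarith
      subst hd
      simp at h3
    filter_upwards [h1, h2] with z hz1 hz2
    exact three_term hτ hz2 hw hz1
  have hcJ : Tendsto (fun z => J τ (z + w)) (𝓝[≠] 0) (𝓝 (J τ w)) := by
    have h : ContinuousAt (J τ) (0 + w) := by rw [zero_add]; exact hD.continuousAt
    have := (h.comp (f := fun z => z + w) (by fun_prop)).tendsto
    simp only [Function.comp_def, zero_add] at this
    exact this.mono_left nhdsWithin_le_nhds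
  have hcK : Tendsto (fun z => K τ (z + w)) (𝓝[≠] 0) (𝓝 (K τ w)) := by
    have h : ContinuousAt (K τ) (0 + w) := by
      rw [zero_add]; exact (differentiableAt_K hτ hw).continuousAt
    have := (h.comp (f := fun z => z + w) (by fun_prop)).tendsto
    simp only [Function.comp_def, zero_add] at this
    exact this.mono_left nhdsWithin_le_nhds
  have hsl : Tendsto (fun z => z⁻¹ * (J τ (z + w) - J τ w)) (𝓝[≠] 0) (𝓝 D) := by
    have := hasDerivAt_iff_tendsto_slope_zero.mp hD
    simpa [add_comm w] using this
  -- The simple pole of J(z) is paired with J(z + w) - J(w): z J(z) tends to 1/(2πi) and the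
  -- difference quotient to D.
  have hlim := (((((tendsto_mul_J hτ).mul hsl).neg.sub (hcJ.mul_const (J τ w))).add
    ((continuousAt_K_zero hτ).tendsto.mono_left nhdsWithin_le_nhds)).add_const (K τ w)).add
    (hcK.add hcJ)
  have hz : Tendsto (fun _ : ℂ => (0 : ℂ)) (𝓝[≠] (0 : ℂ)) (𝓝 0) := tendsto_const_nhds
  have hlim' := hz.congr' (f₂ := _) (by
    filter_upwards [h0, self_mem_nhdsWithin] with z hz1 hz2
    have : -(z * J τ z * (z⁻¹ * (J τ (z + w) - J τ w))) - J τ (z + w) * J τ w + K τ z + K τ w +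
        (K τ (z + w) + J τ (z + w)) = 0 := by
      have hz2 : z ≠ 0 := hz2
      rw [threeTerm] at hz1
      field_simp
      linear_combination hz1
    exact this.symm)
  have := tendsto_nhds_unique hlim hlim'
  linear_combination -this

/-! ### Values of `E` on the real line -/

lemma psum_zero : psum 0 = Real.pi ^ 2 / 3 := by
  have h1 := hasSum_zeta_two
  have h2 : HasSum (fun n : ℕ => (1 : ℂ) / (n : ℂ) ^ 2) (Real.pi ^ 2 / 6) := by
    have := (Complex.hasSum_ofReal).mpr h1
    push_cast at this
    exact this
  have h3 : HasSum (fun d : ℤ => ((0 : ℂ) + d) ^ (-2 : ℤ))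
      ((Real.pi ^ 2 / 6) + (Real.pi ^ 2 / 6) - 1 / (0 : ℕ) ^ 2) := by
    have h4 := HasSum.of_nat_of_neg (f := fun d : ℤ => ((0 : ℂ) + d) ^ (-2 : ℤ))
      (h2.congr_fun fun n => by simp [zpow_neg, zpow_ofNat])
      (h2.congr_fun fun n => by simp [zpow_neg, zpow_ofNat])
    simpa using h4
  rw [psum, h3.tsum_eq]
  simp
  ring

lemma tsum_succ_geometric {x : ℂ} (hx : ‖x‖ < 1) :
    ∑' n : ℕ, ((n : ℂ) + 1) * x ^ n = 1 / (1 - x) ^ 2 := by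
  have h1 := tsum_choose_mul_geometric_of_norm_lt_one 1 hx
  rw [← h1]
  refine tsum_congr fun n => ?_
  simp

lemma hasSum_lambert_sq {q Y : ℂ} (hq : ‖q‖ < 1) (hY : ‖Y‖ = 1) :
    HasSum (fun m : ℕ => Y ^ (m + 1) * (q ^ (m + 1) / (1 - q ^ (m + 1)) ^ 2))
      (∑' n : ℕ, ((n : ℂ) + 1) * (q ^ n * (q * Y) / (1 - q ^ n * (q * Y)))) := by
  have h := hasSum_lambert (u := fun n => (n : ℂ) + 1) hq (Y := q * Y)
    (by rw [norm_mul, hY, mul_one]; exact hq) (fun n => by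
      have : ((n : ℂ) + 1) = ((n + 1 : ℝ) : ℂ) := by push_cast; ring
      rw [this, Complex.norm_of_nonneg (by positivity)]
      linarith)
  refine h.congr_fun fun m => ?_
  rw [tsum_succ_geometric (by rw [norm_pow]; exact pow_lt_one₀ (norm_nonneg _) hq (by simp)),
    mul_pow]
  ring

lemma kterm_real_succ {τ : ℂ} (hτ : 0 < τ.im) (b : ℝ) (n : ℕ) :
    kterm τ b ((n + 1 : ℕ) : ℤ) =
      -(ee τ ^ n * (ee τ * ee b) / (1 - ee τ ^ n * (ee τ * ee b))) := by
  have e1 : kterm τ b ((n + 1 : ℕ) : ℤ) = kterm τ (b + τ) n := by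
    rw [kterm, kterm, sg_natCast, sg_natCast]
    congr 3
    push_cast; ring
  rw [e1, kterm_natCast, ee_add, mul_comm (ee b)]
  intro c hc'
  refine ee_ne_one_of_im_ne_zero ?_
  have : ((b : ℂ) + τ + c * τ).im = (1 + c) * τ.im := by simp; ring
  rw [this]
  have : (0 : ℝ) ≤ c := by exact_mod_cast hc'
  positivity

lemma kterm_real_neg_succ {τ : ℂ} (hτ : 0 < τ.im) (b : ℝ) (n : ℕ) :
    kterm τ b (-(n + 1)) =
      ee τ ^ n * (ee τ * (ee b)⁻¹) / (1 - ee τ ^ n * (ee τ * (ee b)⁻¹)) := by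
  rw [kterm_neg_succ, div_eq_mul_inv (ee τ) (ee b)]
  intro c hc'
  refine ee_ne_one_of_im_ne_zero ?_
  have h : ((b : ℂ) + c * τ).im = c * τ.im := by simp
  rw [h]
  exact mul_ne_zero (by exact_mod_cast hc'.ne) hτ.ne'

lemma natCast_injective_neg : Function.Injective fun n : ℕ => (-(n + 1) : ℤ) :=
  fun a b h => by simpa using h

lemma natCast_injective_succ : Function.Injective fun n : ℕ => (n + 1 : ℤ) :=
  fun a b h => by simpa using h

lemma tsum_int_split_zero {f : ℤ → ℂ} (hf : Summable f) {g h : ℕ → ℂ}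
    (hg : ∀ n : ℕ, f (n + 1) = g n) (hh : ∀ n : ℕ, f (-(n + 1)) = h n) :
    Summable g ∧ Summable h ∧ ∑' c, f c = f 0 + (∑' n, g n + ∑' n, h n) := by
  have h1 : Summable g := (hf.comp_injective natCast_injective_succ).congr hg
  have h2 : Summable h := (hf.comp_injective natCast_injective_neg).congr hh
  refine ⟨h1, h2, ?_⟩
  rw [tsum_of_add_one_of_neg_add_one (hf.comp_injective natCast_injective_succ)
    (hf.comp_injective natCast_injective_neg), ← tsum_congr hg, ← tsum_congr hh]
  ring

/-- On the real line the term c = 0, where |e(b)| = 1, has weight zero, so the Lambert rearrangement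
still applies. -/
lemma K_real {τ : ℂ} (hτ : 0 < τ.im) (b : ℝ) :
    K τ b = -∑' m : ℕ, (ee b ^ (m + 1) + (ee b)⁻¹ ^ (m + 1)) *
      (ee τ ^ (m + 1) / (1 - ee τ ^ (m + 1)) ^ 2) := by
  have hq := norm_ee_lt_one hτ
  have hY : ‖ee b‖ = 1 := by rw [norm_ee]; simp
  have h1 := hasSum_lambert_sq hq hY
  have h2 := hasSum_lambert_sq hq (Y := (ee b)⁻¹) (by rw [norm_inv, hY, inv_one])
  have hs := summable_kterm hτ b id_weight
  have hg : ∀ n : ℕ, ((n + 1 : ℤ) : ℂ) * kterm τ b (n + 1) =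
      -(((n : ℂ) + 1) * (ee τ ^ n * (ee τ * ee b) / (1 - ee τ ^ n * (ee τ * ee b)))) := fun n => by
    have := kterm_real_succ hτ b n
    rw [Nat.cast_succ] at this
    rw [this, mul_neg]
    push_cast
    rfl
  have hh : ∀ n : ℕ, ((-(n + 1) : ℤ) : ℂ) * kterm τ b (-(n + 1)) =
      -(((n : ℂ) + 1) * (ee τ ^ n * (ee τ * (ee b)⁻¹) / (1 - ee τ ^ n * (ee τ * (ee b)⁻¹)))) :=
    fun n => by
      rw [kterm_real_neg_succ hτ b n, ← neg_mul]
      push_cast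
      rfl
  simp only [add_mul]
  rw [(h1.add h2).tsum_eq, K, kser, (tsum_int_split_zero hs hg hh).2.2, Int.cast_zero, zero_mul,
    zero_add, tsum_neg, tsum_neg, neg_add]

lemma psum_nat_mul {τ : ℂ} (hτ : 0 < τ.im) (m : ℕ) : psum (((m + 1 : ℕ) : ℂ) * τ) =
    (2 * Real.pi * I) ^ 2 * (ee τ ^ (m + 1) / (1 - ee τ ^ (m + 1)) ^ 2) := by
  rw [psum_of_im_pos (im_mul_pos hτ m.succ_ne_zero), ee_nat_mul, sub_sq_comm]

/-- This makes `E` Eisenstein at real torsion points: the Lambert series of `K` is the Fourier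
transform of c ↦ psum(cτ). The term c = 0 accounts for the constant B₂(0)/2 = 1/12, because psum 0 =
π²/3. -/
lemma E_real {τ : ℂ} (hτ : 0 < τ.im) (b : ℝ) :
    E τ 0 b = -(4 * Real.pi ^ 2 : ℂ)⁻¹ * ∑' c : ℤ, ee (c * b) * psum (c * τ) := by
  have hs : Summable fun c : ℤ => ee (c * b) * psum (c * τ) := by
    have h := (summable_psum_outer hτ 0).norm
    refine Summable.of_norm (h.congr fun c => ?_)
    have : ‖ee (c * b)‖ = 1 := by rw [norm_ee]; simp
    rw [norm_mul, this, one_mul, zero_add]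
  have hpi : (Real.pi : ℂ) ≠ 0 := by exact_mod_cast Real.pi_ne_zero
  have h1 : ∀ m : ℕ, ee (((m + 1 : ℤ) : ℂ) * b) * psum (((m + 1 : ℤ) : ℂ) * τ) =
      (2 * Real.pi * I) ^ 2 * (ee b ^ (m + 1) * (ee τ ^ (m + 1) / (1 - ee τ ^ (m + 1)) ^ 2)) := by
    intro m
    rw [show ((m + 1 : ℤ) : ℂ) = ((m + 1 : ℕ) : ℂ) by push_cast; ring, ee_nat_mul, psum_nat_mul hτ]
    exact mul_left_comm _ _ _
  have h2 : ∀ m : ℕ, ee (((-(m + 1) : ℤ) : ℂ) * b) * psum (((-(m + 1) : ℤ) : ℂ) * τ) =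
      (2 * Real.pi * I) ^ 2 *
        ((ee b)⁻¹ ^ (m + 1) * (ee τ ^ (m + 1) / (1 - ee τ ^ (m + 1)) ^ 2)) := by
    intro m
    rw [show ((-(m + 1) : ℤ) : ℂ) = -((m + 1 : ℕ) : ℂ) by push_cast; ring, neg_mul, neg_mul,
      psum_neg, ee_neg, ee_nat_mul, psum_nat_mul hτ, inv_pow]
    exact mul_left_comm _ _ _
  obtain ⟨hs1, hs2, hsum⟩ := tsum_int_split_zero hs h1 h2
  rw [hsum, ← hs1.tsum_add hs2]
  simp only [← mul_add, ← add_mul]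
  rw [tsum_mul_left, Int.cast_zero, zero_mul, zero_mul, ee_zero, psum_zero, E, ofReal_zero,
    zero_mul, zero_add, zero_mul, add_zero, K_real hτ]
  generalize ∑' m : ℕ, (ee b ^ (m + 1) + (ee b)⁻¹ ^ (m + 1)) *
      (ee τ ^ (m + 1) / (1 - ee τ ^ (m + 1)) ^ 2) = A
  rw [mul_pow, I_sq]
  field_simp
  ring

lemma E_zero_zero {τ : ℂ} (hτ : 0 < τ.im) : E τ 0 0 = -P τ 0 0 := by
  rw [E_real hτ, P]
  simp

end ToricHecke

/-! ### Relations at all points of the torus, and the Eisenstein span of level `l`. -/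

namespace ToricHecke

open Complex Filter Topology UpperHalfPlane

/-! ### Functions on the torus -/

/-- The torus `(ℝ / ℤ)²`, whose points parametrize the points of the curves `ℂ / (ℤτ + ℤ)`. -/
abbrev Tor : Type := AddCircle (1 : ℝ) × AddCircle (1 : ℝ)

/-- The class of `(a, b)`. -/
def tor (a b : ℝ) : Tor := (a, b)

lemma tor_surjective (x : Tor) : ∃ a b, tor a b = x := by
  obtain ⟨x, y⟩ := x
  obtain ⟨a, rfl⟩ := QuotientAddGroup.mk_surjective x
  obtain ⟨b, rfl⟩ := QuotientAddGroup.mk_surjective y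
  exact ⟨a, b, rfl⟩

lemma circle_eq_iff (a b : ℝ) : (a : AddCircle (1 : ℝ)) = b ↔ ∃ n : ℤ, b = a + n := by
  rw [eq_comm, ← sub_eq_zero, ← AddCircle.coe_sub, AddCircle.coe_eq_zero_iff]
  simp only [zsmul_eq_mul, mul_one]
  exact exists_congr fun n => ⟨fun h => by linarith, fun h => by linarith⟩

lemma tor_eq_iff (a b a' b' : ℝ) :
    tor a b = tor a' b' ↔ (∃ m : ℤ, a' = a + m) ∧ ∃ n : ℤ, b' = b + n := by
  rw [tor, tor, Prod.ext_iff, circle_eq_iff, circle_eq_iff]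

lemma tor_add (a b a' b' : ℝ) : tor a b + tor a' b' = tor (a + a') (b + b') := rfl

lemma tor_neg (a b : ℝ) : -tor a b = tor (-a) (-b) := rfl

lemma tor_zsmul (n : ℤ) (a b : ℝ) : n • tor a b = tor (n * a) (n * b) := by
  simp [tor]

lemma tor_zero : tor 0 0 = 0 := rfl

lemma tor_eq_zero_iff (τ : ℍ) (a b : ℝ) : tor a b = 0 ↔ (a : ℂ) * τ + b ∈ latt τ := by
  rw [← tor_zero, tor_eq_iff]
  constructor
  · rintro ⟨⟨m, hm⟩, n, hn⟩
    refine ⟨-m, -n, ?_⟩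
    rw [show a = -m by linarith, show b = -n by linarith]
    push_cast; ring
  · rintro ⟨c, d, h⟩
    have h1 := congrArg Complex.im h
    simp at h1
    have h1 : a = c := h1.resolve_right τ.im_ne_zero
    subst h1
    have h2 := congrArg Complex.re h
    simp at h2
    exact ⟨⟨-c, by push_cast; ring⟩, -d, by push_cast; linarith⟩

/-- The function on the torus given by a doubly periodic function. -/
def torLift (f : ℂ → ℝ → ℝ → ℂ) (x : Tor) (τ : ℍ) : ℂ := f τ x.1.out x.2.out

lemma torLift_tor {f : ℂ → ℝ → ℝ → ℂ} (h1 : ∀ τ : ℂ, 0 < τ.im → ∀ a b, f τ (a + 1) b = f τ a b)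
    (h2 : ∀ τ : ℂ, 0 < τ.im → ∀ a b, f τ a (b + 1) = f τ a b) (a b : ℝ) (τ : ℍ) :
    torLift f (tor a b) τ = f τ a b := by
  obtain ⟨m, hm⟩ := (circle_eq_iff a _).mp (QuotientAddGroup.out_eq' (tor a b).1).symm
  obtain ⟨n, hn⟩ := (circle_eq_iff b _).mp (QuotientAddGroup.out_eq' (tor a b).2).symm
  have p1 : ∀ b, Function.Periodic (fun a => f τ a b) 1 := fun b a => h1 τ τ.im_pos a b
  have p2 : ∀ a, Function.Periodic (fun b => f τ a b) 1 := fun a b => h2 τ τ.im_pos a b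
  rw [torLift, hm, hn]
  have e1 := (p1 (b + n)).int_mul m a
  have e2 := (p2 a).int_mul n b
  simp only [mul_one] at e1 e2
  rw [e1, e2]

/-- The logarithmic derivative of theta as a function on the torus. -/
def St : Tor → ℍ → ℂ := torLift S

/-- The Eisenstein series `E` as a function on the torus. -/
def Et : Tor → ℍ → ℂ := torLift E

/-- The Eisenstein series `P` as a function on the torus. -/
def Pt : Tor → ℍ → ℂ := torLift P

lemma St_tor (a b : ℝ) (τ : ℍ) : St (tor a b) τ = S τ a b :=
  torLift_tor (fun _ hτ a b => S_add_one_left hτ a b) (fun τ _ a b => S_add_one_right τ a b) a b τ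

lemma Et_tor (a b : ℝ) (τ : ℍ) : Et (tor a b) τ = E τ a b :=
  torLift_tor (fun _ hτ a b => E_add_one_left hτ a b) (fun τ _ a b => E_add_one_right τ a b) a b τ

lemma Pt_tor (a b : ℝ) (τ : ℍ) : Pt (tor a b) τ = P τ a b :=
  torLift_tor (fun τ _ a b => P_add_one_left τ a b) (fun τ _ a b => P_add_one_right τ a b) a b τ

lemma St_neg (x : Tor) : St (-x) = -St x := by
  obtain ⟨a, b, rfl⟩ := tor_surjective x
  ext τ
  rw [tor_neg, St_tor, S_neg τ.im_pos, Pi.neg_apply, St_tor]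

@[simp] lemma St_zero : St 0 = 0 := by
  ext τ
  rw [← tor_zero, St_tor, S_zero τ.im_pos]; rfl

lemma tor_rel_aux {a b J₁ J₂ J₃ K₁ K₂ K₃ : ℂ}
    (h : J₁ * J₂ - J₃ * (J₁ + J₂) + K₁ + K₂ + K₃ + J₃ = 0) :
    (J₁ + a - 1 / 2) * (J₂ + b - 1 / 2) -
      (J₃ + (a + b) - 1 / 2) * ((J₁ + a - 1 / 2) + (J₂ + b - 1 / 2)) =
    -(K₁ + a * J₁ + (a ^ 2 - a + 1 / 6) / 2) + -(K₂ + b * J₂ + (b ^ 2 - b + 1 / 6) / 2) +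
      -(K₃ + (a + b) * J₃ + ((a + b) ^ 2 - (a + b) + 1 / 6) / 2) := by
  linear_combination h

lemma S_three_term {τ : ℍ} {a b a' b' : ℝ} (h1 : tor a b ≠ 0) (h2 : tor a' b' ≠ 0)
    (h3 : tor (a + a') (b + b') ≠ 0) :
    S τ a b * S τ a' b' - S τ (a + a') (b + b') * (S τ a b + S τ a' b') =
      E τ a b + E τ a' b' + E τ (a + a') (b + b') := by
  rw [Ne, tor_eq_zero_iff τ] at h1 h2 h3
  have e : ((a + a' : ℝ) : ℂ) * τ + ((b + b' : ℝ) : ℂ) = (a * τ + b) + (a' * τ + b') := by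
    push_cast; ring
  rw [e] at h3
  have := three_term τ.im_pos h1 h2 h3
  simp only [S, E, e]
  push_cast
  exact tor_rel_aux this

lemma neg_S_sq {τ : ℍ} {a b : ℝ} (h : tor a b ≠ 0) :
    -S τ a b ^ 2 = E τ 0 0 + 2 * E τ a b + P τ a b := by
  rw [Ne, tor_eq_zero_iff τ] at h
  have := J_sq τ.im_pos h (hasDerivAt_J τ.im_pos a b h)
  have hpi : (2 * Real.pi * Complex.I : ℂ) ≠ 0 := by simp [Real.pi_ne_zero]
  rw [neg_div, mul_div_cancel_left₀ _ hpi] at this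
  simp only [S, E, ofReal_zero, zero_mul, zero_add]
  linear_combination -this

open Classical in
/-- The function `P`, put at the points of the torus times zero. -/
def dPt (x y : Tor) : ℍ → ℂ := if x = 0 then Pt y else 0

lemma dPt_zero (y : Tor) : dPt 0 y = Pt y := if_pos rfl

lemma dPt_of_ne {x : Tor} (h : x ≠ 0) (y : Tor) : dPt x y = 0 := if_neg h

lemma P_neg (τ : ℂ) (a b : ℝ) : P τ (-a) (-b) = P τ a b := by
  rw [P, P, ← (Equiv.neg ℤ).tsum_eq]
  congr 1
  refine tsum_congr fun c => ?_
  rw [← psum_neg]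
  congr 1
  simp only [Equiv.neg_apply]
  push_cast; ring

lemma Pt_neg (x : Tor) : Pt (-x) = Pt x := by
  obtain ⟨a, b, rfl⟩ := tor_surjective x
  ext τ
  rw [tor_neg, Pt_tor, P_neg, Pt_tor]

lemma Et_zero : Et 0 = -Pt 0 := by
  ext τ
  rw [← tor_zero, Et_tor, E_zero_zero τ.im_pos, Pi.neg_apply, Pt_tor]

lemma St_sq {x : Tor} (hx : x ≠ 0) : -St x ^ 2 = Et 0 + 2 * Et x + Pt x := by
  obtain ⟨a, b, rfl⟩ := tor_surjective x
  ext τ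
  simp only [← tor_zero, Pi.neg_apply, Pi.pow_apply, Pi.add_apply, Pi.mul_apply, St_tor, Et_tor,
    Pt_tor, neg_S_sq hx]
  rfl

/-- Read off from `St_sq`, all of whose other terms are even. -/
lemma Et_neg {x : Tor} : Et (-x) = Et x := by
  rcases eq_or_ne x 0 with rfl | hx
  · rw [neg_zero]
  have h1 := St_sq hx
  have h2 := St_sq (neg_ne_zero.mpr hx)
  rw [St_neg, neg_sq, h1, Pt_neg] at h2
  ext τ
  have := congrFun h2 τ
  simp only [Pi.add_apply, Pi.mul_apply, Pi.ofNat_apply] at this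
  linear_combination -this / 2

/-- The three-term relation for three points of the torus with sum zero. -/
lemma St_three_term {x y z : Tor} (h : x + y + z = 0) :
    St x * St y + St y * St z + St z * St x =
      (Et x + dPt x y) + (Et y + dPt y z) + (Et z + dPt z x) := by
  -- With x = 0 the relation is `St_sq`, or E(0) = -P(0) when all three points vanish. Cyclic
  -- symmetry reduces the other degenerate cases to this one.
  have hdeg : ∀ {x y z : Tor}, x + y + z = 0 → x = 0 →
      St x * St y + St y * St z + St z * St x =
      (Et x + dPt x y) + (Et y + dPt y z) + (Et z + dPt z x) := by
    rintro x y z h rfl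
    have hz : z = -y := by rw [zero_add] at h; exact (neg_eq_of_add_eq_zero_right h).symm
    subst hz
    rcases eq_or_ne y 0 with rfl | hy
    · simp only [neg_zero, St_zero, dPt_zero, Et_zero]
      simp
    · rw [dPt_zero, dPt_of_ne hy, dPt_of_ne (neg_ne_zero.mpr hy), St_neg, St_zero, Et_neg]
      linear_combination St_sq hy
  rcases eq_or_ne x 0 with hx | hx
  · exact hdeg h hx
  rcases eq_or_ne y 0 with hy | hy
  · have := hdeg (x := y) (y := z) (z := x) (by rw [← h]; abel) hy
    linear_combination this
  rcases eq_or_ne z 0 with hz | hz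
  · have := hdeg (x := z) (y := x) (z := y) (by rw [← h]; abel) hz
    linear_combination this
  rw [dPt_of_ne hx, dPt_of_ne hy, dPt_of_ne hz]
  have hz' : z = -(x + y) := (neg_eq_of_add_eq_zero_right h).symm
  subst hz'
  rw [neg_ne_zero] at hz
  rw [St_neg, Et_neg]
  obtain ⟨a, b, rfl⟩ := tor_surjective x
  obtain ⟨a', b', rfl⟩ := tor_surjective y
  rw [tor_add] at *
  ext τ
  simp only [Pi.neg_apply, Pi.add_apply, Pi.mul_apply, St_tor, Et_tor, Pi.zero_apply]
  linear_combination S_three_term (τ := τ) hx hy hz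

/-! ### The Eisenstein series of level `l` -/

lemma natCast_residueEquiv_aux {l : ℕ} [NeZero l] (a : ℤ) (n : ℤ) :
    ((a + l * n : ℤ) : ZMod l) = a := by simp

/-- The integers in a residue class. -/
def residueEquiv (l : ℕ) [NeZero l] (a : ℤ) : ℤ ≃ {c : ℤ // (c : ZMod l) = a} where
  toFun n := ⟨a + l * n, natCast_residueEquiv_aux a n⟩
  invFun c := (c - a) / l
  left_inv n := by simp [NeZero.ne l]
  right_inv c := by
    have h := c.2
    rw [← sub_eq_zero, ← Int.cast_sub, ZMod.intCast_zmod_eq_zero_iff_dvd] at h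
    apply Subtype.ext
    simp only
    rw [Int.mul_ediv_cancel' h]; ring

lemma eisG_eq (l : ℕ) [NeZero l] (a b : ℤ) :
    eisG l (a, b) = (4 * Real.pi ^ 2 / l ^ 2 : ℂ) • Pt (tor (a / l) (b / l)) := by
  have hl : (l : ℂ) ≠ 0 := by exact_mod_cast NeZero.ne l
  have hpi : (Real.pi : ℂ) ≠ 0 := by exact_mod_cast Real.pi_ne_zero
  ext τ
  rw [Pi.smul_apply, Pt_tor, P, eisG, ← (residueEquiv l a).tsum_eq, smul_eq_mul, ← mul_assoc]
  have : (4 * Real.pi ^ 2 / l ^ 2 : ℂ) * (4 * Real.pi ^ 2 : ℂ)⁻¹ = (l ^ 2 : ℂ)⁻¹ := by field_simp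
  rw [this, ← tsum_mul_left]
  refine tsum_congr fun n => ?_
  rw [← (residueEquiv l b).tsum_eq, psum, ← tsum_mul_left]
  refine tsum_congr fun m => ?_
  simp only [residueEquiv, Equiv.coe_fn_mk]
  push_cast
  have : ((a : ℂ) + l * n) * τ + (b + l * m) = l * (a / l * τ + b / l + n * τ + m) := by
    field_simp
    ring
  rw [this, mul_zpow, zpow_neg (l : ℂ)]
  rfl

/-- The span of the Eisenstein series of level `l`. -/
def eisSpan (l : ℕ) : Submodule ℂ (ℍ → ℂ) := Submodule.span ℂ (Set.range (eisG l))

lemma Pt_mem_eisSpan (l : ℕ) [NeZero l] (a b : ℤ) : Pt (tor (a / l) (b / l)) ∈ eisSpan l := by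
  have hl : (l : ℂ) ≠ 0 := by exact_mod_cast NeZero.ne l
  have hpi : (Real.pi : ℂ) ≠ 0 := by exact_mod_cast Real.pi_ne_zero
  have h : (4 * Real.pi ^ 2 / l ^ 2 : ℂ) ≠ 0 := by simp [hl, hpi]
  have : Pt (tor (a / l) (b / l)) = (4 * Real.pi ^ 2 / l ^ 2 : ℂ)⁻¹ • eisG l (a, b) := by
    rw [eisG_eq, inv_smul_smul₀ h]
  rw [this]
  exact Submodule.smul_mem _ _ (Submodule.subset_span ⟨_, rfl⟩)

lemma tsum_psum_residue {τ : ℂ} (hτ : 0 < τ.im) {l : ℕ} (hl : l ≠ 0) (r : ℕ) :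
    ∑' c : ℤ, psum ((l * c + r) * τ) =
      4 * Real.pi ^ 2 / l ^ 2 * ∑ j ∈ Finset.range l, P τ (r / l) (j / l) := by
  have hl' : (l : ℂ) ≠ 0 := by exact_mod_cast hl
  have hpi : (Real.pi : ℂ) ≠ 0 := by exact_mod_cast Real.pi_ne_zero
  have h := P_root hτ hl (r / l) 0
  simp only [zero_add] at h
  rw [h, P, div_mul_eq_mul_div, mul_div_assoc, mul_div_cancel_left₀ _ (pow_ne_zero 2 hl'),
    mul_inv_cancel_left₀ (by simp [hpi])]
  refine tsum_congr fun c => ?_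
  congr 1
  push_cast
  field_simp
  ring

/-- Split the Fourier sum of `E_real` by c modulo l. The character is constant on each class, and
each class sum is a combination of the `P` at l-torsion points by `tsum_psum_residue`. -/
lemma Et_mem_eisSpan (l : ℕ) [NeZero l] (b : ℤ) : Et (tor 0 (b / l)) ∈ eisSpan l := by
  have hl : (l : ℂ) ≠ 0 := by exact_mod_cast NeZero.ne l
  have hpi : (Real.pi : ℂ) ≠ 0 := by exact_mod_cast Real.pi_ne_zero
  have : Et (tor 0 (b / l)) = ∑ r ∈ Finset.range l, ∑ j ∈ Finset.range l,
      (-ee (r * b / l) / l ^ 2) • Pt (tor ((r : ℤ) / l) ((j : ℤ) / l)) := by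
    ext τ
    have hs : Summable fun c : ℤ => ee (c * ((b / l : ℝ) : ℂ)) * psum (c * τ) := by
      have h := (summable_psum_outer τ.im_pos 0).norm
      refine Summable.of_norm (h.congr fun c => ?_)
      have : ‖ee (c * ((b / l : ℝ) : ℂ))‖ = 1 := by rw [norm_ee, im_mul_ofReal]; simp
      rw [norm_mul, this, one_mul, zero_add]
    rw [Et_tor, E_real τ.im_pos, tsum_int_split (NeZero.ne l) hs, Finset.sum_apply, Finset.mul_sum]
    refine Finset.sum_congr rfl fun r _ => ?_
    have he : ∀ c : ℤ, ee (((l * c + r : ℤ) : ℂ) * ((b / l : ℝ) : ℂ)) = ee (r * b / l) := fun c => by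
      have : ((l * c + r : ℤ) : ℂ) * ((b / l : ℝ) : ℂ) = (c * b : ℤ) + r * b / l := by
        push_cast; field_simp
      rw [this, ee_add, ee_int, one_mul]
    simp only [he]
    rw [tsum_mul_left]
    push_cast
    rw [tsum_psum_residue τ.im_pos (NeZero.ne l), Finset.sum_apply, Finset.mul_sum,
      Finset.mul_sum, Finset.mul_sum]
    refine Finset.sum_congr rfl fun j _ => ?_
    rw [Pi.smul_apply, Pt_tor, smul_eq_mul]
    field_simp
  rw [this]
  exact Submodule.sum_mem _ fun r _ => Submodule.sum_mem _ fun j _ =>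
    Submodule.smul_mem _ _ (Pt_mem_eisSpan l _ _)

/-! ### Distribution relations -/

lemma circle_nsmul_eq_iff {n : ℕ} (hn : n ≠ 0) (a : ℝ) (z : AddCircle (1 : ℝ)) :
    n • z = a ↔ ∃ i ∈ Finset.range n, (((a + i) / n : ℝ) : AddCircle (1 : ℝ)) = z := by
  have hn' : (n : ℝ) ≠ 0 := by exact_mod_cast hn
  have hnz : (n : ℤ) ≠ 0 := by exact_mod_cast hn
  constructor
  · obtain ⟨y, rfl⟩ := QuotientAddGroup.mk_surjective z
    intro h
    have h' : ((n * y : ℝ) : AddCircle (1 : ℝ)) = a := by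
      rw [← h, ← nsmul_eq_mul]; rfl
    obtain ⟨m, hm⟩ := (circle_eq_iff _ _).mp h'.symm
    refine ⟨(m % n).toNat, ?_, ?_⟩
    · rw [Finset.mem_range]
      have := Int.emod_nonneg m hnz
      have := Int.emod_lt_of_pos m (by omega : (0 : ℤ) < n)
      omega
    · refine (circle_eq_iff _ _).mpr ⟨m / n, ?_⟩
      have h1 : (((m % n).toNat : ℕ) : ℝ) = (m : ℝ) - n * ((m / n : ℤ) : ℝ) := by
        have h2 := Int.toNat_of_nonneg (Int.emod_nonneg m hnz)
        have h3 : (((m % n).toNat : ℕ) : ℤ) = m - n * (m / n) := by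
          rw [h2]; linarith [Int.emod_add_mul_ediv m n]
        exact_mod_cast h3
      rw [h1]
      field_simp
      linarith
  · rintro ⟨i, -, rfl⟩
    rw [← AddCircle.coe_nsmul, nsmul_eq_mul, mul_div_cancel₀ _ hn', circle_eq_iff]
    exact ⟨-i, by push_cast; ring⟩

lemma circle_div_injOn {n : ℕ} (hn : n ≠ 0) (a : ℝ) : Set.InjOn
    (fun i : ℕ => (((a + i) / n : ℝ) : AddCircle (1 : ℝ))) (Finset.range n : Finset ℕ) := by
  have hn' : (n : ℝ) ≠ 0 := by exact_mod_cast hn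
  intro i hi j hj h
  obtain ⟨m, hm⟩ := (circle_eq_iff _ _).mp h
  field_simp at hm
  have h1 : (j : ℤ) = i + n * m := by
    have : (j : ℝ) = i + n * m := by linarith
    exact_mod_cast this
  simp only [Finset.coe_range, Set.mem_Iio] at hi hj
  have h2 := congrArg (· % (n : ℤ)) h1
  simp only [Int.add_mul_emod_self_left] at h2
  rw [Int.emod_eq_of_lt (by omega) (by omega), Int.emod_eq_of_lt (by omega) (by omega)] at h2
  exact_mod_cast h2.symm

/-- The points of the torus over a given one, under multiplication by `n`. -/
lemma finsum_nsmul_fiber {M : Type*} [AddCommMonoid M] {n : ℕ} (hn : n ≠ 0) (a b : ℝ)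
    (f : Tor → M) :
    {z : Tor | n • z = tor a b}.Finite ∧ ∑ᶠ z ∈ {z : Tor | n • z = tor a b}, f z =
      ∑ i ∈ Finset.range n, ∑ j ∈ Finset.range n, f (tor ((a + i) / n) ((b + j) / n)) := by
  have h : {z : Tor | n • z = tor a b} = (fun p : ℕ × ℕ => tor ((a + p.1) / n) ((b + p.2) / n)) ''
      (Finset.range n ×ˢ Finset.range n : Finset (ℕ × ℕ)) := by
    ext ⟨x, y⟩
    simp only [Set.mem_ofPred_eq, tor, Prod.smul_mk, Prod.mk.injEq, Set.mem_image,
      Finset.coe_product, Set.mem_prod, Prod.exists, Finset.mem_coe]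
    rw [circle_nsmul_eq_iff hn, circle_nsmul_eq_iff hn]
    constructor
    · rintro ⟨⟨i, hi, h1⟩, j, hj, h2⟩
      exact ⟨i, j, ⟨hi, hj⟩, h1, h2⟩
    · rintro ⟨i, j, ⟨hi, hj⟩, h1, h2⟩
      exact ⟨⟨i, hi, h1⟩, j, hj, h2⟩
  rw [h]
  refine ⟨(Finset.finite_toSet _).image _, ?_⟩
  rw [finsum_mem_image, finsum_mem_coe_finset, Finset.sum_product]
  rintro ⟨i, j⟩ hp ⟨i', j'⟩ hp' heq
  simp only [Finset.coe_product, Set.mem_prod] at hp hp'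
  simp only [tor, Prod.mk.injEq] at heq
  rw [circle_div_injOn hn a hp.1 hp'.1 heq.1, circle_div_injOn hn b hp.2 hp'.2 heq.2]

lemma St_distribution {n : ℕ} (hn : n ≠ 0) (x : Tor) :
    ∑ᶠ z ∈ {z : Tor | n • z = x}, St z = (n : ℂ) • St x := by
  obtain ⟨a, b, rfl⟩ := tor_surjective x
  rw [(finsum_nsmul_fiber hn a b St).2]
  ext τ
  simp only [Finset.sum_apply, Pi.smul_apply, St_tor, smul_eq_mul]
  exact S_distribution τ.im_pos hn a b

lemma Et_distribution {n : ℕ} (hn : n ≠ 0) (x : Tor) :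
    ∑ᶠ z ∈ {z : Tor | n • z = x}, Et z = Et x := by
  obtain ⟨a, b, rfl⟩ := tor_surjective x
  rw [(finsum_nsmul_fiber hn a b Et).2]
  ext τ
  simp only [Finset.sum_apply, Et_tor]
  exact E_distribution τ.im_pos hn a b

lemma Pt_distribution {n : ℕ} (hn : n ≠ 0) (x : Tor) :
    ∑ᶠ z ∈ {z : Tor | n • z = x}, Pt z = (n ^ 2 : ℂ) • Pt x := by
  obtain ⟨a, b, rfl⟩ := tor_surjective x
  rw [(finsum_nsmul_fiber hn a b Pt).2]
  ext τ
  simp only [Finset.sum_apply, Pi.smul_apply, Pt_tor, smul_eq_mul]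
  exact P_distribution τ.im_pos hn a b

end ToricHecke

/-! ### Forms attached to integral matrices, and their cocycle relation modulo Eisenstein series. -/

namespace ToricHecke

open Matrix UpperHalfPlane

/-! ### Sums over the fibres of a homomorphism -/

section push

variable {A B C V : Type*} [AddCommGroup A] [AddCommGroup B] [AddCommGroup C] [AddCommGroup V]

/-- The sum of `f` over the fibre of `φ` over `x`. -/
def push (φ : A →+ B) (f : A → V) (x : B) : V := ∑ᶠ z ∈ {z | φ z = x}, f z

/-- All fibres of `φ` are finite. -/
def FiniteFibers (φ : A →+ B) : Prop := ∀ x, {z | φ z = x}.Finite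

lemma push_comp {φ : B →+ C} {ψ : A →+ B} (hφ : FiniteFibers φ) (hψ : FiniteFibers ψ) (f : A → V)
    (x : C) : push (φ.comp ψ) f x = push φ (push ψ f) x := by
  have h : {z | (φ.comp ψ) z = x} = ⋃ y ∈ {y | φ y = x}, {z | ψ z = y} := by
    ext z; simp
  rw [push, h, finsum_mem_biUnion _ (hφ x) fun y _ => hψ y]
  · rfl
  · intro y _ y' _ hne
    rw [Function.onFun, Set.disjoint_left]
    rintro z h1 h2
    exact hne (h1.symm.trans h2)

lemma push_of_inverse {φ : A →+ B} (ψ : B → A) (h1 : ∀ x, φ (ψ x) = x) (h2 : ∀ z, ψ (φ z) = z)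
    (f : A → V) (x : B) : push φ f x = f (ψ x) := by
  have h : {z | φ z = x} = {ψ x} := by
    ext z
    simp only [Set.mem_ofPred_eq, Set.mem_singleton_iff]
    exact ⟨fun h => by rw [← h, h2], fun h => by rw [h, h1]⟩
  rw [push, h, finsum_mem_singleton]

lemma push_add {φ : A →+ B} (hφ : FiniteFibers φ) (f g : A → V) (x : B) :
    push φ (fun z => f z + g z) x = push φ f x + push φ g x := finsum_mem_add_distrib (hφ x)

lemma push_smul [Module ℂ V] {φ : A →+ B} (hφ : FiniteFibers φ) (c : ℂ) (f : A → V) (x : B) :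
    push φ (fun z => c • f z) x = c • push φ f x := by
  rw [push, push, finsum_mem_eq_finite_toFinset_sum _ (hφ x),
    finsum_mem_eq_finite_toFinset_sum _ (hφ x), Finset.smul_sum]

end push

/-! ### Integral matrices acting on pairs -/

section act

variable {A : Type*} [AddCommGroup A]

/-- The action of integral matrices on `A × A`. -/
def act (M : Matrix (Fin 2) (Fin 2) ℤ) : A × A →+ A × A where
  toFun z := (M 0 0 • z.1 + M 0 1 • z.2, M 1 0 • z.1 + M 1 1 • z.2)
  map_zero' := by simp
  map_add' x y := by
    simp only [Prod.fst_add, Prod.snd_add, smul_add, Prod.mk_add_mk, Prod.mk.injEq]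
    exact ⟨by abel, by abel⟩

lemma act_apply (M : Matrix (Fin 2) (Fin 2) ℤ) (z : A × A) :
    act M z = (M 0 0 • z.1 + M 0 1 • z.2, M 1 0 • z.1 + M 1 1 • z.2) := rfl

lemma act_mul (M N : Matrix (Fin 2) (Fin 2) ℤ) : act (A := A) (M * N) = (act M).comp (act N) := by
  ext z <;> simp [act_apply, Matrix.mul_apply, Fin.sum_univ_two, smul_smul, add_smul, smul_add] <;> abel

lemma act_one : act (A := A) 1 = AddMonoidHom.id _ := by
  ext z <;> simp [act_apply]

lemma act_mul_apply (M N : Matrix (Fin 2) (Fin 2) ℤ) (z : A × A) :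
    act (M * N) z = act M (act N z) := by rw [act_mul]; rfl

lemma act_smul_one (n : ℤ) (z : A × A) : act (n • 1) z = n • z := by
  ext <;> simp [act_apply, Matrix.smul_apply, -zsmul_eq_mul, -zsmul_one]

lemma push_act_of_mul_eq_one {V : Type*} [AddCommGroup V] {M N : Matrix (Fin 2) (Fin 2) ℤ}
    (h : M * N = 1) (f : A × A → V) (x : A × A) : push (act M) f x = f (act N x) := by
  refine push_of_inverse _ (fun x => ?_) (fun z => ?_) f x
  · rw [← act_mul_apply, h, act_one]; rfl
  · rw [← act_mul_apply, mul_eq_one_comm.mp h, act_one]; rfl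

lemma finite_zsmul_fiber {n : ℤ} (hn : n ≠ 0) (x : Tor) : {z : Tor | n • z = x}.Finite := by
  have key : ∀ (n : ℕ), n ≠ 0 → ∀ x : Tor, {z : Tor | n • z = x}.Finite := by
    intro n hn x
    obtain ⟨a, b, rfl⟩ := tor_surjective x
    exact (finsum_nsmul_fiber (M := ℕ) hn a b 0).1
  obtain ⟨m, rfl | rfl⟩ := Int.eq_nat_or_neg n
  · simpa using key m (by simpa using hn) x
  · have := key m (by simpa using hn) (-x)
    refine this.subset fun z hz => ?_
    simp only [Set.mem_ofPred_eq, neg_zsmul, natCast_zsmul] at hz ⊢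
    rw [← hz, neg_neg]

/-- Applying the adjugate confines a fibre to the solutions of det(M) z = const. -/
lemma finiteFibers_act {M : Matrix (Fin 2) (Fin 2) ℤ} (hM : M.det ≠ 0) :
    FiniteFibers (act (A := Tor) M) := by
  intro x
  refine ((finite_zsmul_fiber hM (act M.adjugate x).1).prod
    (finite_zsmul_fiber hM (act M.adjugate x).2)).subset fun z hz => ?_
  have hz : act M z = x := hz
  have : act M.adjugate x = M.det • z := by
    rw [← hz, ← act_mul_apply, Matrix.adjugate_mul, act_smul_one]
  rw [this]
  exact ⟨rfl, rfl⟩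

lemma push_act_mul {V : Type*} [AddCommGroup V] {M N : Matrix (Fin 2) (Fin 2) ℤ} (hM : M.det ≠ 0)
    (hN : N.det ≠ 0) (f : Tor × Tor → V) (x : Tor × Tor) :
    push (act (M * N)) f x = push (act M) (push (act N) f) x := by
  rw [act_mul, push_comp (finiteFibers_act hM) (finiteFibers_act hN)]

lemma push_diagonal {V : Type*} [AddCommGroup V] {m n : ℤ} (hm : m ≠ 0) (hn : n ≠ 0)
    (f : Tor × Tor → V) (x : Tor × Tor) :
    push (act !![m, 0; 0, n]) f x = ∑ᶠ z ∈ {z : Tor | m • z = x.1},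
      ∑ᶠ w ∈ {w : Tor | n • w = x.2}, f (z, w) := by
  classical
  have hf1 := finite_zsmul_fiber hm x.1
  have hf2 := finite_zsmul_fiber hn x.2
  have h : {z : Tor × Tor | act !![m, 0; 0, n] z = x} =
      (hf1.toFinset ×ˢ hf2.toFinset : Finset (Tor × Tor)) := by
    ext z
    simp [act_apply, Prod.ext_iff]
  rw [push, h, finsum_mem_coe_finset, Finset.sum_product, finsum_mem_eq_finite_toFinset_sum _ hf1]
  refine Finset.sum_congr rfl fun z _ => ?_
  rw [finsum_mem_eq_finite_toFinset_sum _ hf2]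

end act

/-! ### Distribution relations for integers -/

lemma finsum_zsmul_fiber {V : Type*} [AddCommGroup V] [Module ℂ V] {f : Tor → V} {ε : ℂ}
    (hneg : ∀ x, f (-x) = ε • f x) {c : ℤ → ℂ}
    (hc : ∀ n, c (-n) = ε * c n)
    (hdist : ∀ n : ℕ, n ≠ 0 → ∀ x, ∑ᶠ z ∈ {z : Tor | n • z = x}, f z = c n • f x)
    {n : ℤ} (hn : n ≠ 0) (x : Tor) : ∑ᶠ z ∈ {z : Tor | n • z = x}, f z = c n • f x := by
  obtain ⟨m, rfl | rfl⟩ := Int.eq_nat_or_neg n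
  · simpa using hdist m (by simpa using hn) x
  · have h := hdist m (by simpa using hn) (-x)
    have e : {z : Tor | (-(m : ℤ)) • z = x} = {z : Tor | m • z = -x} := by
      ext z
      simp only [Set.mem_ofPred_eq, neg_zsmul, natCast_zsmul]
      rw [neg_eq_iff_eq_neg]
    rw [e, h, hneg, hc, smul_smul, mul_comm]

lemma St_zsmul_fiber {n : ℤ} (hn : n ≠ 0) (x : Tor) :
    ∑ᶠ z ∈ {z : Tor | n • z = x}, St z = (n : ℂ) • St x :=
  finsum_zsmul_fiber (ε := -1) (c := fun n => n) (by simp [St_neg])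
    (by simp) (fun n hn x => by simpa using St_distribution hn x) hn x

lemma Et_zsmul_fiber {n : ℤ} (hn : n ≠ 0) (x : Tor) :
    ∑ᶠ z ∈ {z : Tor | n • z = x}, Et z = Et x := by
  simpa using finsum_zsmul_fiber (ε := 1) (c := fun _ => 1) (by simp [Et_neg])
    (by simp) (fun n hn x => by simpa using Et_distribution hn x) hn x

lemma Pt_zsmul_fiber {n : ℤ} (hn : n ≠ 0) (x : Tor) :
    ∑ᶠ z ∈ {z : Tor | n • z = x}, Pt z = ((n : ℂ) ^ 2) • Pt x :=
  finsum_zsmul_fiber (ε := 1) (c := fun n => (n : ℂ) ^ 2) (by simp [Pt_neg])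
    (by simp) (fun n hn x => by simpa using Pt_distribution hn x) hn x

lemma const_zsmul_fiber {V : Type*} [AddCommGroup V] [Module ℂ V] {n : ℤ} (hn : n ≠ 0) (x : Tor)
    (v : V) : ∑ᶠ z ∈ {z : Tor | n • z = x}, (fun _ : Tor => v) z = ((n : ℂ) ^ 2) • v := by
  refine finsum_zsmul_fiber (ε := 1) (c := fun n => (n : ℂ) ^ 2) (f := fun _ => v)
    (by simp) (by simp) (fun n hn x => ?_) hn x
  obtain ⟨a, b, rfl⟩ := tor_surjective x
  rw [(finsum_nsmul_fiber hn a b _).2]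
  simp only [Finset.sum_const, Finset.card_range, smul_smul]
  rw [← Nat.cast_smul_eq_nsmul ℂ]
  congr 1
  push_cast; ring

/-! ### The forms attached to pairs of cusps -/

/-- The external square of the function `St`. -/
def SS (z : Tor × Tor) : ℍ → ℂ := St z.1 * St z.2

lemma finsum_mem_mul {s t : Set Tor} (hs : s.Finite) (ht : t.Finite) (f g : Tor → ℍ → ℂ) :
    ∑ᶠ z ∈ s, ∑ᶠ w ∈ t, f z * g w = (∑ᶠ z ∈ s, f z) * ∑ᶠ w ∈ t, g w := by
  simp only [finsum_mem_eq_finite_toFinset_sum _ hs, finsum_mem_eq_finite_toFinset_sum _ ht]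
  rw [Finset.sum_mul_sum]

lemma push_diagonal_SS {m n : ℤ} (hm : m ≠ 0) (hn : n ≠ 0) (x : Tor × Tor) :
    push (act !![m, 0; 0, n]) SS x = (m * n : ℂ) • SS x := by
  rw [push_diagonal hm hn]
  simp only [SS]
  rw [finsum_mem_mul (finite_zsmul_fiber hm _) (finite_zsmul_fiber hn _), St_zsmul_fiber hm,
    St_zsmul_fiber hn, smul_mul_smul_comm]

lemma det_transpose_adjugate (M : Matrix (Fin 2) (Fin 2) ℤ) : (M.adjugateᵀ).det = M.det := by
  rw [det_transpose, det_adjugate]; simp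

/-- The function attached to a pair of vectors (the columns of `M`) and a pair of points. -/
def pairForm (M : Matrix (Fin 2) (Fin 2) ℤ) (x : Tor × Tor) : ℍ → ℂ :=
  (-(M.det : ℂ)⁻¹) • push (act M.adjugateᵀ) SS x

lemma pairForm_of_det_eq_zero {M : Matrix (Fin 2) (Fin 2) ℤ} (h : M.det = 0) (x : Tor × Tor) :
    pairForm M x = 0 := by simp [pairForm, h]

lemma pairForm_mul {M N : Matrix (Fin 2) (Fin 2) ℤ} (hM : M.det ≠ 0) (hN : N.det ≠ 0)
    (x : Tor × Tor) :
    pairForm (M * N) x = ((M.det : ℂ)⁻¹) • push (act M.adjugateᵀ) (pairForm N) x := by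
  have hM' := hM
  have hN' := hN
  rw [← det_transpose_adjugate] at hM' hN'
  have : pairForm N = fun z => (-(N.det : ℂ)⁻¹) • push (act N.adjugateᵀ) SS z := rfl
  rw [this, push_smul (finiteFibers_act hM'), pairForm, det_mul, adjugate_mul_distrib,
    transpose_mul, push_act_mul hM' hN', smul_smul]
  congr 1
  push_cast
  rw [mul_inv]; ring

/-- The determinant and, by the distribution relation for `St`, the pushforward both acquire the
factor mn. This cancellation, valid for negative m and n too, makes the form depend only on the
lines spanned by the columns. -/
lemma pairForm_mul_diagonal (M : Matrix (Fin 2) (Fin 2) ℤ) {m n : ℤ} (hm : m ≠ 0) (hn : n ≠ 0)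
    (x : Tor × Tor) : pairForm (M * !![m, 0; 0, n]) x = pairForm M x := by
  have hm' : (m : ℂ) ≠ 0 := by exact_mod_cast hm
  have hn' : (n : ℂ) ≠ 0 := by exact_mod_cast hn
  rcases eq_or_ne M.det 0 with h | h
  · rw [pairForm_of_det_eq_zero h, pairForm_of_det_eq_zero]
    rw [det_mul, h, zero_mul]
  have hd : (!![m, 0; 0, n] : Matrix (Fin 2) (Fin 2) ℤ).det = m * n := by simp [det_fin_two]
  have hM' := h
  rw [← det_transpose_adjugate] at hM'
  have hN : pairForm !![m, 0; 0, n] = fun z => (-1 : ℂ) • SS z := by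
    funext z
    have e : (!![m, 0; 0, n] : Matrix (Fin 2) (Fin 2) ℤ).adjugateᵀ = !![n, 0; 0, m] := by
      rw [adjugate_fin_two]
      ext i j; fin_cases i <;> fin_cases j <;> simp
    rw [pairForm, e, push_diagonal_SS hn hm, hd, smul_smul]
    congr 1
    push_cast
    field_simp
  rw [pairForm_mul h (by rw [hd]; exact mul_ne_zero hm hn), hN, push_smul (finiteFibers_act hM'),
    smul_smul, pairForm]
  congr 1
  ring

/-- `SS` is symmetric and invariant under negating both points, so the sign is that of the
determinant. -/
lemma pairForm_mul_swap (M : Matrix (Fin 2) (Fin 2) ℤ) (x : Tor × Tor) :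
    pairForm (M * !![0, 1; 1, 0]) x = -pairForm M x := by
  rcases eq_or_ne M.det 0 with h | h
  · rw [pairForm_of_det_eq_zero h, pairForm_of_det_eq_zero, neg_zero]
    rw [det_mul, h, zero_mul]
  have hM' := h
  rw [← det_transpose_adjugate] at hM'
  have hN : pairForm !![0, 1; 1, 0] = fun z => (1 : ℂ) • SS z := by
    funext z
    have e : (!![0, 1; 1, 0] : Matrix (Fin 2) (Fin 2) ℤ).adjugateᵀ = !![0, -1; -1, 0] := by
      rw [adjugate_fin_two]
      ext i j; fin_cases i <;> fin_cases j <;> simp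
    rw [pairForm, e, push_act_of_mul_eq_one (N := !![0, -1; -1, 0])]
    · simp [SS, act_apply, St_neg, mul_comm, det_fin_two]
    · ext i j; fin_cases i <;> fin_cases j <;> simp
  rw [pairForm_mul h (by simp [det_fin_two]), hN, push_smul (finiteFibers_act hM'), pairForm,
    one_smul]
  ext τ
  simp

/-! ### The cocycle relation modulo Eisenstein series -/

/-- The correction term in the three-term relation. -/
def corr (z : Tor × Tor) : ℍ → ℂ := Et z.1 + dPt z.1 z.2

lemma finsum_dPt_left (n : ℤ) (x y : Tor) :
    ∑ᶠ z ∈ {z : Tor | n • z = x}, dPt z y = dPt x y := by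
  rcases eq_or_ne x 0 with rfl | hx
  · rw [dPt_zero]
    refine (finsum_mem_inter_support_eq _ _ {0} ?_).trans ?_
    · ext z
      simp only [Set.mem_inter_iff, Set.mem_ofPred_eq, Set.mem_singleton_iff]
      constructor
      · rintro ⟨-, h⟩
        refine ⟨?_, h⟩
        by_contra hz
        exact h (dPt_of_ne hz y)
      · rintro ⟨rfl, h⟩
        exact ⟨smul_zero n, h⟩
    · rw [finsum_mem_singleton, dPt_zero]
  · rw [dPt_of_ne hx]
    refine finsum_mem_eq_zero_of_forall_eq_zero fun z hz => dPt_of_ne ?_ y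
    rintro rfl
    exact hx (by rw [← hz.out, smul_zero])

/-- Factor the matrix into two diagonal ones and a unipotent one. In the second variable `Et` is
constant over r² points and `Pt` has distribution factor r². In the first, `Et` is invariant and
only z = 0 contributes to `dPt`. The unipotent factor acts trivially, as the second variable matters
only where the first is zero. -/
lemma push_corr_lower {p q r : ℤ} (hp : p ≠ 0) (hr : r ≠ 0) (x : Tor × Tor) :
    push (act !![p, 0; q, r]) corr x = ((r : ℂ) ^ 2) • corr x := by
  have hd : (!![1, 0; 0, r] : Matrix (Fin 2) (Fin 2) ℤ).det ≠ 0 := by simpa [det_fin_two] using hr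
  have hd1 : (!![p, 0; 0, 1] : Matrix (Fin 2) (Fin 2) ℤ).det ≠ 0 := by simpa [det_fin_two] using hp
  have hd2 : (!![1, 0; q, 1] : Matrix (Fin 2) (Fin 2) ℤ).det ≠ 0 := by simp [det_fin_two]
  have e : (!![p, 0; q, r] : Matrix (Fin 2) (Fin 2) ℤ) =
      !![p, 0; 0, 1] * (!![1, 0; q, 1] * !![1, 0; 0, r]) := by
    ext i j; fin_cases i <;> fin_cases j <;> simp [Matrix.mul_apply, Fin.sum_univ_two]
  have h1 : push (act !![1, 0; 0, r]) corr = fun z => ((r : ℂ) ^ 2) • corr z := by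
    funext z
    rw [push_diagonal one_ne_zero hr]
    have hz : {w : Tor | (1 : ℤ) • w = z.1} = {z.1} := by ext w; simp
    rw [hz, finsum_mem_singleton]
    simp only [corr]
    rw [finsum_mem_add_distrib (finite_zsmul_fiber hr z.2), const_zsmul_fiber hr, smul_add]
    congr 1
    rcases eq_or_ne z.1 0 with h | h
    · simp only [h, dPt_zero, Pt_zsmul_fiber hr]
    · simp only [dPt_of_ne h, smul_zero, finsum_mem_zero]
  have h2 : push (act !![1, 0; q, 1]) corr = corr := by
    funext z
    rw [push_act_of_mul_eq_one (N := !![1, 0; -q, 1])]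
    · simp only [corr, act_apply]
      rcases eq_or_ne z.1 0 with h | h
      · simp [h]
      · simp [dPt_of_ne h]
    · ext i j; fin_cases i <;> fin_cases j <;> simp
  have h2' : push (act !![1, 0; q, 1]) (fun z => ((r : ℂ) ^ 2) • corr z) =
      fun z => ((r : ℂ) ^ 2) • corr z := by
    funext z
    rw [push_smul (finiteFibers_act hd2), h2]
  have h3 : push (act !![p, 0; 0, 1]) corr x = corr x := by
    rw [push_diagonal hp one_ne_zero]
    have hz : {w : Tor | (1 : ℤ) • w = x.2} = {x.2} := by ext w; simp
    simp only [hz, finsum_mem_singleton, corr]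
    rw [finsum_mem_add_distrib (finite_zsmul_fiber hp x.1), Et_zsmul_fiber hp, finsum_dPt_left p]
  rw [e, push_act_mul hd1 (by rw [det_mul]; exact mul_ne_zero hd2 hd), funext fun y =>
    push_act_mul hd2 hd corr y, h1, h2', push_smul (finiteFibers_act hd1), h3]

lemma exists_lower_triangular {M : Matrix (Fin 2) (Fin 2) ℤ} (hM : M.det ≠ 0) :
    ∃ N N' : Matrix (Fin 2) (Fin 2) ℤ, ∃ p q r : ℤ, N * N' = 1 ∧ p ≠ 0 ∧ r ≠ 0 ∧
      M = N * !![p, 0; q, r] := by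
  set b := M 0 1 with hb
  set d := M 1 1 with hd
  set g : ℤ := ((Int.gcd b d : ℕ) : ℤ) with hg
  have hg0 : g ≠ 0 := by
    intro h
    have h' : Int.gcd b d = 0 := by rw [hg] at h; exact_mod_cast h
    rw [Int.gcd_eq_zero_iff] at h'
    apply hM
    rw [det_fin_two, ← hb, ← hd, h'.1, h'.2]; ring
  obtain ⟨b', hb'⟩ : g ∣ b := Int.gcd_dvd_left ..
  obtain ⟨d', hd'⟩ : g ∣ d := Int.gcd_dvd_right ..
  have hbez := Int.gcd_eq_gcd_ab b d
  set s := Int.gcdA b d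
  set t := Int.gcdB b d
  have h1 : b' * s + d' * t = 1 := by
    apply mul_left_cancel₀ hg0
    rw [← hg] at hbez
    linear_combination -hbez - s * hb' - t * hd'
  -- The unimodular factor sends (0, 1) to the primitive part of the second column of M, completed
  -- to a basis by Bézout.
  have hM' : M = !![t, b'; -s, d'] * !![d' * M 0 0 - b' * M 1 0, 0; s * M 0 0 + t * M 1 0, g] := by
    ext i j
    fin_cases i <;> fin_cases j <;> simp [Matrix.mul_apply, Fin.sum_univ_two]
    · linear_combination -(M 0 0) * h1
    · linear_combination hb'
    · linear_combination -(M 1 0) * h1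
    · linear_combination hd'
  refine ⟨!![t, b'; -s, d'], !![d', -b'; s, t], d' * M 0 0 - b' * M 1 0,
    s * M 0 0 + t * M 1 0, g, ?_, ?_, hg0, hM'⟩
  · ext i j
    fin_cases i <;> fin_cases j <;> simp [Matrix.mul_apply, Fin.sum_univ_two] <;>
    first | linear_combination h1 | ring
  · intro h0
    apply hM
    rw [hM', det_mul, h0]
    simp [det_fin_two]

/-- The multiples of the point `(0, 1 / l)` of the torus. -/
def cuspPoints (l : ℕ) : AddSubgroup Tor := AddSubgroup.zmultiples (tor 0 (1 / l))

lemma mem_cuspPoints {l : ℕ} {x : Tor} : x ∈ cuspPoints l ↔ ∃ j : ℤ, x = tor 0 (j / l) := by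
  rw [cuspPoints, AddSubgroup.mem_zmultiples_iff]
  refine exists_congr fun j => ?_
  rw [tor_zsmul, mul_zero, mul_one_div, eq_comm]

lemma corr_mem_eisSpan {l : ℕ} [NeZero l] {x y : Tor} (hx : x ∈ cuspPoints l)
    (hy : y ∈ cuspPoints l) : corr (x, y) ∈ eisSpan l := by
  obtain ⟨i, rfl⟩ := mem_cuspPoints.mp hx
  obtain ⟨j, rfl⟩ := mem_cuspPoints.mp hy
  refine Submodule.add_mem _ (Et_mem_eisSpan l i) ?_
  rw [dPt]
  split_ifs
  · simpa using Pt_mem_eisSpan l 0 j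
  · exact Submodule.zero_mem _

lemma act_mem_cuspPoints {l : ℕ} (M : Matrix (Fin 2) (Fin 2) ℤ) {x : Tor × Tor}
    (hx : x.1 ∈ cuspPoints l ∧ x.2 ∈ cuspPoints l) :
    (act M x).1 ∈ cuspPoints l ∧ (act M x).2 ∈ cuspPoints l :=
  ⟨AddSubgroup.add_mem _ (AddSubgroup.zsmul_mem _ hx.1 _) (AddSubgroup.zsmul_mem _ hx.2 _),
    AddSubgroup.add_mem _ (AddSubgroup.zsmul_mem _ hx.1 _) (AddSubgroup.zsmul_mem _ hx.2 _)⟩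

/-- The unimodular factor of M only moves the points inside `cuspPoints l`, and the triangular
factor acts by a scalar. -/
lemma push_corr_mem {l : ℕ} [NeZero l] {M : Matrix (Fin 2) (Fin 2) ℤ} (hM : M.det ≠ 0)
    {x : Tor × Tor} (hx : x.1 ∈ cuspPoints l ∧ x.2 ∈ cuspPoints l) :
    push (act M) corr x ∈ eisSpan l := by
  obtain ⟨N, N', p, q, r, hN, hp, hr, rfl⟩ := exists_lower_triangular hM
  rw [det_mul] at hM
  rw [push_act_mul (left_ne_zero_of_mul hM) (right_ne_zero_of_mul hM),
    push_act_of_mul_eq_one hN, push_corr_lower hp hr]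
  exact Submodule.smul_mem _ _ (corr_mem_eisSpan (act_mem_cuspPoints N' hx).1
    (act_mem_cuspPoints N' hx).2)

lemma push_corr_comp_mem {l : ℕ} [NeZero l] {M R R' : Matrix (Fin 2) (Fin 2) ℤ} (hM : M.det ≠ 0)
    (hR : R * R' = 1) {x : Tor × Tor} (hx : x.1 ∈ cuspPoints l ∧ x.2 ∈ cuspPoints l) :
    push (act M) (fun z => corr (act R' z)) x ∈ eisSpan l := by
  have h : (fun z => corr (act R' z)) = push (act R) corr := by
    funext z; rw [push_act_of_mul_eq_one hR]
  have hd : R.det ≠ 0 := by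
    intro h0
    have := congrArg det hR
    rw [det_mul, h0] at this
    simp at this
  rw [h, ← push_act_mul hM hd]
  exact push_corr_mem (by rw [det_mul]; exact mul_ne_zero hM hd) hx

/-- The matrix that rotates the columns `u, v, w` with `u + v + w = 0`. -/
def rot : Matrix (Fin 2) (Fin 2) ℤ := !![0, -1; 1, -1]

lemma det_rot : rot.det = 1 := by simp [rot, det_fin_two]

lemma adjugate_rot : rot.adjugateᵀ = !![-1, -1; 1, 0] := by
  rw [rot, adjugate_fin_two]
  ext i j; fin_cases i <;> fin_cases j <;> simp

lemma adjugate_rot_sq : (rot * rot).adjugateᵀ = !![0, 1; -1, -1] := by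
  rw [rot, adjugate_fin_two]
  ext i j; fin_cases i <;> fin_cases j <;> simp

/-- If u, v are the columns of M and u + v + w = 0, the three matrices have columns (u, v), (v, w),
(w, u). Before pushing forward by M, the sum is the left side of `St_three_term` up to sign, so only
corrections remain. -/
lemma pairForm_rot_sum {l : ℕ} [NeZero l] {M : Matrix (Fin 2) (Fin 2) ℤ} (hM : M.det ≠ 0)
    {x : Tor × Tor} (hx : x.1 ∈ cuspPoints l ∧ x.2 ∈ cuspPoints l) :
    pairForm M x + pairForm (M * rot) x + pairForm (M * (rot * rot)) x ∈ eisSpan l := by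
  have hM' := hM
  rw [← det_transpose_adjugate] at hM'
  have hff := finiteFibers_act hM'
  have e0 : pairForm M x = (M.det : ℂ)⁻¹ • push (act M.adjugateᵀ) (fun z => (-1 : ℂ) • SS z) x := by
    rw [push_smul hff, smul_smul, pairForm]; congr 1; ring
  have e1 : pairForm rot = fun z => (-1 : ℂ) • (St z.2 * St (-z.1 - z.2)) := by
    funext z
    rw [pairForm, adjugate_rot, det_rot, push_act_of_mul_eq_one (N := !![0, 1; -1, -1])]
    · simp [SS, act_apply, sub_eq_add_neg]
    · ext i j; fin_cases i <;> fin_cases j <;> simp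
  have e2 : pairForm (rot * rot) = fun z => (-1 : ℂ) • (St (-z.1 - z.2) * St z.1) := by
    funext z
    rw [pairForm, adjugate_rot_sq, det_mul, det_rot,
      push_act_of_mul_eq_one (N := !![-1, -1; 1, 0])]
    · simp [SS, act_apply, sub_eq_add_neg]
    · ext i j; fin_cases i <;> fin_cases j <;> simp
  rw [e0, pairForm_mul hM (by rw [det_rot]; exact one_ne_zero), pairForm_mul hM (by
    rw [det_mul, det_rot]; norm_num), e1, e2, ← smul_add, ← smul_add, ← push_add hff,
    ← push_add hff]
  refine Submodule.smul_mem _ _ ?_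
  have key : (fun z : Tor × Tor => (-1 : ℂ) • SS z + (-1 : ℂ) • (St z.2 * St (-z.1 - z.2)) +
      (-1 : ℂ) • (St (-z.1 - z.2) * St z.1)) = fun z => (-1 : ℂ) • (corr z +
        corr (act !![0, 1; -1, -1] z) + corr (act !![-1, -1; 1, 0] z)) := by
    funext z
    have := St_three_term (x := z.1) (y := z.2) (z := -z.1 - z.2) (by abel)
    rw [← smul_add, ← smul_add, SS, this]
    simp [corr, act_apply, sub_eq_add_neg]
  rw [key, push_smul hff, push_add hff, push_add hff]
  refine Submodule.smul_mem _ _ (Submodule.add_mem _ (Submodule.add_mem _ (push_corr_mem hM' hx)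
    (push_corr_comp_mem hM' (R := !![-1, -1; 1, 0]) ?_ hx))
    (push_corr_comp_mem hM' (R := !![0, 1; -1, -1]) ?_ hx))
  · ext i j; fin_cases i <;> fin_cases j <;> simp
  · ext i j; fin_cases i <;> fin_cases j <;> simp

end ToricHecke

/-! ### From pairs of cusps to modular symbols, and generation by Manin symbols. -/

namespace ToricHecke

open Matrix Matrix.SpecialLinearGroup CongruenceSubgroup UpperHalfPlane

/-! ### Integral vectors representing points of the projective line -/

/-- A primitive integral vector that represents a point of the projective line. -/
def rep : P1 → Fin 2 → ℤ
  | none => ![1, 0]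
  | some q => ![q.num, q.den]

lemma rep_infty : rep (OnePoint.infty : P1) = ![1, 0] := rfl

lemma rep_coe (q : ℚ) : rep (q : P1) = ![q.num, q.den] := rfl

/-- The point of the projective line given by a vector. -/
def ratPoint (m n : ℚ) : P1 := if n = 0 then OnePoint.infty else ((m / n : ℚ) : P1)

lemma exists_eq_smul_rep (m n : ℤ) (h : m ≠ 0 ∨ n ≠ 0) :
    ∃ c : ℤ, c ≠ 0 ∧ m = rep (ratPoint m n) 0 * c ∧ n = rep (ratPoint m n) 1 * c := by
  rw [ratPoint]
  split_ifs with hn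
  · have hn : n = 0 := by exact_mod_cast hn
    subst hn
    exact ⟨m, by simpa using h, by simp [rep_infty], by simp [rep_infty]⟩
  · have hn : n ≠ 0 := by exact_mod_cast hn
    obtain ⟨c, h1, h2⟩ := Rat.exists_eq_mul_div_num_and_eq_mul_div_den m hn
    refine ⟨c, ?_, ?_, ?_⟩
    · rintro rfl
      exact hn (by rw [h2, zero_mul])
    · rw [rep_coe, mul_comm]; exact h1
    · rw [rep_coe, mul_comm]; exact h2

lemma rep_ne_zero (P : P1) : rep P 0 ≠ 0 ∨ rep P 1 ≠ 0 := by
  induction P using OnePoint.rec with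
  | infty => left; simp [rep_infty]
  | coe q => right; simp [rep_coe]

lemma smul_eq_ratPoint (g : GL (Fin 2) ℚ) (P : P1) :
    g • P = ratPoint (g 0 0 * rep P 0 + g 0 1 * rep P 1) (g 1 0 * rep P 0 + g 1 1 * rep P 1) := by
  induction P using OnePoint.rec with
  | infty =>
    rw [OnePoint.smul_infty_eq_ite, ratPoint]
    simp [rep_infty]
  | coe q =>
    have hd : (q.den : ℚ) ≠ 0 := by exact_mod_cast q.den_ne_zero
    have hq : (q.num : ℚ) = q * q.den := (Rat.mul_den_eq_num q).symm
    rw [OnePoint.smul_some_eq_ite, ratPoint]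
    simp only [rep_coe, cons_val_zero, cons_val_one, Int.cast_natCast, hq]
    have e : ∀ i, g i 0 * (q * q.den) + g i 1 * q.den = (g i 0 * q + g i 1) * q.den := fun i => by
      ring
    rw [e, e]
    simp only [mul_eq_zero, hd, or_false]
    split_ifs with h
    · rfl
    · rw [mul_div_mul_right _ _ hd]

/-- The matrix whose columns represent two points of the projective line. -/
def repMatrix (P Q : P1) : Matrix (Fin 2) (Fin 2) ℤ := !![rep P 0, rep Q 0; rep P 1, rep Q 1]

lemma exists_mul_rep {g : GL (Fin 2) ℚ} {h : Matrix (Fin 2) (Fin 2) ℤ}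
    (hg : ∀ i j, g i j = h i j) (P : P1) : ∃ c : ℤ, c ≠ 0 ∧ ∀ i,
      h i 0 * rep P 0 + h i 1 * rep P 1 = rep (g • P) i * c := by
  have h1 := smul_eq_ratPoint g P
  simp only [hg] at h1
  have hdet : (h.det : ℚ) ≠ 0 := by
    have h2 := g.det_ne_zero
    rw [det_fin_two, hg, hg, hg, hg] at h2
    rw [det_fin_two]; push_cast; exact h2
  have hdet : h.det ≠ 0 := by exact_mod_cast hdet
  obtain ⟨c, hc, e0, e1⟩ := exists_eq_smul_rep (h 0 0 * rep P 0 + h 0 1 * rep P 1)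
    (h 1 0 * rep P 0 + h 1 1 * rep P 1) (by
      by_contra! h0
      rw [det_fin_two] at hdet
      rcases rep_ne_zero P with h' | h'
      · apply mul_ne_zero hdet h'
        linear_combination h 1 1 * h0.1 - h 0 1 * h0.2
      · apply mul_ne_zero hdet h'
        linear_combination h 0 0 * h0.2 - h 1 0 * h0.1)
  push_cast at e0 e1
  rw [← h1] at e0 e1
  refine ⟨c, hc, fun i => ?_⟩
  fin_cases i
  · exact e0
  · exact e1

lemma exists_mul_repMatrix {g : GL (Fin 2) ℚ} {h : Matrix (Fin 2) (Fin 2) ℤ}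
    (hg : ∀ i j, g i j = h i j) (P Q : P1) : ∃ m n : ℤ, m ≠ 0 ∧ n ≠ 0 ∧
      h * repMatrix P Q = repMatrix (g • P) (g • Q) * !![m, 0; 0, n] := by
  obtain ⟨m, hm, h1⟩ := exists_mul_rep hg P
  obtain ⟨n, hn, h2⟩ := exists_mul_rep hg Q
  refine ⟨m, n, hm, hn, ?_⟩
  ext i j
  fin_cases j <;>
    simp only [repMatrix, Matrix.mul_apply, Fin.sum_univ_two] <;>
    fin_cases i <;> simp [h1, h2]

lemma repMatrix_det_eq_zero {P Q : P1} (h : (repMatrix P Q).det = 0) : P = Q := by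
  rw [repMatrix, det_fin_two_of] at h
  induction P using OnePoint.rec with
  | infty => induction Q using OnePoint.rec with
    | infty => rfl
    | coe q => simp [rep_coe, rep_infty] at h
  | coe p => induction Q using OnePoint.rec with
    | infty => simp [rep_coe, rep_infty] at h
    | coe q =>
      simp only [rep_coe, cons_val_zero, cons_val_one] at h
      rw [OnePoint.coe_eq_coe, Rat.eq_iff_mul_eq_mul]
      linarith

lemma repMatrix_det_self (P : P1) : (repMatrix P P).det = 0 := by
  rw [repMatrix, det_fin_two_of]; ring

lemma repMatrix_swap (P Q : P1) : repMatrix Q P = repMatrix P Q * !![0, 1; 1, 0] := by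
  ext i j; fin_cases i <;> fin_cases j <;> simp [repMatrix]

/-- The base point of the definition of the map on modular symbols. -/
def basePt (l : ℕ) : Tor × Tor := (0, tor 0 (1 / l))

lemma basePt_mem (l : ℕ) : (basePt l).1 ∈ cuspPoints l ∧ (basePt l).2 ∈ cuspPoints l :=
  ⟨AddSubgroup.zero_mem _, AddSubgroup.mem_zmultiples _⟩

lemma pairForm_repMatrix_smul {g : GL (Fin 2) ℚ} {h : Matrix (Fin 2) (Fin 2) ℤ}
    (hg : ∀ i j, g i j = h i j) (P Q : P1) (x : Tor × Tor) :
    pairForm (repMatrix (g • P) (g • Q)) x = pairForm (h * repMatrix P Q) x := by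
  obtain ⟨m, n, hm, hn, e⟩ := exists_mul_repMatrix hg P Q
  rw [e, pairForm_mul_diagonal _ hm hn]

/-- Three plane vectors satisfy det(v, w)u + det(w, u)v + det(u, v)w = 0, and rescaling the columns
by these determinants reduces to `pairForm_rot_sum`. If one determinant vanishes, two cusps coincide
and antisymmetry suffices. -/
lemma pairForm_repMatrix_add {l : ℕ} [NeZero l] {x : Tor × Tor}
    (hx : x.1 ∈ cuspPoints l ∧ x.2 ∈ cuspPoints l) (P Q R : P1) :
    pairForm (repMatrix P Q) x + pairForm (repMatrix Q R) x - pairForm (repMatrix P R) x ∈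
      eisSpan l := by
  have hself : ∀ P, pairForm (repMatrix P P) x = 0 := fun P =>
    pairForm_of_det_eq_zero (repMatrix_det_self P) x
  have hswap : ∀ P Q, pairForm (repMatrix Q P) x = -pairForm (repMatrix P Q) x := fun P Q => by
    rw [repMatrix_swap, pairForm_mul_swap]
  by_cases h1 : (repMatrix P Q).det = 0
  · rw [repMatrix_det_eq_zero h1, hself, zero_add, sub_self]; exact Submodule.zero_mem _
  by_cases h2 : (repMatrix Q R).det = 0
  · rw [repMatrix_det_eq_zero h2, hself, add_zero, sub_self]; exact Submodule.zero_mem _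
  by_cases h3 : (repMatrix R P).det = 0
  · rw [repMatrix_det_eq_zero h3, hself, hswap, neg_add_cancel, sub_self]
    exact Submodule.zero_mem _
  set c := (repMatrix P Q).det with hc
  set a := (repMatrix Q R).det with ha
  set b := (repMatrix R P).det with hb
  rw [repMatrix, det_fin_two_of] at hc ha hb
  have hM : (repMatrix P Q * !![a, 0; 0, b]).det ≠ 0 := by
    rw [det_mul]
    exact mul_ne_zero h1 (by simp [det_fin_two]; exact ⟨h2, h3⟩)
  have e1 : repMatrix P Q * !![a, 0; 0, b] * rot = repMatrix Q R * !![b, 0; 0, c] := by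
    ext i j
    fin_cases i <;> fin_cases j <;> simp [repMatrix, rot, Matrix.mul_apply, Fin.sum_univ_two] <;>
      rw [ha, hb, hc] <;> ring
  have e2 : repMatrix P Q * !![a, 0; 0, b] * (rot * rot) = repMatrix R P * !![c, 0; 0, a] := by
    rw [← mul_assoc, e1]
    ext i j
    fin_cases i <;> fin_cases j <;> simp [repMatrix, rot, Matrix.mul_apply, Fin.sum_univ_two] <;>
      rw [ha, hb, hc] <;> ring
  have := pairForm_rot_sum hM hx
  rwa [e1, e2, pairForm_mul_diagonal _ h2 h3, pairForm_mul_diagonal _ h3 h1,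
    pairForm_mul_diagonal _ h1 h2, hswap P R, ← sub_eq_add_neg] at this

lemma adjugate_transpose_mul (g : SL(2, ℤ)) :
    (g : Matrix (Fin 2) (Fin 2) ℤ).adjugateᵀ * (g : Matrix (Fin 2) (Fin 2) ℤ)ᵀ = 1 := by
  rw [← transpose_mul, mul_adjugate, g.det_coe, one_smul, transpose_one]

lemma pairForm_SL_mul (g : SL(2, ℤ)) (M : Matrix (Fin 2) (Fin 2) ℤ) (x : Tor × Tor) :
    pairForm ((g : Matrix (Fin 2) (Fin 2) ℤ) * M) x =
      pairForm M (act (g : Matrix (Fin 2) (Fin 2) ℤ)ᵀ x) := by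
  by_cases hM : M.det = 0
  · rw [pairForm_of_det_eq_zero hM, pairForm_of_det_eq_zero]
    rw [det_mul, hM, mul_zero]
  rw [pairForm_mul (by rw [g.det_coe]; exact one_ne_zero) hM, g.det_coe,
    push_act_of_mul_eq_one (adjugate_transpose_mul g)]
  simp

lemma mapGL_apply_int (g : SL(2, ℤ)) (i j : Fin 2) :
    (mapGL ℚ g : GL (Fin 2) ℚ) i j = ((g : Matrix (Fin 2) (Fin 2) ℤ) i j : ℤ) := by
  simp [mapGL]

lemma tor_intCast_div {l : ℕ} [NeZero l] {a b : ℤ} (h : (a : ZMod l) = b) :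
    tor 0 (a / l) = tor 0 (b / l) := by
  have hl : (l : ℝ) ≠ 0 := by exact_mod_cast NeZero.ne l
  rw [← sub_eq_zero, ← Int.cast_sub, ZMod.intCast_zmod_eq_zero_iff_dvd] at h
  obtain ⟨k, hk⟩ := h
  have hk' : (a : ℝ) - b = l * k := by exact_mod_cast hk
  rw [tor_eq_iff]
  refine ⟨⟨0, by simp⟩, -k, ?_⟩
  rw [show (a : ℝ) = b + l * k by linarith]
  push_cast
  field_simp
  ring

lemma act_basePt (l : ℕ) (M : Matrix (Fin 2) (Fin 2) ℤ) :
    act M (basePt l) = (tor 0 (M 0 1 / l), tor 0 (M 1 1 / l)) := by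
  simp [act_apply, basePt, tor_zsmul, div_eq_mul_inv]

/-- The transpose of a matrix moves the base point to its bottom row divided by l, and for Γ₁(l)
this row is (0, 1) modulo l. The level enters the construction here. -/
lemma act_basePt_of_mem {l : ℕ} [NeZero l] {γ : SL(2, ℤ)} (hγ : γ ∈ Gamma1 l) :
    act (γ : Matrix (Fin 2) (Fin 2) ℤ)ᵀ (basePt l) = basePt l := by
  rw [Gamma1_mem] at hγ
  rw [act_basePt, basePt, transpose_apply, transpose_apply,
    tor_intCast_div (a := γ 1 0) (b := 0) (by simpa using hγ.2.2),
    tor_intCast_div (a := γ 1 1) (b := 1) (by simpa using hγ.2.1)]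
  simp [tor]

/-- The class modulo Eisenstein series of the function attached to a pair of cusps. -/
def cuspForm (l : ℕ) (P Q : P1) : (ℍ → ℂ) ⧸ eisSpan l :=
  (eisSpan l).mkQ (pairForm (repMatrix P Q) (basePt l))

/-- The map on modular symbols, with values in the functions modulo Eisenstein series. -/
def symbolMap (l : ℕ) [NeZero l] : ModSym l →ₗ[ℂ] (ℍ → ℂ) ⧸ eisSpan l :=
  liftSymb l (cuspForm l)
    (fun P Q R => by
      rw [← sub_eq_zero, cuspForm, cuspForm, cuspForm, ← map_add, ← map_sub,
        Submodule.mkQ_apply, Submodule.Quotient.mk_eq_zero]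
      exact pairForm_repMatrix_add (basePt_mem l) P Q R)
    (fun γ hγ P Q => by
      rw [cuspForm, cuspForm, pairForm_repMatrix_smul (mapGL_apply_int γ), pairForm_SL_mul,
        act_basePt_of_mem hγ])

lemma symbolMap_symb (l : ℕ) [NeZero l] (P Q : P1) :
    symbolMap l (symb l P Q) = (eisSpan l).mkQ (pairForm (repMatrix P Q) (basePt l)) :=
  liftSymb_symb ..

lemma pairForm_zero_infty (x : Tor × Tor) :
    pairForm (repMatrix ((0 : ℚ) : P1) OnePoint.infty) x = SS x := by
  have e : repMatrix ((0 : ℚ) : P1) OnePoint.infty = 1 * !![0, 1; 1, 0] := by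
    ext i j; fin_cases i <;> fin_cases j <;> simp [repMatrix, rep_coe, rep_infty]
  rw [e, pairForm_mul_swap, pairForm, adjugate_one, transpose_one,
    push_act_of_mul_eq_one (N := 1) (mul_one 1), act_one]
  simp

lemma symbolMap_maninSymbol {l : ℕ} [NeZero l] {a b : ℤ} (g : SL(2, ℤ))
    (ha : (g 1 0 : ZMod l) = a) (hb : (g 1 1 : ZMod l) = b) :
    symbolMap l (maninSymbol l a b) =
      (eisSpan l).mkQ (St (tor 0 (a / l)) * St (tor 0 (b / l))) := by
  rw [maninSymbol_eq l a b g ha hb, symbolMap_symb, pairForm_repMatrix_smul (mapGL_apply_int g),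
    pairForm_SL_mul, pairForm_zero_infty, act_basePt, SS, transpose_apply, transpose_apply,
    tor_intCast_div ha, tor_intCast_div hb]

/-! ### Manin symbols -/

/-- Replace a by a non-zero a' in its class. Then b is a unit modulo G = gcd(l, a'); lift it to a
unit modulo a' and adjust b by a multiple of l to agree with the lift. The new row is coprime. -/
lemma exists_SL_bottom_row {l : ℕ} [NeZero l] {a b : ℤ} (h : Int.gcd (Int.gcd a b) l = 1) :
    ∃ g : SL(2, ℤ), (g 1 0 : ZMod l) = a ∧ (g 1 1 : ZMod l) = b := by
  obtain ⟨a', ha0, haa⟩ : ∃ a' : ℤ, a' ≠ 0 ∧ (a' : ZMod l) = a := by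
    by_cases ha : a = 0
    · exact ⟨l, by exact_mod_cast NeZero.ne l, by simp [ha]⟩
    · exact ⟨a, ha, rfl⟩
  have hcop : IsCoprime b (Int.gcd l a' : ℤ) := by
    rw [← Int.isCoprime_iff_gcd_eq_one] at h
    obtain ⟨x, y, hxy⟩ := h
    have hg := Int.gcd_eq_gcd_ab a b
    have h1 : (Int.gcd l a' : ℤ) ∣ l := Int.gcd_dvd_left ..
    have h2 : (Int.gcd l a' : ℤ) ∣ a' := Int.gcd_dvd_right ..
    have h3 : (l : ℤ) ∣ a' - a := by
      rw [← ZMod.intCast_zmod_eq_zero_iff_dvd]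
      push_cast; rw [haa, sub_self]
    have h4 : (Int.gcd l a' : ℤ) ∣ a := by
      have := dvd_sub h2 (h1.trans h3)
      simpa using this
    obtain ⟨c, hc⟩ := h4
    obtain ⟨d, hd⟩ := h1
    refine ⟨x * Int.gcdB a b, x * Int.gcdA a b * c + y * d, ?_⟩
    rw [hg] at hxy
    linear_combination hxy - x * Int.gcdA a b * hc - y * hd
  have hna : NeZero a'.natAbs := ⟨by simpa using ha0⟩
  set G := Int.gcd l a' with hG
  have hdvd : G ∣ a'.natAbs := by
    rw [← Int.natCast_dvd]; exact Int.gcd_dvd_right ..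
  have hGpos : NeZero G := ⟨fun h0 => by
    rw [Int.gcd_eq_zero_iff] at h0; exact ha0 h0.2⟩
  obtain ⟨u, hu⟩ := ZMod.unitsMap_surjective hdvd
    (ZMod.unitOfIsCoprime b hcop)
  obtain ⟨v, hv⟩ := ZMod.intCast_surjective (u : ZMod a'.natAbs)
  have hu' := congrArg Units.val hu
  rw [ZMod.unitsMap_def, Units.coe_map, MonoidHom.coe_coe, ← hv, map_intCast,
    ZMod.coe_unitOfIsCoprime] at hu'
  have hGv : (G : ℤ) ∣ v - b := by
    rw [← ZMod.intCast_zmod_eq_zero_iff_dvd]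
    push_cast; rw [hu', sub_self]
  obtain ⟨k, hk⟩ := hGv
  have hbez := Int.gcd_eq_gcd_ab l a'
  rw [← hG] at hbez
  set b' := b + l * (Int.gcdA l a' * k)
  have hb'v : (b' : ZMod a'.natAbs) = v := by
    rw [← sub_eq_zero, ← Int.cast_sub, ZMod.intCast_zmod_eq_zero_iff_dvd, Int.natAbs_dvd]
    exact ⟨-(Int.gcdB l a' * k), by linear_combination -hk - k * hbez⟩
  have hcop2 : IsCoprime a' b' := by
    have hun : IsUnit (b' : ZMod a'.natAbs) := by rw [hb'v, hv]; exact u.isUnit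
    obtain ⟨w, hw⟩ := hun.exists_right_inv
    obtain ⟨w, rfl⟩ := ZMod.intCast_surjective w
    rw [← sub_eq_zero, ← Int.cast_mul, ← Int.cast_one, ← Int.cast_sub,
      ZMod.intCast_zmod_eq_zero_iff_dvd, Int.natAbs_dvd] at hw
    obtain ⟨k, hk⟩ := hw
    exact ⟨-k, w, by linear_combination hk⟩
  obtain ⟨g, hg0, hg1⟩ := hcop2.exists_SL2_row 1
  refine ⟨g, ?_, ?_⟩
  · rw [hg0, haa]
  · rw [hg1]; simp [b']

lemma gcd_bottom_row {l : ℕ} {a b : ℤ} (g : SL(2, ℤ)) (ha : (g 1 0 : ZMod l) = a)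
    (hb : (g 1 1 : ZMod l) = b) : Int.gcd (Int.gcd a b) l = 1 := by
  obtain ⟨x, y, hxy⟩ := isCoprime_row g 1
  rw [← sub_eq_zero, ← Int.cast_sub, ZMod.intCast_zmod_eq_zero_iff_dvd] at ha hb
  obtain ⟨i, hi⟩ := ha
  obtain ⟨j, hj⟩ := hb
  obtain ⟨c, hc⟩ : (Int.gcd a b : ℤ) ∣ a := Int.gcd_dvd_left ..
  obtain ⟨d, hd⟩ : (Int.gcd a b : ℤ) ∣ b := Int.gcd_dvd_right ..
  rw [← Int.isCoprime_iff_gcd_eq_one]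
  refine ⟨x * c + y * d, x * i + y * j, ?_⟩
  linear_combination hxy - x * hi - y * hj - x * hc - y * hd

lemma smul_zero_eq (g : SL(2, ℤ)) :
    mapGL ℚ g • ((0 : ℚ) : P1) = ratPoint (g 0 1) (g 1 1) := by
  rw [smul_eq_ratPoint]
  simp [rep_coe]

lemma smul_infty_eq (g : SL(2, ℤ)) :
    mapGL ℚ g • (OnePoint.infty : P1) = ratPoint (g 0 0) (g 1 0) := by
  rw [smul_eq_ratPoint]
  simp [rep_infty]

/-- The span of the Manin symbols. -/
def maninSpan (l : ℕ) : Submodule ℂ (ModSym l) :=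
  Submodule.span ℂ {x | ∃ a b : ℤ, Int.gcd (Int.gcd a b) l = 1 ∧ x = maninSymbol l a b}

lemma symb_smul_mem_maninSpan (l : ℕ) (g : SL(2, ℤ)) :
    symb l (ratPoint (g 0 1) (g 1 1)) (ratPoint (g 0 0) (g 1 0)) ∈ maninSpan l := by
  rw [← smul_zero_eq, ← smul_infty_eq, ← maninSymbol_eq l (g 1 0) (g 1 1) g rfl rfl]
  exact Submodule.subset_span ⟨_, _, gcd_bottom_row g rfl rfl, rfl⟩

lemma symb_self (l : ℕ) (P : P1) : symb l P P = 0 := by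
  have := symb_add l P P P
  simpa using this

/-- Manin's continued fraction argument. Complete (num, den) to a unimodular matrix whose other
column has lower entry in [0, den); the symbol between the two columns is a Manin symbol, and the
other column has smaller denominator or is ∞. -/
lemma symb_infty_mem_maninSpan (l : ℕ) (n : ℕ) : ∀ q : ℚ, q.den = n →
    symb l OnePoint.infty (q : P1) ∈ maninSpan l := by
  induction n using Nat.strong_induction_on with
  | _ n ih =>
    intro q hq
    have hn : 0 < (q.den : ℤ) := by exact_mod_cast q.den_pos
    obtain ⟨x, y, hxy⟩ : IsCoprime q.num (q.den : ℤ) := by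
      rw [Int.isCoprime_iff_gcd_eq_one]; exact q.reduced
    set n' := x % (q.den : ℤ) with hn'
    set m' := -(q.num * (x / (q.den : ℤ)) + y) with hm'
    have hx := Int.emod_add_mul_ediv x (q.den : ℤ)
    have h0 : 0 ≤ n' := Int.emod_nonneg _ hn.ne'
    have h1 : n' < q.den := Int.emod_lt_of_pos _ hn
    have hdet : q.num * n' - m' * q.den = 1 := by
      rw [← hn'] at hx
      rw [hm']; linear_combination hxy + q.num * hx
    let g : SL(2, ℤ) := ⟨!![q.num, m'; q.den, n'], by rw [det_fin_two_of]; exact hdet⟩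
    have hg := symb_smul_mem_maninSpan l g
    have e1 : ratPoint (g 0 0) (g 1 0) = (q : P1) := by
      simp [g, ratPoint, Rat.num_div_den]
    have e2 : symb l OnePoint.infty (ratPoint (g 0 1) (g 1 1)) ∈ maninSpan l := by
      simp only [g, ratPoint, of_apply, cons_val_zero,
        cons_val_one, cons_val', cons_val_fin_one]
      split_ifs with h
      · rw [symb_self]; exact Submodule.zero_mem _
      · refine ih _ ?_ _ rfl
        have h : n' ≠ 0 := by exact_mod_cast h
        have h2 := Rat.den_dvd m' n'
        rw [Rat.divInt_eq_div] at h2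
        have h3 := Int.le_of_dvd (by omega) h2
        rw [← hq]
        exact_mod_cast h3.trans_lt h1
    rw [e1] at hg
    rw [← symb_add l _ (ratPoint (g 0 1) (g 1 1))]
    exact Submodule.add_mem _ e2 hg

lemma symb_mem_maninSpan (l : ℕ) (P Q : P1) : symb l P Q ∈ maninSpan l := by
  have h : ∀ P : P1, symb l OnePoint.infty P ∈ maninSpan l := by
    intro P
    induction P using OnePoint.rec with
    | infty => rw [symb_self]; exact Submodule.zero_mem _
    | coe q => exact symb_infty_mem_maninSpan l _ q rfl
  rw [eq_sub_of_add_eq' (symb_add l OnePoint.infty P Q)]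
  exact Submodule.sub_mem _ (h Q) (h P)

lemma maninSpan_eq_top (l : ℕ) : maninSpan l = ⊤ := by
  rw [eq_top_iff]
  rintro x -
  obtain ⟨f, rfl⟩ := (symbolRelations l).mkQ_surjective x
  induction f using Finsupp.induction_linear with
  | zero => rw [map_zero]; exact Submodule.zero_mem _
  | add f g hf hg => rw [map_add]; exact Submodule.add_mem _ hf hg
  | single p c =>
    have : Finsupp.single p c = c • Finsupp.single (p.1, p.2) (1 : ℂ) := by simp
    rw [this, map_smul]
    exact Submodule.smul_mem _ _ (symb_mem_maninSpan l p.1 p.2)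

/-- Linear maps on modular symbols are determined by their values at the Manin symbols. -/
lemma ext_maninSymbol {l : ℕ} {V : Type*} [AddCommGroup V] [Module ℂ V] {f g : ModSym l →ₗ[ℂ] V}
    (h : ∀ a b : ℤ, Int.gcd (Int.gcd a b) l = 1 → f (maninSymbol l a b) = g (maninSymbol l a b)) :
    f = g := by
  refine LinearMap.ext_on (maninSpan_eq_top l) ?_
  rintro x ⟨a, b, hab, rfl⟩
  exact h a b hab

/-- The projection to the minus symbols. -/
def minusProj (l : ℕ) : ModSym l →ₗ[ℂ] minusSymbols l :=
  LinearMap.codRestrict _ ((1 / 2 : ℂ) • (LinearMap.id - iota l)) (fun x => by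
    have hii : iota l ∘ₗ iota l = LinearMap.id := ext_maninSymbol fun a b _ => by
      rw [LinearMap.comp_apply, iota_maninSymbol, iota_maninSymbol, neg_neg, LinearMap.id_apply]
    have hx : iota l (iota l x) = x := LinearMap.congr_fun hii x
    change iota l ((1 / 2 : ℂ) • (x - iota l x)) = -((1 / 2 : ℂ) • (x - iota l x))
    rw [map_smul, map_sub, hx, ← smul_neg, neg_sub])

lemma minusProj_maninSymbol (l : ℕ) (a b : ℤ) :
    minusProj l (maninSymbol l a b) = maninMinus l a b := by
  apply Subtype.ext
  change (1 / 2 : ℂ) • (maninSymbol l a b - iota l (maninSymbol l a b)) = _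
  rw [iota_maninSymbol]
  rfl

lemma minusProj_coe (l : ℕ) (x : minusSymbols l) : minusProj l x = x := by
  apply Subtype.ext
  change (1 / 2 : ℂ) • ((x : ModSym l) - iota l x) = x
  have hx : iota l (x : ModSym l) = -x := x.2
  rw [hx, sub_neg_eq_add, ← two_smul ℂ (x : ModSym l), smul_smul]
  norm_num

/-- Linear maps on minus symbols are determined by their values at the symbols `(a, b)₋`. -/
lemma ext_maninMinus {l : ℕ} {V : Type*} [AddCommGroup V] [Module ℂ V]
    {f g : minusSymbols l →ₗ[ℂ] V}
    (h : ∀ a b : ℤ, Int.gcd (Int.gcd a b) l = 1 → f (maninMinus l a b) = g (maninMinus l a b)) :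
    f = g := by
  have : f ∘ₗ minusProj l = g ∘ₗ minusProj l := ext_maninSymbol fun a b hab => by
    simp only [LinearMap.comp_apply, minusProj_maninSymbol, h a b hab]
  ext x
  have := LinearMap.congr_fun this x
  simpa only [LinearMap.comp_apply, minusProj_coe] using this

end ToricHecke

/-! ### `J` as a logarithmic derivative of theta, and the inversion formulas. -/

namespace ToricHecke

open Complex Filter Topology

/-! ### The theta function -/

/-- The theta function divided by its leading factor. -/
def thT (τ z : ℂ) : ℂ := jacobiTheta₂ (z + τ / 2 + 1 / 2) τ

/-- The derivative of `thT`. -/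
def thT' (τ z : ℂ) : ℂ := jacobiTheta₂' (z + τ / 2 + 1 / 2) τ

lemma hasDerivAt_thT {τ : ℂ} (hτ : 0 < τ.im) (z : ℂ) : HasDerivAt (thT τ) (thT' τ z) z := by
  have h := hasDerivAt_jacobiTheta₂_fst (z + τ / 2 + 1 / 2) hτ
  have h2 : HasDerivAt (fun z : ℂ => z + τ / 2 + 1 / 2) 1 z :=
    ((hasDerivAt_id z).add_const _).add_const _
  have := HasDerivAt.comp z h h2
  rw [mul_one] at this
  exact this

lemma ee_half : ee (1 / 2) = -1 := by
  rw [ee, show 2 * (Real.pi : ℂ) * I * (1 / 2) = Real.pi * I by ring, Complex.exp_pi_mul_I]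

/-- The coefficients of `thT`. -/
def tc (τ : ℂ) (n : ℤ) : ℂ := (-1) ^ n * ee (τ / 2) ^ (n ^ 2 + n)

lemma jacobiTheta₂_term_eq (τ z : ℂ) (n : ℤ) :
    jacobiTheta₂_term n (z + τ / 2 + 1 / 2) τ = tc τ n * ee z ^ n := by
  rw [tc, ← ee_half, ← ee_int_mul, ← ee_int_mul, ← ee_int_mul, ← ee_add, ← ee_add,
    jacobiTheta₂_term, ee]
  congr 1
  push_cast
  ring

lemma hasSum_thT {τ : ℂ} (hτ : 0 < τ.im) (z : ℂ) :
    HasSum (fun n : ℤ => tc τ n * ee z ^ n) (thT τ z) :=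
  (hasSum_jacobiTheta₂_term _ hτ).congr_fun fun n => (jacobiTheta₂_term_eq τ z n).symm

lemma hasSum_thT' {τ : ℂ} (hτ : 0 < τ.im) (z : ℂ) :
    HasSum (fun n : ℤ => 2 * Real.pi * I * (n * (tc τ n * ee z ^ n))) (thT' τ z) :=
  (hasSum_jacobiTheta₂'_term _ hτ).congr_fun fun n => by
    rw [jacobiTheta₂'_term, jacobiTheta₂_term_eq]; ring

lemma theta_eq (z τ : ℂ) :
    theta z τ = -I * (Complex.exp (Real.pi * I * (τ / 4 + z)) * thT τ z) := by
  have h : Complex.exp (Real.pi * I * (τ / 4 + z)) * thT τ z = ∑' n : ℤ,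
      Complex.exp (Real.pi * I * (τ / 4 + z)) * jacobiTheta₂_term n (z + τ / 2 + 1 / 2) τ :=
    tsum_mul_left.symm
  rw [theta, h]
  congr 1
  refine tsum_congr fun n => ?_
  rw [jacobiTheta₂_term_eq, tc, ← ee_half, ← ee_int_mul, ← ee_int_mul, ← ee_int_mul]
  rw [ee, ee, ee, ← Complex.exp_add, ← Complex.exp_add, ← Complex.exp_add, ← Complex.exp_add,
    ← Complex.exp_add]
  congr 1
  push_cast
  ring

/-- The ratios of the coefficients of `thT`. -/
def tw (τ : ℂ) (n k : ℤ) : ℂ := (-1) ^ k * ee (τ / 2) ^ (k ^ 2 - (2 * n + 1) * k)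

lemma tc_sub (τ : ℂ) (n k : ℤ) : tc τ (n - k) = tc τ n * tw τ n k := by
  have h := ee_ne_zero (τ / 2)
  have h1 : (-1 : ℂ) ^ (n - k) = (-1) ^ n * (-1) ^ k := by
    rw [zpow_sub₀ (by norm_num), div_eq_mul_inv, ← inv_zpow]
    norm_num
  rw [tc, tc, tw, h1, mul_mul_mul_comm, ← zpow_add₀ h]
  congr 2
  ring

lemma tc_ne_zero (τ : ℂ) (n : ℤ) : tc τ n ≠ 0 :=
  mul_ne_zero (zpow_ne_zero _ (by norm_num)) (zpow_ne_zero _ (ee_ne_zero _))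

lemma tw_zero (τ : ℂ) (n : ℤ) : tw τ n 0 = 1 := by simp [tw]

lemma summable_tc {τ : ℂ} (hτ : 0 < τ.im) : Summable (tc τ) :=
  (hasSum_thT hτ 0).summable.congr fun n => by simp

lemma summable_tw {τ : ℂ} (hτ : 0 < τ.im) (n : ℤ) : Summable (tw τ n) := by
  have h := (summable_tc hτ).comp_injective (i := fun k => n - k) (sub_right_injective)
  refine (h.mul_left (tc τ n)⁻¹).congr fun k => ?_
  rw [Function.comp_apply, tc_sub, inv_mul_cancel_left₀ (tc_ne_zero τ n)]

lemma tw_sub (τ : ℂ) (n k : ℤ) : tw τ n (2 * n + 1 - k) = -tw τ n k := by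
  have h1 : (-1 : ℂ) ^ (2 * n + 1 - k) = -(-1) ^ k := by
    rw [zpow_sub₀ (by norm_num), zpow_add₀ (by norm_num), zpow_mul, div_eq_mul_inv, ← inv_zpow]
    norm_num
  rw [tw, tw, h1, neg_mul]
  congr 3
  ring

lemma tw_neg (τ : ℂ) (n k : ℤ) : tw τ n (-k) = tw τ (-n - 1) k := by
  have h1 : (-1 : ℂ) ^ (-k) = (-1) ^ k := by
    rw [zpow_neg, ← inv_zpow]; norm_num
  rw [tw, tw, h1]
  congr 2
  ring

lemma tw_succ (τ : ℂ) (n k : ℤ) : tw τ n k = ee τ ^ k * tw τ (n + 1) k := by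
  have h := ee_ne_zero (τ / 2)
  have h1 : ee τ = ee (τ / 2) ^ (2 : ℤ) := by
    rw [← ee_int_mul]; congr 1; push_cast; ring
  rw [tw, tw, h1, ← zpow_mul, mul_left_comm, ← zpow_add₀ h]
  congr 2
  ring

/-- The involution k ↦ 2n + 1 - k changes the sign of every term. -/
lemma tsum_tw (τ : ℂ) (n : ℤ) : ∑' k, tw τ n k = 0 := by
  have h := (Equiv.subLeft (2 * n + 1)).tsum_eq (tw τ n)
  simp only [Equiv.subLeft_apply, tw_sub, tsum_neg] at h
  linear_combination -h / 2

/-- The coefficients of the Laurent expansion of `1 - J`. -/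
def lc1 (q : ℂ) (k : ℤ) : ℂ := lc q k + if k = 0 then 1 else 0

lemma lc1_zero (q : ℂ) : lc1 q 0 = 1 := by simp [lc1, lc_zero]

lemma lc1_of_ne (q : ℂ) {k : ℤ} (hk : k ≠ 0) : lc1 q k = lc q k := by simp [lc1, hk]

lemma exists_lc1_bound {q : ℂ} (hq0 : q ≠ 0) (hq : ‖q‖ < 1) : ∃ C : ℝ, ∀ k, ‖lc1 q k‖ ≤ C := by
  have hpos : 0 < 1 - ‖q‖ := by linarith
  have h1 : ∀ k : ℤ, 0 < k → ‖lc q k‖ ≤ 1 / (1 - ‖q‖) := by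
    intro k hk
    lift k to ℕ using hk.le
    rw [lc, norm_div, norm_one]
    refine one_div_le_one_div_of_le hpos ?_
    have h2 : ‖(1 : ℂ)‖ - ‖q ^ (k : ℤ)‖ ≤ ‖1 - q ^ (k : ℤ)‖ := norm_sub_norm_le _ _
    rw [zpow_natCast, norm_pow, norm_one] at h2
    rw [zpow_natCast]
    have h3 : ‖q‖ ^ k ≤ ‖q‖ := pow_le_of_le_one (norm_nonneg _) hq.le (by
      intro h0; simp [h0] at hk)
    linarith
  have h4 : 0 ≤ 1 / (1 - ‖q‖) := by positivity
  refine ⟨1 + 1 / (1 - ‖q‖), fun k => ?_⟩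
  rcases lt_trichotomy k 0 with hk | rfl | hk
  · rw [lc1_of_ne q hk.ne]
    have := lc_neg hq0 hq (k := -k) (by omega)
    rw [neg_neg] at this
    rw [this]
    refine (norm_sub_le _ _).trans ?_
    rw [norm_one]
    linarith [h1 (-k) (by omega)]
  · rw [lc1_zero, norm_one]; linarith
  · rw [lc1_of_ne q hk.ne']
    linarith [h1 k hk]

lemma summable_lc1_tw {τ : ℂ} (hτ : 0 < τ.im) (n : ℤ) :
    Summable fun k => lc1 (ee τ) k * tw τ n k := by
  obtain ⟨C, hC⟩ := exists_lc1_bound (ee_ne_zero τ) (norm_ee_lt_one hτ)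
  refine Summable.of_norm_bounded ((summable_tw hτ n).norm.mul_left C) fun k => ?_
  rw [norm_mul]
  exact mul_le_mul_of_nonneg_right (hC k) (norm_nonneg _)

/-- Passing from n to n + 1 divides the k-th ratio by qᵏ, which cancels the denominator of `lc`.
What is left is `tsum_tw` without its term k = 0, hence -1. -/
lemma tsum_lc1_tw_succ {τ : ℂ} (hτ : 0 < τ.im) (n : ℤ) :
    ∑' k, lc1 (ee τ) k * tw τ (n + 1) k = ∑' k, lc1 (ee τ) k * tw τ n k - 1 := by
  have h : ∀ k, lc1 (ee τ) k * tw τ (n + 1) k - lc1 (ee τ) k * tw τ n k =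
      tw τ (n + 1) k - if k = 0 then 1 else 0 := by
    intro k
    rcases eq_or_ne k 0 with rfl | hk
    · simp [tw_zero]
    · rw [tw_succ τ n k, lc1_of_ne _ hk, lc, if_neg hk]
      have : 1 - ee τ ^ k ≠ 0 := sub_ne_zero.mpr (zpow_ne_one (norm_ee_lt_one hτ) hk).symm
      field_simp
      ring
  have h1 := (summable_lc1_tw hτ (n + 1)).tsum_sub (summable_lc1_tw hτ n)
  rw [tsum_congr h, (summable_tw hτ (n + 1)).tsum_sub (hasSum_ite_eq (0 : ℤ) (1 : ℂ)).summable,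
    tsum_tw, tsum_ite_eq] at h1
  linear_combination -h1

/-- The reflection k ↦ -k relates n = -1 to n = 0, and so does the recursion. Together they
determine the value. -/
lemma tsum_lc1_tw_zero {τ : ℂ} (hτ : 0 < τ.im) : ∑' k, lc1 (ee τ) k * tw τ 0 k = 0 := by
  have h1 := tsum_lc1_tw_succ hτ (-1)
  rw [show (-1 + 1 : ℤ) = 0 by norm_num] at h1
  have h2 : ∑' k, lc1 (ee τ) k * tw τ (-1) k = 1 - ∑' k, lc1 (ee τ) k * tw τ 0 k := by
    rw [← (Equiv.neg ℤ).tsum_eq]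
    have h3 : ∀ k : ℤ, lc1 (ee τ) (Equiv.neg ℤ k) * tw τ (-1) (Equiv.neg ℤ k) =
        tw τ 0 k - lc1 (ee τ) k * tw τ 0 k + if k = 0 then 1 else 0 := by
      intro k
      rw [Equiv.neg_apply, tw_neg]
      rcases eq_or_ne k 0 with rfl | hk
      · simp [tw_zero, lc1_zero]
      · rw [lc1_of_ne _ hk, lc1_of_ne _ (neg_ne_zero.mpr hk),
          lc_neg (ee_ne_zero τ) (norm_ee_lt_one hτ) hk, if_neg hk]
        norm_num
        ring
    rw [tsum_congr h3, ((summable_tw hτ 0).sub (summable_lc1_tw hτ 0)).tsum_add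
      (hasSum_ite_eq (0 : ℤ) (1 : ℂ)).summable, (summable_tw hτ 0).tsum_sub (summable_lc1_tw hτ 0),
      tsum_tw, tsum_ite_eq]
    ring
  linear_combination (h1 + h2) / 2

lemma tsum_lc1_tw {τ : ℂ} (hτ : 0 < τ.im) (n : ℤ) : ∑' k, lc1 (ee τ) k * tw τ n k = -n := by
  induction n using Int.induction_on with
  | zero => simpa using tsum_lc1_tw_zero hτ
  | succ n ih => rw [tsum_lc1_tw_succ hτ, ih]; push_cast; ring
  | pred n ih =>
    have := tsum_lc1_tw_succ hτ (-n - 1)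
    rw [sub_add_cancel, ih] at this
    push_cast at this ⊢
    linear_combination -this

lemma hasSum_lc1_tc {τ : ℂ} (hτ : 0 < τ.im) (X : ℂ) (hX : X ≠ 0) (n : ℤ) :
    HasSum (fun k => lc1 (ee τ) k * X ^ k * (tc τ (n - k) * X ^ (n - k))) (-n * (tc τ n * X ^ n)) := by
  have h := (summable_lc1_tw hτ n).hasSum
  rw [tsum_lc1_tw hτ] at h
  refine (h.mul_right (tc τ n * X ^ n)).congr_fun fun k => ?_
  rw [tc_sub, zpow_sub₀ hX]
  have := zpow_ne_zero k hX
  field_simp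

/-- Multiply the Laurent series of 1 - J and of theta: the n-th coefficient of the product is -n
times that of theta, which is termwise differentiation. -/
lemma thT'_strip {τ z : ℂ} (h1 : 0 < z.im) (h2 : z.im < τ.im) :
    thT' τ z = 2 * Real.pi * I * (J τ z - 1) * thT τ z := by
  have hτ := h1.trans h2
  have hpi : (2 * Real.pi * I : ℂ) ≠ 0 := by simp [Real.pi_ne_zero]
  have hX := ee_ne_zero z
  have hJ : HasSum (fun k : ℤ => lc1 (ee τ) k * ee z ^ k) (-J τ z + 1) := by
    refine ((hasSum_laurent_J h1 h2).add (hasSum_ite_eq (0 : ℤ) 1)).congr_fun fun k => ?_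
    rcases eq_or_ne k 0 with rfl | hk <;> simp [lc1, *]
  have hprod := hasSum_mul_prod hJ (hasSum_thT hτ z)
  have hprod' : HasSum (fun p : ℤ × ℤ => lc1 (ee τ) p.2 * ee z ^ p.2 *
      (tc τ (p.1 - p.2) * ee z ^ (p.1 - p.2))) ((-J τ z + 1) * thT τ z) :=
    sumEquivLeft.hasSum_iff.mpr hprod
  have h3 := hprod'.prod_fiberwise fun n => hasSum_lc1_tc hτ (ee z) hX n
  have h4 := ((hasSum_thT' hτ z).mul_left (-(2 * Real.pi * I)⁻¹)).congr_fun
    (g := fun n : ℤ => -(n : ℂ) * (tc τ n * ee z ^ n)) fun n => by field_simp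
  have := h3.unique h4
  field_simp at this
  linear_combination this

lemma thT'_eq {τ z : ℂ} (hτ : 0 < τ.im) (hz : z ∉ latt τ) :
    thT' τ z = 2 * Real.pi * I * (J τ z - 1) * thT τ z := by
  have e : (latt τ ∪ {w | 0 + w ∈ latt τ})ᶜ = (latt τ)ᶜ := by simp
  have hpre := isPreconnected_compl_latt τ 0
  rw [e] at hpre
  have hopen := (isClosed_latt hτ).isOpen_compl
  set F : ℂ → ℂ := fun z => thT' τ z - 2 * Real.pi * I * (J τ z - 1) * thT τ z with hF
  have hd1 : Differentiable ℂ (thT τ) := fun z => (hasDerivAt_thT hτ z).differentiableAt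
  have hd2 : Differentiable ℂ (thT' τ) := by
    have : thT' τ = deriv (thT τ) := funext fun z => (hasDerivAt_thT hτ z).deriv.symm
    rw [this]
    exact hd1.deriv
  have hd : DifferentiableOn ℂ F (latt τ)ᶜ := fun z hz => by
    have h1 := differentiableAt_J hτ hz
    have h2 := hd1 z
    have h3 := hd2 z
    have : DifferentiableAt ℂ F z := by rw [hF]; fun_prop
    exact this.differentiableWithinAt
  set z₀ : ℂ := ((τ.im / 2 : ℝ) : ℂ) * I
  have hz₀1 : 0 < z₀.im := by simp [z₀]; linarith
  have hz₀2 : z₀.im < τ.im := by simp [z₀]; linarith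
  have hev : F =ᶠ[𝓝 z₀] 0 := by
    have ho : IsOpen {z : ℂ | 0 < z.im ∧ z.im < τ.im} :=
      (isOpen_lt continuous_const Complex.continuous_im).inter
        (isOpen_lt Complex.continuous_im continuous_const)
    filter_upwards [ho.mem_nhds ⟨hz₀1, hz₀2⟩] with z hz
    exact sub_eq_zero.mpr (thT'_strip hz.1 hz.2)
  have := (hd.analyticOnNhd hopen).eqOn_zero_of_preconnected_of_eventuallyEq_zero hpre
    (notMem_latt_of_strip hz₀1 hz₀2) hev hz
  exact sub_eq_zero.mp this

/-- The zeroth Fourier coefficient of the theta series over [0, 1] is 1. -/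
lemma exists_thT_ne_zero {τ : ℂ} (hτ : 0 < τ.im) : ∃ z, thT τ z ≠ 0 := by
  by_contra! h
  let f : ℤ → C(ℝ, ℂ) := fun n =>
    ⟨fun x => jacobiTheta₂_term n x τ, by unfold jacobiTheta₂_term; fun_prop⟩
  have hs : Summable fun n => ‖ContinuousMap.restrict
      ((⟨Set.uIcc (0 : ℝ) 1, isCompact_uIcc⟩ : TopologicalSpace.Compacts ℝ) : Set ℝ) (f n)‖ := by
    refine Summable.of_nonneg_of_le (fun n => norm_nonneg _) (fun n => ?_)
      ((summable_jacobiTheta₂_term_iff 0 τ).mpr hτ).norm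
    rw [ContinuousMap.norm_le _ (norm_nonneg _)]
    intro x
    simp only [ContinuousMap.restrict_apply, f, ContinuousMap.coe_mk, norm_jacobiTheta₂_term]
    simp
  have h1 := intervalIntegral.hasSum_intervalIntegral_of_summable_norm hs
  have h2 : ∀ x : ℝ, ∑' n, f n x = 0 := by
    intro x
    have := h (x - τ / 2 - 1 / 2)
    rw [thT, show (x : ℂ) - τ / 2 - 1 / 2 + τ / 2 + 1 / 2 = x by ring] at this
    exact this
  simp only [h2, intervalIntegral.integral_zero] at h1
  have h3 : ∀ n : ℤ, ∫ x in (0 : ℝ)..1, f n x = if n = 0 then 1 else 0 := by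
    intro n
    have e : ∀ x : ℝ, f n x = Complex.exp (Real.pi * I * n ^ 2 * τ) *
        Complex.exp (2 * Real.pi * I * n * x) := fun x => by
      simp only [f, ContinuousMap.coe_mk]
      rw [jacobiTheta₂_term, Complex.exp_add, mul_comm]
    simp only [e, intervalIntegral.integral_const_mul]
    split_ifs with hn
    · subst hn; simp
    · have hc : (2 * Real.pi * I * n : ℂ) ≠ 0 := by simp [Real.pi_ne_zero, hn]
      rw [integral_exp_mul_complex hc, ofReal_one, ofReal_zero, mul_one, mul_zero, Complex.exp_zero,
        show (2 * Real.pi * I * n : ℂ) = n * (2 * Real.pi * I) by ring,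
        Complex.exp_int_mul_two_pi_mul_I]
      simp
  simp only [h3] at h1
  exact one_ne_zero ((hasSum_ite_eq (0 : ℤ) (1 : ℂ)).unique h1)

/-- Off the lattice theta solves a first order linear equation with holomorphic coefficient. A zero
there would force it to vanish on a disc, hence identically. -/
lemma thT_ne_zero {τ z : ℂ} (hτ : 0 < τ.im) (hz : z ∉ latt τ) : thT τ z ≠ 0 := by
  intro h0
  obtain ⟨ε, hε, hball⟩ := Metric.isOpen_iff.mp (isClosed_latt hτ).isOpen_compl z hz
  have hd : DifferentiableOn ℂ (fun z => 2 * Real.pi * I * (J τ z - 1)) (Metric.ball z ε) :=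
    fun w hw => (((differentiableAt_J hτ (hball hw)).sub_const 1).const_mul
      _).differentiableWithinAt
  obtain ⟨H, hH⟩ := hd.isExactOn_ball
  have hder : ∀ w ∈ Metric.ball z ε,
      HasDerivAt (fun w => thT τ w * Complex.exp (-H w)) 0 w := by
    intro w hw
    have h1 := (hasDerivAt_thT hτ w).mul (hH w hw).neg.cexp
    refine h1.congr_deriv ?_
    rw [thT'_eq hτ (hball hw)]
    ring
  have hconst : ∀ w ∈ Metric.ball z ε, thT τ w = 0 := by
    intro w hw
    have h1 := Metric.isOpen_ball.is_const_of_deriv_eq_zero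
      (convex_ball z ε).isPreconnected
      (fun w hw => (hder w hw).differentiableAt.differentiableWithinAt)
      (fun w hw => (hder w hw).deriv) hw (Metric.mem_ball_self hε)
    simp only [h0, zero_mul] at h1
    exact (mul_eq_zero.mp h1).resolve_right (Complex.exp_ne_zero _)
  have hd1 : Differentiable ℂ (thT τ) := fun z => (hasDerivAt_thT hτ z).differentiableAt
  have hev : thT τ =ᶠ[𝓝 z] 0 := by
    filter_upwards [Metric.ball_mem_nhds z hε] with w hw using hconst w hw
  have := AnalyticOnNhd.eq_of_eventuallyEq (fun w _ => hd1.analyticAt w)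
    (fun w _ => analyticAt_const) hev
  obtain ⟨w, hw⟩ := exists_thT_ne_zero hτ
  exact hw (congrFun this w)

lemma logDeriv_theta {τ z : ℂ} (hτ : 0 < τ.im) (hz : z ∉ latt τ) :
    logDeriv (fun z => theta z τ) z = 2 * Real.pi * I * (J τ z - 1 / 2) := by
  have hT := thT_ne_zero hτ hz
  have h1 : HasDerivAt (fun z : ℂ => Complex.exp (Real.pi * I * (τ / 4 + z)))
      (Complex.exp (Real.pi * I * (τ / 4 + z)) * (Real.pi * I * 1)) z :=
    (((hasDerivAt_id z).const_add (τ / 4)).const_mul (Real.pi * I : ℂ)).cexp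
  have h2 : HasDerivAt (fun z => -I * (Complex.exp (Real.pi * I * (τ / 4 + z)) * thT τ z)) _ z :=
    (h1.mul (hasDerivAt_thT hτ z)).const_mul (-I)
  have e : (fun z => theta z τ) =
      fun z => -I * (Complex.exp (Real.pi * I * (τ / 4 + z)) * thT τ z) :=
    funext fun z => theta_eq z τ
  rw [logDeriv_apply, e, HasDerivAt.deriv h2, thT'_eq hτ hz, theta_eq]
  have := Complex.exp_ne_zero (Real.pi * I * (τ / 4 + z))
  have hI := Complex.I_ne_zero
  field_simp
  ring

lemma tor_div_eq_zero_iff {l : ℕ} [NeZero l] (a : ℤ) :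
    tor 0 (a / l) = 0 ↔ (l : ℤ) ∣ a := by
  have hl : (l : ℝ) ≠ 0 := by exact_mod_cast NeZero.ne l
  rw [← tor_zero, tor_eq_iff]
  constructor
  · rintro ⟨-, n, hn⟩
    refine ⟨-n, ?_⟩
    field_simp at hn
    have : (a : ℝ) = l * -n := by linarith
    exact_mod_cast this
  · rintro ⟨k, rfl⟩
    refine ⟨⟨0, by simp⟩, -k, ?_⟩
    push_cast
    field_simp
    ring

lemma s_eq (l : ℕ) [NeZero l] {a : ℤ} (ha : ¬ (l : ℤ) ∣ a) : s l a = St (tor 0 (a / l)) := by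
  ext τ
  have hz := mt (tor_div_eq_zero_iff a).mp ha
  rw [tor_eq_zero_iff τ] at hz
  have e : ((0 : ℝ) : ℂ) * τ + ((a / l : ℝ) : ℂ) = a / l := by push_cast; ring
  rw [e] at hz
  have hpi : (2 * Real.pi * I : ℂ) ≠ 0 := by simp [Real.pi_ne_zero]
  rw [s, logDeriv_theta τ.im_pos hz, inv_mul_cancel_left₀ hpi, St_tor, S, e]
  push_cast
  ring

/-! ### The transformation `τ ↦ -1 / τ` -/

lemma im_neg_inv_pos {τ : ℂ} (hτ : 0 < τ.im) : 0 < (-1 / τ).im := by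
  have h0 : τ ≠ 0 := by rintro rfl; simp at hτ
  rw [neg_div, one_div, neg_im, Complex.inv_im, neg_div, neg_neg]
  exact div_pos hτ (Complex.normSq_pos.mpr h0)

lemma div_mem_latt_iff {τ z : ℂ} (hτ : 0 < τ.im) : z / τ ∈ latt (-1 / τ) ↔ z ∈ latt τ := by
  have h0 : τ ≠ 0 := by rintro rfl; simp at hτ
  constructor
  · rintro ⟨c, d, h⟩
    refine ⟨d, -c, ?_⟩
    field_simp at h
    rw [h]; push_cast; ring
  · rintro ⟨c, d, h⟩
    refine ⟨-d, c, ?_⟩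
    rw [h]; push_cast; field_simp; ring

/-- Divide the functional equation of ∂θ by that of θ; the Gaussian factor contributes the terms
linear in z. -/
lemma J_neg_inv {τ z : ℂ} (hτ : 0 < τ.im) (hz : z ∉ latt τ) :
    J (-1 / τ) (z / τ) = τ * (J τ z - 1 / 2) + z + 1 / 2 := by
  have h0 : τ ≠ 0 := by rintro rfl; simp at hτ
  have hτ' := im_neg_inv_pos hτ
  have hpi : (2 * Real.pi * I : ℂ) ≠ 0 := by simp [Real.pi_ne_zero]
  set τ' := -1 / τ with hτ'def
  set u := z + τ / 2 + 1 / 2 with hu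
  have hz' : z / τ ∉ latt τ' := fun h => hz ((div_mem_latt_iff hτ).mp h)
  have hz'' : z / τ - τ' ∉ latt τ' := by
    rintro ⟨c, d, h⟩
    exact hz' ⟨c + 1, d, by push_cast; linear_combination h⟩
  -- The half-period shift in `thT` lands on z/τ - τ' rather than z/τ, and `J_add_tau` repairs this.
  have hu' : u / τ = z / τ - τ' + τ' / 2 + 1 / 2 := by
    rw [hu, hτ'def]; field_simp; ring
  have e1 : thT τ z = 1 / (-I * τ) ^ (1 / 2 : ℂ) * Complex.exp (-Real.pi * I * u ^ 2 / τ) *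
      thT τ' (z / τ - τ') := by
    rw [thT, thT, ← hu', ← hu]; exact jacobiTheta₂_functional_equation u τ
  have e2 : thT' τ z = 1 / (-I * τ) ^ (1 / 2 : ℂ) * Complex.exp (-Real.pi * I * u ^ 2 / τ) / τ *
      (thT' τ' (z / τ - τ') - 2 * Real.pi * I * u * thT τ' (z / τ - τ')) := by
    rw [thT, thT', thT', ← hu', ← hu]; exact jacobiTheta₂'_functional_equation u τ
  have hT := thT_ne_zero hτ hz
  have hT' := thT_ne_zero hτ' hz''
  rw [thT'_eq hτ hz, thT'_eq hτ' hz'', e1] at e2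
  rw [e1] at hT
  have hC := left_ne_zero_of_mul hT
  set C := 1 / (-I * τ) ^ (1 / 2 : ℂ) * Complex.exp (-Real.pi * I * u ^ 2 / τ)
  have hJ : J τ' (z / τ - τ') = J τ' (z / τ) + 1 := by
    have := J_add_tau hτ' (z / τ - τ')
    rw [sub_add_cancel] at this
    rw [this]; ring
  rw [hJ] at e2
  generalize thT τ' (z / τ - τ') = X at *
  field_simp at e2
  rw [hu] at e2
  linear_combination -e2

lemma S_neg_inv_of_notMem {τ : ℂ} (hτ : 0 < τ.im) {a b : ℝ} (h : a * τ + b ∉ latt τ) :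
    S (-1 / τ) (-b) a = τ * S τ a b := by
  have h0 : τ ≠ 0 := by rintro rfl; simp at hτ
  have e : ((-b : ℝ) : ℂ) * (-1 / τ) + a = (a * τ + b) / τ := by push_cast; field_simp; ring
  rw [S, S, e, J_neg_inv hτ h]
  push_cast
  ring

/-- Differentiate `J_neg_inv` in z. The summand z there becomes the quasi-modular defect. -/
lemma P_neg_inv_of_notMem {τ : ℂ} (hτ : 0 < τ.im) {a b : ℝ} (h : a * τ + b ∉ latt τ) :
    P (-1 / τ) (-b) a = τ ^ 2 * P τ a b + τ / (2 * Real.pi * I) := by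
  have h0 : τ ≠ 0 := by rintro rfl; simp at hτ
  have hpi : (2 * Real.pi * I : ℂ) ≠ 0 := by simp [Real.pi_ne_zero]
  have e : ((-b : ℝ) : ℂ) * (-1 / τ) + a = (a * τ + b) / τ := by push_cast; field_simp; ring
  have hτ' := im_neg_inv_pos hτ
  have h1 := hasDerivAt_J hτ' (-b) a (by rw [e]; exact fun h' => h ((div_mem_latt_iff hτ).mp h'))
  rw [e] at h1
  have h2 : HasDerivAt (fun z : ℂ => z / τ) (1 / τ) (a * τ + b) := (hasDerivAt_id _).div_const τ
  have h3 := HasDerivAt.comp (a * τ + b : ℂ) h1 h2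
  have h4 := ((((hasDerivAt_J hτ a b h).sub_const (1 / 2)).const_mul τ).add
    (hasDerivAt_id _)).add_const (1 / 2 : ℂ)
  have hev : (J (-1 / τ) ∘ fun z => z / τ) =ᶠ[𝓝 (a * τ + b : ℂ)]
      fun z => τ * (J τ z - 1 / 2) + z + 1 / 2 := by
    filter_upwards [(isClosed_latt hτ).isOpen_compl.mem_nhds h] with z hz
    exact J_neg_inv hτ hz
  have h5 := (h4.congr_of_eventuallyEq hev).unique h3
  field_simp at h5 ⊢
  linear_combination -h5

end ToricHecke

/-! ### Equivariance under SL₂(ℤ), growth at the cusps, and the products as modular forms. -/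

namespace ToricHecke

open Complex Filter Topology Matrix ModularForm
open UpperHalfPlane hiding I
open scoped Manifold

/-! ### Transformation under `SL₂(ℤ)` -/

lemma transpose_coe_mul (g h : SL(2, ℤ)) : ((g * h : SL(2, ℤ)) : Matrix (Fin 2) (Fin 2) ℤ)ᵀ =
    (h : Matrix (Fin 2) (Fin 2) ℤ)ᵀ * (g : Matrix (Fin 2) (Fin 2) ℤ)ᵀ :=
  Matrix.transpose_mul _ _

lemma transpose_coe_one : ((1 : SL(2, ℤ)) : Matrix (Fin 2) (Fin 2) ℤ)ᵀ = 1 :=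
  Matrix.transpose_one

/-- Because φ is a cocycle, the law is stable under products and inverses, so the generators
suffice. It is used with φ = 0 for `St` and with φ a multiple of `D2` for `Pt`. -/
lemma slash_family {k : ℤ} {f : Tor → ℍ → ℂ} {φ : SL(2, ℤ) → ℍ → ℂ}
    (hφ : ∀ A B, φ (A * B) = φ A ∣[k] B + φ B)
    (hS : ∀ x, f x ∣[k] ModularGroup.S = f (act (ModularGroup.S : Matrix (Fin 2) (Fin 2) ℤ)ᵀ x) + φ ModularGroup.S)
    (hT : ∀ x, f x ∣[k] ModularGroup.T = f (act (ModularGroup.T : Matrix (Fin 2) (Fin 2) ℤ)ᵀ x) + φ ModularGroup.T)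
    (γ : SL(2, ℤ)) (x : Tor) : f x ∣[k] γ = f (act (γ : Matrix (Fin 2) (Fin 2) ℤ)ᵀ x) + φ γ := by
  have h1 : φ 1 = 0 := by
    have := hφ 1 1
    rw [mul_one, SlashAction.slash_one] at this
    simpa using this
  have hγ : γ ∈ Subgroup.closure {ModularGroup.S, ModularGroup.T} := by
    simp [SpecialLinearGroup.SL2Z_generators]
  induction hγ using Subgroup.closure_induction generalizing x with
  | one =>
    rw [SlashAction.slash_one, h1, transpose_coe_one, act_one,
      add_zero]
    rfl
  | mem g hg =>
    rcases hg with rfl | rfl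
    · exact hS x
    · exact hT x
  | mul g h _ _ ig ih =>
    rw [SlashAction.slash_mul, ig, SlashAction.add_slash, ih, hφ, transpose_coe_mul,
      act_mul_apply, add_assoc, add_comm (φ h)]
  | inv g _ ig =>
    have e1 : (g : Matrix (Fin 2) (Fin 2) ℤ)ᵀ * ((g⁻¹ : SL(2, ℤ)) : Matrix (Fin 2) (Fin 2) ℤ)ᵀ = 1 := by
      rw [← transpose_coe_mul, inv_mul_cancel, transpose_coe_one]
    have h2 := congrArg (fun F : ℍ → ℂ => F ∣[k] g⁻¹) (ig (act ((g⁻¹ : SL(2, ℤ)) : Matrix (Fin 2) (Fin 2) ℤ)ᵀ x))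
    simp only [← act_mul_apply, e1, act_one, SlashAction.add_slash, ← SlashAction.slash_mul,
      mul_inv_cancel, SlashAction.slash_one] at h2
    have h3 := hφ g g⁻¹
    rw [mul_inv_cancel, h1] at h3
    rw [h2, AddMonoidHom.id_apply, add_assoc, ← h3, add_zero]

lemma slash_S_apply (k : ℤ) (f : ℍ → ℂ) (τ : ℍ) :
    (f ∣[k] ModularGroup.S) τ = f (ModularGroup.S • τ) * (τ : ℂ) ^ (-k) := by
  rw [SL_slash_apply]
  rw [ModularGroup.denom_apply]
  simp [ModularGroup.S]

lemma slash_T_apply (k : ℤ) (f : ℍ → ℂ) (τ : ℍ) :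
    (f ∣[k] ModularGroup.T) τ = f (ModularGroup.T • τ) := by
  rw [SL_slash_apply]
  rw [ModularGroup.denom_apply]
  simp [ModularGroup.T]

lemma coe_S_smul (τ : ℍ) : ((ModularGroup.S • τ : ℍ) : ℂ) = -1 / τ := by
  rw [UpperHalfPlane.modular_S_smul]
  change (-(τ : ℂ))⁻¹ = _
  rw [inv_neg, neg_div, one_div]

lemma coe_T_smul (τ : ℍ) : ((ModularGroup.T • τ : ℍ) : ℂ) = τ + 1 := by
  rw [UpperHalfPlane.modular_T_smul]
  change (((1 : ℝ) : ℂ) + τ) = _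
  push_cast
  ring

lemma act_S_tor (a b : ℝ) : act (ModularGroup.S : Matrix (Fin 2) (Fin 2) ℤ)ᵀ (tor a b) = tor b (-a) := by
  simp [act_apply, ModularGroup.S, tor]

lemma act_T_tor (a b : ℝ) : act (ModularGroup.T : Matrix (Fin 2) (Fin 2) ℤ)ᵀ (tor a b) = tor a (a + b) := by
  simp [act_apply, ModularGroup.T, tor]

lemma tor_swap_eq_zero_iff (a b : ℝ) : tor b (-a) = 0 ↔ tor a b = 0 := by
  simp only [tor, Prod.mk_eq_zero, AddCircle.coe_neg, neg_eq_zero]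
  exact and_comm

lemma St_slash (γ : SL(2, ℤ)) (x : Tor) : St x ∣[(1 : ℤ)] γ = St (act (γ : Matrix (Fin 2) (Fin 2) ℤ)ᵀ x) := by
  have := slash_family (k := 1) (f := St) (φ := 0) (fun A B => by simp) (fun x => ?_)
    (fun x => ?_) γ x
  · simpa using this
  · obtain ⟨a, b, rfl⟩ := tor_surjective x
    rw [act_S_tor, Pi.zero_apply, add_zero]
    ext τ
    rw [slash_S_apply]
    rcases eq_or_ne (tor a b) 0 with h | h
    · rw [h, (tor_swap_eq_zero_iff a b).mpr h, St_zero]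
      simp
    · rw [Ne, ← tor_swap_eq_zero_iff, tor_eq_zero_iff τ] at h
      have := S_neg_inv_of_notMem τ.im_pos h
      rw [neg_neg] at this
      rw [St_tor, St_tor, coe_S_smul, this]
      have h0 := UpperHalfPlane.ne_zero τ
      rw [_root_.zpow_neg_one]
      field_simp
  · obtain ⟨a, b, rfl⟩ := tor_surjective x
    rw [act_T_tor, Pi.zero_apply, add_zero]
    ext τ
    rw [slash_T_apply, St_tor, St_tor, coe_T_smul, S_tau_add_one]

/-- The distribution relation for n = 2 at the origin. It transports the inversion law to x = 0,
where differentiating `J` is not possible. -/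
lemma Pt_zero_eq : (3 : ℂ) • Pt 0 = Pt (tor 0 (1 / 2)) + Pt (tor (1 / 2) 0) +
    Pt (tor (1 / 2) (1 / 2)) := by
  have h := (finsum_nsmul_fiber two_ne_zero 0 0 Pt).2
  rw [Pt_distribution two_ne_zero] at h
  simp only [Finset.sum_range_succ, Finset.sum_range_zero, Nat.cast_zero, Nat.cast_one, zero_add,
    zero_div, Nat.cast_ofNat, tor_zero] at h
  ext τ
  have h1 := congrFun h τ
  simp only [Pi.add_apply, Pi.smul_apply, smul_eq_mul] at h1 ⊢
  linear_combination h1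

lemma Pt_slash (γ : SL(2, ℤ)) (x : Tor) : Pt x ∣[(2 : ℤ)] γ =
    Pt (act (γ : Matrix (Fin 2) (Fin 2) ℤ)ᵀ x) + ((2 * Real.pi * I) ^ 2 : ℂ)⁻¹ • EisensteinSeries.D2 γ := by
  have hpi : (2 * Real.pi * I : ℂ) ≠ 0 := by simp [Real.pi_ne_zero]
  refine slash_family (k := 2) (f := Pt)
    (φ := fun γ => ((2 * Real.pi * I) ^ 2 : ℂ)⁻¹ • EisensteinSeries.D2 γ) (fun A B => ?_)
    (fun x => ?_) (fun x => ?_) γ x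
  · rw [EisensteinSeries.D2_mul, smul_add, SL_smul_slash]
  · have key : ∀ a b : ℝ, tor a b ≠ 0 → ∀ τ : ℍ, Pt (tor a b) (ModularGroup.S • τ) =
        (τ : ℂ) ^ 2 * Pt (tor b (-a)) τ + τ / (2 * Real.pi * I) := by
      intro a b h τ
      rw [Ne, ← tor_swap_eq_zero_iff, tor_eq_zero_iff τ] at h
      have := P_neg_inv_of_notMem τ.im_pos h
      rw [neg_neg] at this
      rw [Pt_tor, Pt_tor, coe_S_smul, this]
    have main : ∀ a b : ℝ, ∀ τ : ℍ, Pt (tor a b) (ModularGroup.S • τ) =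
        (τ : ℂ) ^ 2 * Pt (tor b (-a)) τ + τ / (2 * Real.pi * I) := by
      intro a b τ
      rcases eq_or_ne (tor a b) 0 with h | h
      · have hhalf : ¬ ∃ m : ℤ, (0 : ℝ) = 1 / 2 + m := by
          rintro ⟨m, hm⟩
          have : (0 : ℝ) = ((1 + 2 * m : ℤ) : ℝ) := by push_cast; linarith
          have : (0 : ℤ) = 1 + 2 * m := by exact_mod_cast this
          omega
        have h1 := key 0 (1 / 2) (by
          rw [← tor_zero, Ne, tor_eq_iff]; exact fun h => hhalf h.2) τ
        have h2 := key (1 / 2) 0 (by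
          rw [← tor_zero, Ne, tor_eq_iff]; exact fun h => hhalf h.1) τ
        have h3 := key (1 / 2) (1 / 2) (by
          rw [← tor_zero, Ne, tor_eq_iff]; exact fun h => hhalf h.1) τ
        have e1 : tor 0 (-(1 / 2)) = tor 0 (1 / 2) :=
          (tor_eq_iff _ _ _ _).mpr ⟨⟨0, by norm_num⟩, 1, by norm_num⟩
        have e2 : tor (1 / 2) (-(1 / 2)) = tor (1 / 2) (1 / 2) :=
          (tor_eq_iff _ _ _ _).mpr ⟨⟨0, by norm_num⟩, 1, by norm_num⟩
        rw [neg_zero] at h1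
        rw [e1] at h2
        rw [e2] at h3
        rw [h, (tor_swap_eq_zero_iff a b).mpr h]
        have h4 := congrFun Pt_zero_eq τ
        have h5 := congrFun Pt_zero_eq (ModularGroup.S • τ)
        simp only [Pi.add_apply, Pi.smul_apply, smul_eq_mul] at h4 h5
        rw [h1, h2, h3] at h5
        linear_combination h5 / 3 - (τ : ℂ) ^ 2 * h4 / 3
      · exact key a b h τ
    obtain ⟨a, b, rfl⟩ := tor_surjective x
    ext τ
    have h0 := UpperHalfPlane.ne_zero τ
    rw [act_S_tor, slash_S_apply, main, Pi.add_apply, Pi.smul_apply, EisensteinSeries.D2_S,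
      smul_eq_mul, _root_.zpow_neg]
    norm_cast
    field_simp
  · obtain ⟨a, b, rfl⟩ := tor_surjective x
    rw [act_T_tor, EisensteinSeries.D2_T, smul_zero, add_zero]
    ext τ
    rw [slash_T_apply, Pt_tor, Pt_tor, coe_T_smul, P_tau_add_one]

/-! ### Holomorphy and growth -/

lemma norm_geometric_div_le {q Z : ℂ} (hq : ‖q‖ ≤ 1) {r : ℝ} (hr : r < 1) (hZ : ‖Z‖ ≤ r) (n : ℕ) :
    ‖q ^ n * Z / (1 - q ^ n * Z)‖ ≤ ‖q‖ ^ n * ‖Z‖ / (1 - r) := by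
  have h1 : ‖q ^ n * Z‖ = ‖q‖ ^ n * ‖Z‖ := by rw [norm_mul, norm_pow]
  have h2 : ‖q‖ ^ n * ‖Z‖ ≤ r := (mul_le_of_le_one_left (norm_nonneg _)
    (pow_le_one₀ (norm_nonneg _) hq)).trans hZ
  have h3 : 1 - r ≤ ‖1 - q ^ n * Z‖ := by
    have := norm_sub_norm_le (1 : ℂ) (q ^ n * Z)
    rw [norm_one, h1] at this
    linarith
  rw [norm_div, h1]
  gcongr

lemma summable_geometric_div {q : ℂ} (hq : ‖q‖ < 1) (Z : ℂ) (r : ℝ) :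
    Summable fun n : ℕ => ‖q‖ ^ n * ‖Z‖ / (1 - r) :=
  ((summable_geometric_of_lt_one (norm_nonneg _) hq).mul_right _).div_const _

/-- For 0 ≤ a < 1 only the term c = 0 may fail to decay as Im τ grows; the other terms are
geometrically small. -/
lemma J_split {τ : ℂ} (hτ : 0 < τ.im) {a b : ℝ} (ha : 0 ≤ a) (ha1 : a < 1) :
    J τ (a * τ + b) = kterm τ (a * τ + b) 0 +
      (∑' n : ℕ, -(ee τ ^ n * ee (a * τ + b + τ) / (1 - ee τ ^ n * ee (a * τ + b + τ))) +
       ∑' n : ℕ, ee τ ^ n * (ee τ / ee (a * τ + b)) / (1 - ee τ ^ n * (ee τ / ee (a * τ + b)))) := by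
  set z : ℂ := a * τ + b with hz
  have him : ∀ c : ℤ, (z + c * τ).im = (a + c) * τ.im := fun c => by simp [hz]; ring
  have hpos : ∀ c : ℤ, 0 ≤ c → ee (z + τ + c * τ) ≠ 1 := by
    intro c hc
    refine ee_ne_one_of_im_ne_zero ?_
    have e : z + τ + c * τ = z + ((c + 1 : ℤ) : ℂ) * τ := by push_cast; ring
    rw [e, him]
    have : (0 : ℝ) ≤ c := by exact_mod_cast hc
    push_cast
    positivity
  have hneg : ∀ c : ℤ, c < 0 → ee (z + c * τ) ≠ 1 := by
    intro c hc
    refine ee_ne_one_of_im_ne_zero ?_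
    rw [him]
    have : (c : ℝ) ≤ -1 := by exact_mod_cast Int.le_sub_one_of_lt hc
    exact (mul_neg_of_neg_of_pos (by linarith) hτ).ne
  have hs : Summable (kterm τ z) := by simpa using summable_kterm hτ z one_weight
  rw [J_def]
  refine (tsum_int_split_zero hs (fun n => ?_) (fun n => ?_)).2.2
  · rw [← kterm_natCast hpos, kterm, kterm]
    have e1 : sg ((n : ℤ) + 1) = sg n := by
      rw [sg, sg, if_pos (by positivity), if_pos (by positivity)]
    rw [e1]
    congr 3
    push_cast
    ring
  · exact kterm_neg_succ hneg n

lemma isBoundedAtImInfty_St (x : Tor) : UpperHalfPlane.IsBoundedAtImInfty (St x) := by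
  obtain ⟨a', b, rfl⟩ := tor_surjective x
  have hfr : tor a' b = tor (Int.fract a') b :=
    (tor_eq_iff _ _ _ _).mpr ⟨⟨-⌊a'⌋, by rw [Int.fract]; push_cast; ring⟩, 0, by simp⟩
  rw [hfr]
  have ha := Int.fract_nonneg a'
  have ha1 := Int.fract_lt_one a'
  generalize Int.fract a' = a at *
  -- For a = 0 this term does not involve τ. For a > 0 the height 1/(2πa) gives |X| ≤ e⁻¹ < 1/2.
  have hk : ∃ C T : ℝ, ∀ τ : ℍ, T ≤ τ.im → ‖kterm τ (a * τ + b) 0‖ ≤ C := by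
    rcases eq_or_lt_of_le ha with rfl | ha
    · exact ⟨‖kterm 0 b 0‖, 0, fun τ _ => by simp [kterm]⟩
    · refine ⟨1 / 2 / (1 - 1 / 2), 1 / (2 * Real.pi * a), fun τ hT => ?_⟩
      have e : kterm τ (a * τ + b) ((0 : ℕ) : ℤ) = _ := kterm_natCast (fun c hc => by
        refine ee_ne_one_of_im_ne_zero ?_
        have : (0 : ℝ) ≤ c := by exact_mod_cast hc
        have e : ((a : ℂ) * τ + b + c * τ).im = (a + c) * τ.im := by simp; ring
        rw [e]
        have := τ.im_pos
        positivity) 0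
      rw [Nat.cast_zero] at e
      have hX : ‖ee (a * τ + b)‖ ≤ 1 / 2 := by
        have e2 : ((a : ℂ) * τ + b).im = a * τ.im := by simp
        rw [norm_ee, e2]
        have h2 : 1 ≤ 2 * Real.pi * (a * τ.im) := by
          rw [div_le_iff₀ (by positivity)] at hT
          linarith
        have h3 : Real.exp (-2 * Real.pi * (a * τ.im)) ≤ Real.exp (-1) :=
          Real.exp_le_exp.mpr (by linarith)
        have h4 := Real.exp_neg_one_lt_half
        linarith
      rw [e, norm_neg]
      refine (norm_geometric_div_le (norm_ee_lt_one τ.im_pos).le (by norm_num) hX 0).trans ?_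
      rw [pow_zero, one_mul]
      gcongr
  obtain ⟨C, T, hC⟩ := hk
  rw [UpperHalfPlane.isBoundedAtImInfty_iff]
  have hsum : ∀ {q Z : ℂ}, ‖q‖ ≤ 1 / 2 → ‖Z‖ ≤ 1 / 2 →
      ‖∑' n : ℕ, q ^ n * Z / (1 - q ^ n * Z)‖ ≤ 2 := by
    intro q Z hq hZ
    have hs := summable_geometric_div (q := q) (by linarith) Z (1 / 2)
    refine (tsum_of_norm_bounded hs.hasSum
      (norm_geometric_div_le (by linarith) (by norm_num) hZ)).trans ?_
    rw [tsum_div_const, tsum_mul_right, tsum_geometric_of_lt_one (norm_nonneg _) (by linarith)]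
    have : (1 - ‖q‖)⁻¹ ≤ 2 := by
      rw [inv_le_comm₀ (by linarith) (by norm_num)]; linarith
    have h := mul_le_mul this hZ (norm_nonneg _) (by norm_num)
    rw [div_le_iff₀ (by norm_num)]
    linarith
  refine ⟨C + (2 + 2) + |a| + 1 / 2, max T (1 / (2 * Real.pi * (1 - a))), fun τ hT => ?_⟩
  have hτ := τ.im_pos
  have h1a : 0 < 1 - a := by linarith
  have hsmall : 1 ≤ 2 * Real.pi * ((1 - a) * τ.im) := by
    have := (le_max_right _ _).trans hT
    rw [div_le_iff₀ (by positivity)] at this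
    linarith
  have h4 := Real.exp_neg_one_lt_half
  have hle : ∀ {w : ℂ}, (1 - a) * τ.im ≤ w.im → ‖ee w‖ ≤ 1 / 2 := by
    intro w hw
    rw [norm_ee]
    have h3 : Real.exp (-2 * Real.pi * w.im) ≤ Real.exp (-1) :=
      Real.exp_le_exp.mpr (by nlinarith [Real.pi_pos])
    linarith
  have hq : ‖ee τ‖ ≤ 1 / 2 := hle (by rw [UpperHalfPlane.coe_im]; nlinarith)
  have hX : ‖ee (a * τ + b + τ)‖ ≤ 1 / 2 := hle (by simp; nlinarith)
  have hY : ‖ee τ / ee (a * τ + b)‖ ≤ 1 / 2 := by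
    have e : ee τ / ee (a * τ + b) = ee (τ - (a * τ + b)) := by
      rw [sub_eq_add_neg, ee_add (τ : ℂ), ee_neg, div_eq_mul_inv]
    rw [e]
    exact hle (by simp; linarith)
  rw [St_tor, S, J_split hτ ha ha1]
  have n1 := hC τ ((le_max_left _ _).trans hT)
  have n2 := hsum hq hX
  have n3 := hsum hq hY
  rw [tsum_neg]
  refine (norm_sub_le _ _).trans ?_
  have : ‖(1 / 2 : ℂ)‖ = 1 / 2 := by norm_num
  rw [this]
  gcongr
  refine (norm_add_le _ _).trans ?_
  rw [Complex.norm_real, Real.norm_eq_abs]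
  gcongr
  refine (norm_add_le _ _).trans ?_
  gcongr
  refine (norm_add_le _ _).trans ?_
  rw [norm_neg]
  gcongr

lemma mdifferentiable_St_real (b : ℝ) : MDiff (St (tor 0 b)) := by
  rw [UpperHalfPlane.mdifferentiable_iff]
  have hdiff : DifferentiableOn ℂ (fun τ : ℂ => S τ 0 b) {z | 0 < z.im} := by
    have hgeo : ∀ Y : ℂ, ‖Y‖ = 1 → DifferentiableOn ℂ
        (fun τ : ℂ => ∑' n : ℕ, ee τ ^ n * (ee τ * Y) / (1 - ee τ ^ n * (ee τ * Y)))
        {z | 0 < z.im} := by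
      intro Y hY z hz
      set T := z.im / 2 with hTdef
      have hT : 0 < T := half_pos hz
      have hzT : T < z.im := half_lt_self hz
      set r := Real.exp (-2 * Real.pi * T) with hr
      have hr1 : r < 1 := by
        rw [hr, Real.exp_lt_one_iff]; nlinarith [Real.pi_pos]
      have hr0 : 0 < r := Real.exp_pos _
      have hopen : IsOpen {w : ℂ | T < w.im} := isOpen_lt continuous_const Complex.continuous_im
      have hle : ∀ w : ℂ, T < w.im → ‖ee w‖ ≤ r := fun w hw => by
        rw [norm_ee, hr]
        exact Real.exp_le_exp.mpr (by nlinarith [Real.pi_pos])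
      have hle' : ∀ w : ℂ, T < w.im → ‖ee w * Y‖ ≤ r := fun w hw => by
        rw [norm_mul, hY, mul_one]; exact hle w hw
      have hD : DifferentiableOn ℂ (fun τ : ℂ => ∑' n : ℕ,
          ee τ ^ n * (ee τ * Y) / (1 - ee τ ^ n * (ee τ * Y))) {w : ℂ | T < w.im} := by
        refine differentiableOn_tsum_of_summable_norm (u := fun n : ℕ => r ^ n * r / (1 - r))
          (((summable_geometric_of_lt_one hr0.le hr1).mul_right _).div_const _)
          (fun n w hw => ?_) hopen (fun n w hw => ?_)
        · have h1 : DifferentiableAt ℂ ee w := (hasDerivAt_ee w).differentiableAt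
          have h2 : 1 - ee w ^ n * (ee w * Y) ≠ 0 := by
            intro h0
            have h3 : ‖ee w ^ n * (ee w * Y)‖ = 1 := by
              rw [← sub_eq_zero.mp h0, norm_one]
            rw [norm_mul, norm_pow] at h3
            have h4 : ‖ee w‖ ^ n * ‖ee w * Y‖ ≤ ‖ee w * Y‖ :=
              mul_le_of_le_one_left (norm_nonneg _)
                (pow_le_one₀ (norm_nonneg _) ((hle w hw).trans hr1.le))
            linarith [hle' w hw]
          have h5 : DifferentiableAt ℂ (fun w => ee w ^ n * (ee w * Y)) w :=
            (h1.pow n).mul (h1.mul_const Y)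
          exact (h5.div (h5.const_sub 1) h2).differentiableWithinAt
        · refine (norm_geometric_div_le ((hle w hw).trans hr1.le) hr1 (hle' w hw) n).trans ?_
          have := hle w hw
          have := hle' w hw
          have : 0 < 1 - r := by linarith
          gcongr
      exact (hD.differentiableAt (hopen.mem_nhds hzT)).differentiableWithinAt
    have hnorm : ‖ee b‖ = 1 := by rw [norm_ee]; simp
    have h1 := hgeo (ee b) hnorm
    have h2 := hgeo (ee b)⁻¹ (by rw [norm_inv, hnorm, inv_one])
    refine DifferentiableOn.congr
      (((h1.neg.add h2).const_add (kterm 0 b 0)).sub_const (1 / 2)) fun τ hτ => ?_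
    have := J_split hτ (a := 0) (b := b) le_rfl one_pos
    rw [S, this, ofReal_zero, zero_mul, zero_add, ee_add, mul_comm (ee b), tsum_neg,
      div_eq_mul_inv (ee τ) (ee b)]
    simp [kterm]
  refine hdiff.congr fun τ hτ => ?_
  rw [Function.comp_apply, UpperHalfPlane.ofComplex_apply_of_im_pos hτ, St_tor]

/-! ### The forms `s_{a/l} s_{b/l}` -/

lemma mul_slash_St (γ : SL(2, ℤ)) (x y : Tor) :
    (St x * St y) ∣[(2 : ℤ)] γ = St (act (γ : Matrix (Fin 2) (Fin 2) ℤ)ᵀ x) * St (act (γ : Matrix (Fin 2) (Fin 2) ℤ)ᵀ y) := by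
  rw [← St_slash, ← St_slash]
  exact mul_slash_SL2 1 1 γ (St x) (St y)

lemma act_tor_zero_of_mem {l : ℕ} [NeZero l] {γ : SL(2, ℤ)} (hγ : γ ∈ CongruenceSubgroup.Gamma1 l)
    (a : ℤ) : act (γ : Matrix (Fin 2) (Fin 2) ℤ)ᵀ (tor 0 (a / l)) = tor 0 (a / l) := by
  have hl : (l : ℝ) ≠ 0 := by exact_mod_cast NeZero.ne l
  rw [CongruenceSubgroup.Gamma1_mem] at hγ
  obtain ⟨-, h11, h10⟩ := hγ
  obtain ⟨m, hm⟩ := (ZMod.intCast_zmod_eq_zero_iff_dvd _ _).mp h10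
  have h11' : ((γ 1 1 - 1 : ℤ) : ZMod l) = 0 := by push_cast; rw [h11, sub_self]
  obtain ⟨n, hn⟩ := (ZMod.intCast_zmod_eq_zero_iff_dvd _ _).mp h11'
  have hn' : γ 1 1 = 1 + l * n := by omega
  have e : act (γ : Matrix (Fin 2) (Fin 2) ℤ)ᵀ (tor 0 (a / l)) = tor (γ 1 0 * (a / l)) (γ 1 1 * (a / l)) := by
    simp [act_apply, tor]
  rw [e, tor_eq_iff, hm, hn']
  refine ⟨⟨-(m * a), ?_⟩, -(n * a), ?_⟩ <;> push_cast <;> field_simp <;> ring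

/-- The modular form `s_{a/l} s_{b/l}`. -/
def prodForm (l : ℕ) [NeZero l] (a b : ℤ) : MForm l where
  toFun := St (tor 0 (a / l)) * St (tor 0 (b / l))
  slash_action_eq' := by
    rintro _ ⟨γ, hγ, rfl⟩
    have := mul_slash_St γ (tor 0 (a / l)) (tor 0 (b / l))
    rw [act_tor_zero_of_mem hγ, act_tor_zero_of_mem hγ] at this
    exact this
  holo' := (mdifferentiable_St_real _).mul (mdifferentiable_St_real _)
  -- Slashing by SL₂(ℤ) only moves the two torsion points, and `St` is bounded at infinity at each
  -- of them. For this reason the bound is proved for all points and holomorphy only for a = 0.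
  bdd_at_cusps' {c} hc := by
    rw [Subgroup.IsArithmetic.isCusp_iff_isCusp_SL2Z] at hc
    rw [OnePoint.isBoundedAt_iff_forall_SL2Z hc]
    intro γ _
    rw [mul_slash_St]
    exact (isBoundedAtImInfty_St _).mul (isBoundedAtImInfty_St _)

lemma coe_prodForm (l : ℕ) [NeZero l] (a b : ℤ) :
    ⇑(prodForm l a b) = St (tor 0 (a / l)) * St (tor 0 (b / l)) := rfl

end ToricHecke

/-! ### Existence and uniqueness of `μ`, and Hecke cosets as points of a projective line. -/

namespace ToricHecke

open Matrix Matrix.SpecialLinearGroup CongruenceSubgroup ConjAct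

/-! ### The map `μ` -/

/-- The map from modular forms modulo Eisenstein series to functions modulo Eisenstein series. -/
def formMap (l : ℕ) : MForm l ⧸ eisSpace l →ₗ[ℂ] (UpperHalfPlane → ℂ) ⧸ eisSpan l :=
  (eisSpace l).mapQ (eisSpan l)
    { toFun := fun f => f
      map_add' := fun _ _ => rfl
      map_smul' := fun _ _ => rfl } fun _ hf => hf

lemma formMap_mkQ (l : ℕ) (f : MForm l) :
    formMap l ((eisSpace l).mkQ f) = (eisSpan l).mkQ (f : UpperHalfPlane → ℂ) := rfl

/-- `eisSpace` is by definition the preimage of `eisSpan`. Identities between classes of forms may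
thus be checked among arbitrary functions. -/
lemma formMap_injective (l : ℕ) : Function.Injective (formMap l) := by
  rw [injective_iff_map_eq_zero]
  intro x hx
  obtain ⟨f, rfl⟩ := (eisSpace l).mkQ_surjective x
  rw [formMap_mkQ, Submodule.mkQ_apply, Submodule.Quotient.mk_eq_zero] at hx
  rw [Submodule.mkQ_apply, Submodule.Quotient.mk_eq_zero]
  exact hx

lemma tor_neg_div (l : ℕ) (a : ℤ) : tor 0 ((-a : ℤ) / l) = -tor 0 (a / l) := by
  rw [tor_neg, neg_zero]
  push_cast
  rw [neg_div]

lemma symbolMap_maninSymbol_of_gcd {l : ℕ} [NeZero l] {a b : ℤ}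
    (h : Int.gcd (Int.gcd a b) l = 1) :
    symbolMap l (maninSymbol l a b) = formMap l ((eisSpace l).mkQ (prodForm l a b)) := by
  obtain ⟨g, ha, hb⟩ := exists_SL_bottom_row h
  rw [symbolMap_maninSymbol g ha hb, formMap_mkQ, coe_prodForm]

lemma prodForm_neg_left (l : ℕ) [NeZero l] (a b : ℤ) : prodForm l (-a) b = -prodForm l a b := by
  apply DFunLike.coe_injective
  rw [coe_prodForm, tor_neg_div, St_neg, neg_mul, ← coe_prodForm]
  rfl

lemma gcd_neg_left {l : ℕ} {a b : ℤ} (h : Int.gcd (Int.gcd a b) l = 1) :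
    Int.gcd (Int.gcd (-a) b) l = 1 := by rwa [Int.neg_gcd]

lemma symbolMap_maninMinus {l : ℕ} [NeZero l] {a b : ℤ} (h : Int.gcd (Int.gcd a b) l = 1) :
    symbolMap l (maninMinus l a b) = formMap l ((eisSpace l).mkQ (prodForm l a b)) := by
  change symbolMap l ((1 / 2 : ℂ) • (maninSymbol l a b - maninSymbol l (-a) b)) = _
  rw [map_smul, map_sub, symbolMap_maninSymbol_of_gcd h,
    symbolMap_maninSymbol_of_gcd (gcd_neg_left h), prodForm_neg_left, map_neg, map_neg,
    sub_neg_eq_add, ← two_smul ℂ, smul_smul]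
  norm_num

lemma prodForm_eq_zero {l : ℕ} [NeZero l] {a b : ℤ} (h : (l : ℤ) ∣ a ∨ (l : ℤ) ∣ b) :
    prodForm l a b = 0 := by
  apply DFunLike.coe_injective
  rw [coe_prodForm]
  rcases h with h | h <;> rw [(tor_div_eq_zero_iff _).mpr h, St_zero]
  · rw [zero_mul]; rfl
  · rw [mul_zero]; rfl

/-- Since `St 0 = 0`, the case where l divides a or b is covered by the same product formula. -/
lemma isToricMap_iff {l : ℕ} [NeZero l] (μ : minusSymbols l →ₗ[ℂ] MForm l ⧸ eisSpace l) :
    IsToricMap l μ ↔ ∀ a b : ℤ, Int.gcd (Int.gcd a b) l = 1 →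
      μ (maninMinus l a b) = (eisSpace l).mkQ (prodForm l a b) := by
  have hs : ∀ {a b : ℤ}, ¬(l : ℤ) ∣ a → ¬(l : ℤ) ∣ b → ∀ τ,
      prodForm l a b τ = s l a τ * s l b τ := by
    intro a b ha hb τ
    rw [s_eq l ha, s_eq l hb]
    rfl
  refine forall₂_congr fun a b => forall_congr' fun _ => ⟨fun h => ?_, fun h => ⟨?_, ?_⟩⟩
  · by_cases hab : (l : ℤ) ∣ a ∨ (l : ℤ) ∣ b
    · rw [h.1 hab, prodForm_eq_zero hab, map_zero]
    · push Not at hab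
      obtain ⟨F, hF, hμ⟩ := h.2 hab.1 hab.2
      rw [hμ]
      congr 1
      ext τ
      rw [hF, hs hab.1 hab.2]
  · intro hab
    rw [h, prodForm_eq_zero hab, map_zero]
  · intro ha hb
    exact ⟨prodForm l a b, hs ha hb, h⟩

lemma IsToricMap.formMap_apply {l : ℕ} [NeZero l]
    {μ : minusSymbols l →ₗ[ℂ] MForm l ⧸ eisSpace l} (hμ : IsToricMap l μ) (x : minusSymbols l) :
    formMap l (μ x) = symbolMap l x := by
  have : formMap l ∘ₗ μ = symbolMap l ∘ₗ (minusSymbols l).subtype :=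
    ext_maninMinus fun a b h => by
      rw [LinearMap.comp_apply, (isToricMap_iff μ).mp hμ a b h, LinearMap.comp_apply,
        Submodule.subtype_apply, symbolMap_maninMinus h]
  exact LinearMap.congr_fun this x

lemma exists_isToricMap (l : ℕ) [NeZero l] :
    ∃ μ : minusSymbols l →ₗ[ℂ] MForm l ⧸ eisSpace l, IsToricMap l μ := by
  -- On minus symbols `symbolMap` has values in the image of `formMap`, so any linear left inverse
  -- recovers classes of forms.
  obtain ⟨j, hj⟩ := (formMap l).exists_leftInverse_of_injective
    (LinearMap.ker_eq_bot.mpr (formMap_injective l))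
  refine ⟨j ∘ₗ symbolMap l ∘ₗ (minusSymbols l).subtype, (isToricMap_iff _).mpr fun a b h => ?_⟩
  rw [LinearMap.comp_apply, LinearMap.comp_apply, Submodule.subtype_apply, symbolMap_maninMinus h]
  exact LinearMap.congr_fun hj _

lemma IsToricMap.unique {l : ℕ} [NeZero l] {μ ν : minusSymbols l →ₗ[ℂ] MForm l ⧸ eisSpace l}
    (hμ : IsToricMap l μ) (hν : IsToricMap l ν) : μ = ν :=
  ext_maninMinus fun a b h => by
    rw [(isToricMap_iff μ).mp hμ a b h, (isToricMap_iff ν).mp hν a b h]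

/-! ### The cosets of the Hecke operator -/

lemma exists_mem_Gamma_column {l p : ℕ} [NeZero l] [hp : Fact p.Prime] (hpl : ¬p ∣ l) (u v : ZMod p)
    (huv : u ≠ 0 ∨ v ≠ 0) :
    ∃ γ ∈ Gamma l, ((γ 1 1 : ℤ) : ZMod p) = u ∧ -((γ 0 1 : ℤ) : ZMod p) = v := by
  have hcop : IsCoprime (p : ℤ) l :=
    Nat.isCoprime_iff_coprime.mpr ((Nat.Prime.coprime_iff_not_dvd hp.out).mpr hpl)
  obtain ⟨x, y, hxy⟩ := hcop
  have hp0 : (p : ℤ) ≠ 0 := by exact_mod_cast hp.out.ne_zero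
  have : NeZero (l * p) := ⟨mul_ne_zero (NeZero.ne l) hp.out.ne_zero⟩
  have hyl : ((y * l : ℤ) : ZMod p) = 1 := by
    have := congrArg (Int.cast : ℤ → ZMod p) hxy
    push_cast at this ⊢
    simpa using this
  have hxp : ((x * p : ℤ) : ZMod l) = 1 := by
    have := congrArg (Int.cast : ℤ → ZMod l) hxy
    push_cast at this ⊢
    simpa using this
  set A : ℤ := u.val * (y * l) + x * p with hA
  set B : ℤ := v.val * (y * l) with hB
  have hAp : (A : ZMod p) = u := by
    rw [hA, Int.cast_add, Int.cast_mul, hyl]; simp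
  have hBp : (B : ZMod p) = v := by
    rw [hB, Int.cast_mul, hyl]; simp
  have hAl : (A : ZMod l) = 1 := by
    rw [hA, Int.cast_add, hxp]; simp
  have hBl : (B : ZMod l) = 0 := by
    rw [hB]; simp
  have hgcd : Int.gcd (Int.gcd A B) (l * p : ℕ) = 1 := by
    rw [← Int.isCoprime_iff_gcd_eq_one, Nat.cast_mul]
    refine IsCoprime.mul_right ?_ ?_
    · have h1 : ((A - 1 : ℤ) : ZMod l) = 0 := by push_cast; rw [hAl, sub_self]
      obtain ⟨k, hk⟩ := (ZMod.intCast_zmod_eq_zero_iff_dvd _ _).mp h1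
      obtain ⟨m, hm⟩ : (Int.gcd A B : ℤ) ∣ A := Int.gcd_dvd_left ..
      exact ⟨m, -k, by linarith⟩
    · rw [isCoprime_comm, Prime.coprime_iff_not_dvd (Nat.prime_iff_prime_int.mp hp.out)]
      intro hdvd
      have h1 := hdvd.trans (Int.gcd_dvd_left (a := A) (b := B))
      have h2 := hdvd.trans (Int.gcd_dvd_right (a := A) (b := B))
      rw [← ZMod.intCast_zmod_eq_zero_iff_dvd] at h1 h2
      rw [hAp] at h1
      rw [hBp] at h2
      exact huv.elim (fun h => h h1) (fun h => h h2)
  obtain ⟨h, h0, h1⟩ := exists_SL_bottom_row hgcd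
  have red : ∀ {n : ℕ} {a b : ℤ}, n ∣ l * p → (a : ZMod (l * p)) = b → (a : ZMod n) = b := by
    intro n a b hn hab
    have := congrArg (ZMod.castHom hn (ZMod n)) hab
    simpa using this
  have hdet : h 0 0 * h 1 1 - h 0 1 * h 1 0 = 1 := by
    rw [← Matrix.det_fin_two]; exact h.det_coe
  have h0l := red (dvd_mul_right l p) h0
  have h1l := red (dvd_mul_right l p) h1
  have h0p := red (dvd_mul_left p l) h0
  have h1p := red (dvd_mul_left p l) h1
  rw [hAl] at h0l
  rw [hBl] at h1l
  have hdetl := congrArg (Int.cast : ℤ → ZMod l) hdet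
  push_cast at hdetl
  rw [h0l, h1l] at hdetl
  -- Multiply the transpose of h on the left by (0, -1; 1, 0), then subtract `h 0 0` times the
  -- second column from the first. As the bottom row of h is (1, 0) modulo l, the result is the
  -- identity modulo l.
  refine ⟨⟨!![h 0 0 * h 1 1 - h 0 1, -h 1 1; h 0 0 - h 0 0 * h 1 0, h 1 0], ?_⟩, ?_, ?_, ?_⟩
  · rw [Matrix.det_fin_two_of]
    linear_combination hdet
  · refine Gamma_mem.mpr ?_
    simp [h0l, h1l]
    linear_combination hdetl
  · simp [h0p, hAp]
  · simp [h1p, hBp]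

/-- A sum over `Γ₁(l) / (Γ₁(l) ∩ α⁻¹ Γ₁(l) α)` as a sum over the projective line over `𝔽_p`. -/
lemma sum_cosets {G : Type*} [Group G] {l p : ℕ} [NeZero l] [hp : Fact p.Prime] (hpl : ¬p ∣ l)
    (ψ : SL(2, ℤ) →* G) (N : Subgroup G)
    (hN : ∀ γ ∈ Gamma1 l, ψ γ ∈ N ↔ ((γ 0 1 : ℤ) : ZMod p) = 0)
    [Fintype ((Gamma1 l).map ψ ⧸ N.subgroupOf ((Gamma1 l).map ψ))] {V : Type*} [AddCommGroup V]
    (F : (Gamma1 l).map ψ ⧸ N.subgroupOf ((Gamma1 l).map ψ) → V) (F' : ZMod p × ZMod p → V)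
    (hF' : ∀ c : ZMod p, c ≠ 0 → ∀ v, F' (c • v) = F' v)
    (hF : ∀ (γ : SL(2, ℤ)) (hγ : γ ∈ Gamma1 l), γ ∈ Gamma l →
      F (QuotientGroup.mk ⟨ψ γ, γ, hγ, rfl⟩) =
        F' (((γ 1 1 : ℤ) : ZMod p), -((γ 0 1 : ℤ) : ZMod p))) :
    (p - 1) • ∑ q, F q + F' 0 = ∑ v, F' v := by
  -- This is the first row of γ⁻¹ modulo p. Two elements lie in the same coset exactly when their
  -- rows span the same line.
  set col : SL(2, ℤ) → ZMod p × ZMod p :=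
    fun γ => (((γ 1 1 : ℤ) : ZMod p), -((γ 0 1 : ℤ) : ZMod p)) with hcol
  have hcol0 : ∀ γ, col γ ≠ 0 := by
    intro γ h0
    have hdet : γ 0 0 * γ 1 1 - γ 0 1 * γ 1 0 = 1 := by
      rw [← Matrix.det_fin_two]; exact γ.det_coe
    have := congrArg (Int.cast : ℤ → ZMod p) hdet
    push_cast at this
    have h1 := congrArg Prod.fst h0
    have h2 := congrArg Prod.snd h0
    simp only [hcol, Prod.fst_zero, Prod.snd_zero, neg_eq_zero] at h1 h2
    rw [h1, h2] at this
    simp at this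
  have hmk : ∀ γ γ' (h : γ ∈ Gamma1 l) (h' : γ' ∈ Gamma1 l) (c : ZMod p), col γ' = c • col γ →
      (QuotientGroup.mk ⟨ψ γ, γ, h, rfl⟩ : (Gamma1 l).map ψ ⧸ N.subgroupOf ((Gamma1 l).map ψ)) =
        QuotientGroup.mk ⟨ψ γ', γ', h', rfl⟩ := by
    intro γ γ' h h' c hc
    rw [QuotientGroup.eq, Subgroup.mem_subgroupOf]
    change (ψ γ)⁻¹ * ψ γ' ∈ N
    rw [← map_inv, ← map_mul, hN _ (mul_mem (inv_mem h) h')]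
    have h1 := congrArg Prod.fst hc
    have h2 := congrArg Prod.snd hc
    simp only [hcol, Prod.smul_mk, smul_eq_mul] at h1 h2
    have e : (γ⁻¹ * γ') 0 1 = γ 1 1 * γ' 0 1 - γ 0 1 * γ' 1 1 := by
      change ((γ : Matrix (Fin 2) (Fin 2) ℤ).adjugate * (γ' : Matrix (Fin 2) (Fin 2) ℤ)) 0 1 = _
      rw [Matrix.mul_apply, Fin.sum_univ_two, Matrix.adjugate_fin_two]
      simp
      ring
    rw [e]
    push_cast
    linear_combination -(γ 1 1 : ZMod p) * h2 - (γ 0 1 : ZMod p) * h1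
  -- Representatives are taken in Γ(l), which fixes every l-torsion point; the Eisenstein series
  -- require this.
  have hrep : ∀ q : (Gamma1 l).map ψ ⧸ N.subgroupOf ((Gamma1 l).map ψ), ∃ (γ : SL(2, ℤ))
      (hγ : γ ∈ Gamma1 l), γ ∈ Gamma l ∧ QuotientGroup.mk ⟨ψ γ, γ, hγ, rfl⟩ = q := by
    intro q
    obtain ⟨⟨_, γ, hγ, rfl⟩, rfl⟩ := QuotientGroup.mk_surjective q
    have h0 := hcol0 γ
    obtain ⟨γ', h1, h2, h3⟩ := exists_mem_Gamma_column hpl (col γ).1 (col γ).2 (by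
      by_contra! hc
      exact h0 (Prod.ext hc.1 hc.2))
    have h1' : γ' ∈ Gamma1 l := by
      rw [Gamma_mem] at h1
      rw [Gamma1_mem]
      tauto
    exact ⟨γ', h1', h1, (hmk γ γ' hγ h1' 1 (by rw [one_smul]; exact Prod.ext h2 h3)).symm⟩
  choose r hr1 hr hrq using hrep
  -- A non-zero vector is a unique unit multiple of the chosen generator of its line. Hence the
  -- factor p - 1.
  let Φ : ((Gamma1 l).map ψ ⧸ N.subgroupOf ((Gamma1 l).map ψ)) × (ZMod p)ˣ →
      {v : ZMod p × ZMod p // v ≠ 0} := fun x => ⟨(x.2 : ZMod p) • col (r x.1), by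
        rw [smul_ne_zero_iff]; exact ⟨x.2.ne_zero, hcol0 _⟩⟩
  have hΦ : Function.Bijective Φ := by
    constructor
    · rintro ⟨q, c⟩ ⟨q', c'⟩ h
      have h1 : (c : ZMod p) • col (r q) = (c' : ZMod p) • col (r q') := congrArg Subtype.val h
      have h2 : q = q' := by
        rw [← hrq q, ← hrq q']
        refine hmk _ _ (hr1 q) (hr1 q') ((c' : ZMod p)⁻¹ * c) ?_
        rw [mul_smul, h1, smul_smul, inv_mul_cancel₀ c'.ne_zero, one_smul]
      subst h2
      rw [Prod.mk.injEq]
      refine ⟨rfl, Units.ext ?_⟩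
      have h3 : ((c : ZMod p) - c') • col (r q) = 0 := by rw [sub_smul, h1, sub_self]
      exact sub_eq_zero.mp ((smul_eq_zero.mp h3).resolve_right (hcol0 _))
    · rintro ⟨v, hv⟩
      obtain ⟨γ, h1, h2, h3⟩ := exists_mem_Gamma_column hpl v.1 v.2 (by
        by_contra! hc
        exact hv (Prod.ext hc.1 hc.2))
      have h1' : γ ∈ Gamma1 l := by
        rw [Gamma_mem] at h1
        rw [Gamma1_mem]
        tauto
      have hcv : col γ = v := Prod.ext h2 h3
      set q : (Gamma1 l).map ψ ⧸ N.subgroupOf ((Gamma1 l).map ψ) :=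
        QuotientGroup.mk ⟨ψ γ, γ, h1', rfl⟩ with hq
      have hmem : (r q)⁻¹ * γ ∈ Gamma1 l := mul_mem (inv_mem (hr1 q)) h1'
      have h4 : ψ ((r q)⁻¹ * γ) ∈ N := by
        have := (hrq q).trans hq
        rw [QuotientGroup.eq, Subgroup.mem_subgroupOf] at this
        rw [map_mul, map_inv]
        exact this
      rw [hN _ hmem] at h4
      set κ := (r q)⁻¹ * γ with hκ
      have hγ : γ = r q * κ := by rw [hκ, mul_inv_cancel_left]
      have e1 : γ 1 1 = r q 1 0 * κ 0 1 + r q 1 1 * κ 1 1 := by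
        rw [hγ]
        change ((r q : Matrix (Fin 2) (Fin 2) ℤ) * (κ : Matrix (Fin 2) (Fin 2) ℤ)) 1 1 = _
        rw [Matrix.mul_apply, Fin.sum_univ_two]
      have e2 : γ 0 1 = r q 0 0 * κ 0 1 + r q 0 1 * κ 1 1 := by
        rw [hγ]
        change ((r q : Matrix (Fin 2) (Fin 2) ℤ) * (κ : Matrix (Fin 2) (Fin 2) ℤ)) 0 1 = _
        rw [Matrix.mul_apply, Fin.sum_univ_two]
      have hv' : v = ((κ 1 1 : ℤ) : ZMod p) • col (r q) := by
        rw [← hcv, hcol]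
        simp only [e1, e2, Prod.smul_mk, smul_eq_mul]
        push_cast
        rw [h4]
        refine Prod.ext ?_ ?_ <;> simp <;> ring
      have hκ0 : ((κ 1 1 : ℤ) : ZMod p) ≠ 0 := by
        intro h0
        rw [h0, zero_smul] at hv'
        exact hv hv'
      exact ⟨(q, Units.mk0 _ hκ0), Subtype.ext hv'.symm⟩
  have h1 : ∑ v, F' v = F' 0 + ∑ v : {v : ZMod p × ZMod p // v ≠ 0}, F' v := by
    rw [← Finset.add_sum_erase _ _ (Finset.mem_univ (0 : ZMod p × ZMod p))]
    congr 1
    rw [Finset.sum_subtype]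
    simp
  have h2 : ∀ x, F' (Φ x) = F x.1 := by
    rintro ⟨q, c⟩
    change F' ((c : ZMod p) • col (r q)) = F q
    rw [hF' _ c.ne_zero, ← hF _ (hr1 q) (hr q), hrq]
  rw [h1, ← hΦ.sum_comp, Fintype.sum_prod_type]
  simp only [h2, Finset.sum_const, Finset.card_univ, ZMod.card_units]
  rw [Finset.smul_sum, add_comm]

/-- Conjugation by diag(1, p) divides the upper right entry by p, multiplies the lower left one by p
and fixes the diagonal, so only the integrality of the former is at stake. -/
lemma mem_conj_diagonal_iff {K : Type*} [Field K] [CharZero K] {l p : ℕ} [hp : Fact p.Prime]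
    {A : GL (Fin 2) K} (hA : (A : Matrix (Fin 2) (Fin 2) K) = !![1, 0; 0, (p : K)])
    {γ : SL(2, ℤ)} (hγ : γ ∈ Gamma1 l) :
    mapGL K γ ∈ toConjAct A⁻¹ • (Gamma1 l).map (mapGL K) ↔ ((γ 0 1 : ℤ) : ZMod p) = 0 := by
  rw [toConjAct_inv, Subgroup.mem_inv_pointwise_smul_iff, toConjAct_smul,
    ZMod.intCast_zmod_eq_zero_iff_dvd]
  have key : ∀ y : SL(2, ℤ), mapGL K y = A * mapGL K γ * A⁻¹ ↔
      γ 0 1 = p * y 0 1 ∧ y 0 0 = γ 0 0 ∧ y 1 0 = p * γ 1 0 ∧ y 1 1 = γ 1 1 := by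
    intro y
    have hp0 : (p : K) ≠ 0 := by exact_mod_cast hp.out.ne_zero
    have hcoe : ∀ (g : SL(2, ℤ)) (i j : Fin 2), (mapGL K g : Matrix (Fin 2) (Fin 2) K) i j =
        ((g i j : ℤ) : K) := fun g i j => by simp [mapGL]
    rw [eq_mul_inv_iff_mul_eq, ← Units.val_inj, ← Matrix.ext_iff]
    simp only [Units.val_mul, hA, Matrix.mul_apply, Fin.sum_univ_two, Fin.forall_fin_two, hcoe]
    simp
    norm_cast
    constructor
    · rintro ⟨⟨h1, h2⟩, h3, h4⟩
      refine ⟨by rw [← h2, mul_comm], h1, h3, ?_⟩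
      rw [mul_comm] at h4
      exact mul_left_cancel₀ (by exact_mod_cast hp.out.ne_zero) h4
    · rintro ⟨h1, h2, h3, h4⟩
      exact ⟨⟨h2, by rw [h1, mul_comm]⟩, h3, by rw [h4, mul_comm]⟩
  rw [Gamma1_mem] at hγ
  constructor
  · rintro ⟨y, -, hy⟩
    rw [key] at hy
    exact ⟨_, hy.1⟩
  · rintro ⟨k, hk⟩
    have hdet : γ 0 0 * γ 1 1 - γ 0 1 * γ 1 0 = 1 := by
      rw [← Matrix.det_fin_two]; exact γ.det_coe
    refine ⟨⟨!![γ 0 0, k; p * γ 1 0, γ 1 1], ?_⟩, ?_, ?_⟩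
    · rw [Matrix.det_fin_two_of]
      rw [hk] at hdet
      linear_combination hdet
    · refine (Gamma1_mem l _).mpr ?_
      simp [hγ]
    · refine (key _).mpr ?_
      simp [hk]

end ToricHecke

/-! ### Hecke operators on symbols and on forms, compared through translates by p-torsion points. -/

namespace ToricHecke

open Matrix Matrix.SpecialLinearGroup CongruenceSubgroup ConjAct UpperHalfPlane

/-! ### Torsion points -/

/-- The `p`-torsion points of the torus. -/
def tp (p : ℕ) [NeZero p] : ZMod p × ZMod p →+ Tor :=
  AddMonoidHom.prodMap ZMod.toAddCircle ZMod.toAddCircle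

lemma tp_apply (p : ℕ) [NeZero p] (v : ZMod p × ZMod p) :
    tp p v = (ZMod.toAddCircle v.1, ZMod.toAddCircle v.2) := rfl

lemma tp_injective (p : ℕ) [NeZero p] : Function.Injective (tp p) :=
  (ZMod.toAddCircle_injective p).prodMap (ZMod.toAddCircle_injective p)

lemma range_toAddCircle (p : ℕ) [NeZero p] :
    Set.range (ZMod.toAddCircle (N := p)) = {z | p • z = 0} := by
  ext z
  rw [Set.mem_ofPred_eq, ← AddCircle.coe_zero, circle_nsmul_eq_iff (NeZero.ne p)]
  constructor
  · rintro ⟨j, rfl⟩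
    exact ⟨j.val, by simpa using ZMod.val_lt j, by rw [ZMod.toAddCircle_apply, zero_add]⟩
  · rintro ⟨i, -, rfl⟩
    exact ⟨i, by rw [ZMod.toAddCircle_natCast, zero_add]⟩

lemma range_tp (p : ℕ) [NeZero p] : Set.range (tp p) = {z | p • z = 0} := by
  ext z
  have h1 : z.1 ∈ Set.range (ZMod.toAddCircle (N := p)) ↔ p • z.1 = 0 := by
    rw [range_toAddCircle]; rfl
  have h2 : z.2 ∈ Set.range (ZMod.toAddCircle (N := p)) ↔ p • z.2 = 0 := by
    rw [range_toAddCircle]; rfl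
  rw [Set.mem_ofPred_eq, Prod.ext_iff, Prod.smul_fst, Prod.smul_snd, Prod.fst_zero, Prod.snd_zero,
    ← h1, ← h2]
  constructor
  · rintro ⟨v, rfl⟩
    exact ⟨⟨v.1, rfl⟩, v.2, rfl⟩
  · rintro ⟨⟨i, hi⟩, j, hj⟩
    exact ⟨(i, j), Prod.ext hi hj⟩

lemma zsmul_tp (p : ℕ) [NeZero p] (n : ℤ) (v : ZMod p × ZMod p) :
    n • tp p v = tp p ((n : ZMod p) • v) := by
  rw [← map_zsmul, Int.cast_smul_eq_zsmul]

lemma zsmul_zmod (p : ℕ) (n : ℤ) (v : ZMod p) : n • v = (n : ZMod p) * v := by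
  rw [← smul_eq_mul, Int.cast_smul_eq_zsmul]

lemma act_tp (p : ℕ) [NeZero p] (M : Matrix (Fin 2) (Fin 2) ℤ) (v : ZMod p × ZMod p) :
    act M (tp p v) = tp p (act M v) := by
  simp only [tp_apply, act_apply, map_add, map_zsmul]

/-- The products of `St` at translates by torsion points. -/
def Th (p : ℕ) [NeZero p] (x y : Tor) (w e : ZMod p × ZMod p) : ℍ → ℂ :=
  St (x + tp p (w.1 • e)) * St (y + tp p (w.2 • e))

/-- A scalar moves freely between w and e. So the sum over e depends only on the line of w, and the
sum over w only on the line of e. -/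
lemma Th_smul (p : ℕ) [NeZero p] (x y : Tor) (c : ZMod p) (w e : ZMod p × ZMod p) :
    Th p x y (c • w) e = Th p x y w (c • e) := by
  simp only [Th, Prod.smul_fst, Prod.smul_snd, smul_smul, smul_eq_mul, mul_comm c]

lemma Th_zero_left (p : ℕ) [NeZero p] (x y : Tor) (e : ZMod p × ZMod p) :
    Th p x y 0 e = St x * St y := by simp [Th]

lemma Th_zero_right (p : ℕ) [NeZero p] (x y : Tor) (w : ZMod p × ZMod p) :
    Th p x y w 0 = St x * St y := by simp [Th]

lemma sum_smul_left {p : ℕ} [Fact p.Prime] {V : Type*} [AddCommMonoid V] {c : ZMod p} (hc : c ≠ 0)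
    (f : ZMod p × ZMod p → V) : ∑ e, f (c • e) = ∑ e, f e :=
  Equiv.sum_comp (MulAction.toPerm (Units.mk0 c hc)) f

lemma sum_act {p : ℕ} [NeZero p] {V : Type*} [AddCommMonoid V] (g : SL(2, ℤ))
    (f : ZMod p × ZMod p → V) :
    ∑ e, f (act (g : Matrix (Fin 2) (Fin 2) ℤ)ᵀ e) = ∑ e, f e := by
  have h1 := adjugate_transpose_mul g
  refine Function.Bijective.sum_comp (Function.bijective_iff_has_inverse.mpr
    ⟨act (g : Matrix (Fin 2) (Fin 2) ℤ).adjugateᵀ, fun v => ?_, fun v => ?_⟩) f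
  · rw [← act_mul_apply, h1, act_one]; rfl
  · rw [← act_mul_apply, mul_eq_one_comm.mp h1, act_one]; rfl

/-! ### The Hecke operator on symbols -/

lemma coe_alpha (p : ℕ) [NeZero p] :
    (alpha p : Matrix (Fin 2) (Fin 2) ℚ) = !![1, 0; 0, (p : ℚ)] := rfl

lemma coe_alphaR (p : ℕ) [NeZero p] :
    (alphaR p : Matrix (Fin 2) (Fin 2) ℝ) = !![1, 0; 0, (p : ℝ)] := by
  ext i j
  fin_cases i <;> fin_cases j <;> simp [alphaR, alpha, GeneralLinearGroup.mkOfDetNeZero]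

lemma push_diagonal_torsion (p : ℕ) [NeZero p] (t : Tor) (f : Tor × Tor → ℍ → ℂ) :
    push (act !![(p : ℤ), 0; 0, 1]) f (0, t) = ∑ e, f (tp p e, t) := by
  have h : {z : Tor × Tor | act !![(p : ℤ), 0; 0, 1] z = (0, t)} =
      Set.range fun e => (tp p e, t) := by
    ext ⟨z, w⟩
    have h1 : z ∈ Set.range (tp p) ↔ p • z = 0 := by rw [range_tp]; rfl
    have h2 : act !![(p : ℤ), 0; 0, 1] (z, w) = (p • z, w) := by simp [act_apply]
    rw [Set.mem_ofPred_eq, h2, Prod.mk.injEq, ← h1]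
    constructor
    · rintro ⟨⟨e, rfl⟩, rfl⟩
      exact ⟨e, rfl⟩
    · rintro ⟨e, he⟩
      exact ⟨⟨e, congrArg Prod.fst he⟩, (congrArg Prod.snd he).symm⟩
  rw [push, h, finsum_mem_range, finsum_eq_sum_of_fintype]
  intro e e' he
  exact tp_injective p (congrArg Prod.fst he)

/-- The transposed adjugate of diag(1, p) is diag(p, 1), whose fibre over the base point moves the
first coordinate by all p-torsion points e. The matrix γ⁻¹g then spreads e over both coordinates,
with multiplicities w given by its first row. -/
lemma pairForm_hecke {l p : ℕ} [NeZero l] [NeZero p] {γ : SL(2, ℤ)} (hγ : γ ∈ Gamma1 l)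
    (g : SL(2, ℤ)) :
    pairForm (repMatrix ((alpha p * (mapGL ℚ γ)⁻¹) • mapGL ℚ g • ((0 : ℚ) : P1))
        ((alpha p * (mapGL ℚ γ)⁻¹) • mapGL ℚ g • (OnePoint.infty : P1))) (basePt l) =
      (p : ℂ)⁻¹ • ∑ e, Th p (tor 0 (g 1 0 / l)) (tor 0 (g 1 1 / l))
        (act (g : Matrix (Fin 2) (Fin 2) ℤ)ᵀ
          (((γ 1 1 : ℤ) : ZMod p), -((γ 0 1 : ℤ) : ZMod p))) e := by
  set h := γ⁻¹ * g with hh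
  set D : Matrix (Fin 2) (Fin 2) ℤ := !![1, 0; 0, (p : ℤ)] with hD
  have e1 : alpha p * (mapGL ℚ γ)⁻¹ * mapGL ℚ g = alpha p * mapGL ℚ h := by
    rw [hh, map_mul, map_inv, mul_assoc]
  have hent : ∀ i j, (alpha p * mapGL ℚ h : GL (Fin 2) ℚ) i j =
      ((D * (h : Matrix (Fin 2) (Fin 2) ℤ)) i j : ℤ) := by
    intro i j
    change ((alpha p : Matrix (Fin 2) (Fin 2) ℚ) * (mapGL ℚ h : Matrix (Fin 2) (Fin 2) ℚ)) i j = _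
    rw [Matrix.mul_apply, Matrix.mul_apply, Fin.sum_univ_two, Fin.sum_univ_two, mapGL_apply_int,
      mapGL_apply_int, coe_alpha, hD]
    fin_cases i <;> simp
  have hdetD : D.det = p := by rw [hD, det_fin_two_of]; ring
  have hdet0 : D.det ≠ 0 := by rw [hdetD]; exact_mod_cast NeZero.ne p
  have hdet1 : ((h : Matrix (Fin 2) (Fin 2) ℤ) *
      repMatrix ((0 : ℚ) : P1) OnePoint.infty).det ≠ 0 := by
    rw [det_mul, h.det_coe, one_mul, det_fin_two]
    simp [repMatrix, rep_coe, rep_infty]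
  have hadj : D.adjugateᵀ = !![(p : ℤ), 0; 0, 1] := by
    rw [hD, adjugate_fin_two_of]
    ext i j
    fin_cases i <;> fin_cases j <;> simp
  rw [smul_smul, smul_smul, e1, pairForm_repMatrix_smul hent, Matrix.mul_assoc,
    pairForm_mul hdet0 hdet1, hdetD, hadj]
  congr 1
  rw [basePt, push_diagonal_torsion]
  refine Finset.sum_congr rfl fun e _ => ?_
  rw [pairForm_SL_mul, pairForm_zero_infty]
  have e2 : act (h : Matrix (Fin 2) (Fin 2) ℤ)ᵀ (basePt l) =
      (tor 0 (g 1 0 / l), tor 0 (g 1 1 / l)) := by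
    rw [hh, transpose_coe_mul, act_mul_apply, act_basePt_of_mem (inv_mem hγ), act_basePt,
      transpose_apply, transpose_apply]
  have e3 : ((tp p e, tor 0 (1 / l)) : Tor × Tor) = (tp p e, 0) + basePt l := by
    simp [basePt]
  have e4 : act (h : Matrix (Fin 2) (Fin 2) ℤ)ᵀ ((tp p e, 0) : Tor × Tor) =
      (h 0 0 • tp p e, h 0 1 • tp p e) := by
    simp [act_apply]
  have e5 : ∀ j, h 0 j = γ 1 1 * g 0 j - γ 0 1 * g 1 j := by
    intro j
    change ((γ : Matrix (Fin 2) (Fin 2) ℤ).adjugate * (g : Matrix (Fin 2) (Fin 2) ℤ)) 0 j = _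
    rw [Matrix.mul_apply, Fin.sum_univ_two, Matrix.adjugate_fin_two]
    simp
    ring
  rw [e3, map_add, e4, e2, SS, Th, zsmul_tp, zsmul_tp, e5, e5, act_apply]
  simp only [Prod.mk_add_mk, transpose_apply, zsmul_zmod]
  push_cast
  rw [add_comm (tp p _), add_comm (tp p _)]
  congr 5 <;> ring

lemma smul_symbolMap_hecke {l p : ℕ} [NeZero l] [hp : Fact p.Prime] (hpl : ¬p ∣ l) (g : SL(2, ℤ)) :
    (p - 1) • symbolMap l (heckeSymb l p (maninSymbol l (g 1 0) (g 1 1))) +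
      (eisSpan l).mkQ ((p : ℂ)⁻¹ • ∑ e, Th p (tor 0 (g 1 0 / l)) (tor 0 (g 1 1 / l)) 0 e) =
      (eisSpan l).mkQ
        ((p : ℂ)⁻¹ • ∑ w, ∑ e, Th p (tor 0 (g 1 0 / l)) (tor 0 (g 1 1 / l)) w e) := by
  set x := tor 0 (g 1 0 / l)
  set y := tor 0 (g 1 1 / l)
  have h := sum_cosets hpl (mapGL ℚ) (toConjAct (alpha p)⁻¹ • GammaQ l)
    (fun γ hγ => mem_conj_diagonal_iff (coe_alpha p) hγ)
    (fun q : HeckeCosets l p => symbolMap l (heckeTerm l p (mapGL ℚ g • ((0 : ℚ) : P1))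
      (mapGL ℚ g • (OnePoint.infty : P1)) q))
    (fun v => (eisSpan l).mkQ
      ((p : ℂ)⁻¹ • ∑ e, Th p x y (act (g : Matrix (Fin 2) (Fin 2) ℤ)ᵀ v) e))
    (fun c hc v => by
      have : act (g : Matrix (Fin 2) (Fin 2) ℤ)ᵀ (c • v) =
          c • act (g : Matrix (Fin 2) (Fin 2) ℤ)ᵀ v := by
        simp only [act_apply, Prod.smul_mk, Prod.smul_fst, Prod.smul_snd, smul_eq_mul, zsmul_zmod]
        refine Prod.ext ?_ ?_ <;> simp <;> ring
      simp only [this, Th_smul]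
      rw [sum_smul_left hc (fun e => Th p x y (act (g : Matrix (Fin 2) (Fin 2) ℤ)ᵀ v) e)])
    (fun γ hγ _ => by
      change symbolMap l (symb l _ _) = _
      rw [symbolMap_symb, pairForm_hecke hγ])
  rw [map_zero, sum_act g (fun w => (eisSpan l).mkQ ((p : ℂ)⁻¹ • ∑ e, Th p x y w e))] at h
  refine Eq.trans ?_ (h.trans ?_)
  · rw [maninSymbol_eq l (g 1 0) (g 1 1) g rfl rfl, heckeSymb, liftSymb_symb, map_sum]
  · rw [Finset.smul_sum, map_sum]

/-! ### The Hecke operator on forms -/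

lemma coe_alphaR_smul (p : ℕ) [NeZero p] (τ : ℍ) : ((alphaR p • τ : ℍ) : ℂ) = τ / p := by
  rw [coe_smul_of_det_pos (det_alphaR_pos p), num, denom]
  simp [coe_alphaR]

lemma slash_alphaR (p : ℕ) [NeZero p] (f : ℍ → ℂ) (τ : ℍ) :
    (f ∣[(2 : ℤ)] alphaR p) τ = (p : ℂ)⁻¹ * f (alphaR p • τ) := by
  have hp : (p : ℂ) ≠ 0 := by exact_mod_cast NeZero.ne p
  have h1 : (alphaR p).det.val = p := by
    rw [GeneralLinearGroup.val_det_apply, coe_alphaR, det_fin_two_of]; ring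
  have h2 : denom (alphaR p) τ = p := by simp [denom, coe_alphaR]
  rw [ModularForm.slash_apply, σ, if_pos (det_alphaR_pos p), h1, h2]
  rw [ContinuousAlgEquiv.refl_apply, abs_of_nonneg (Nat.cast_nonneg p), _root_.zpow_neg]
  norm_num
  field_simp

lemma sum_range_eq_sum_tp (p : ℕ) [NeZero p] {V : Type*} [AddCommMonoid V] (f : Tor → V)
    (a b : ℝ) : ∑ j ∈ Finset.range p, f (tor ((a + j) / p) b) =
      ∑ j : ZMod p, f (tor (a / p) b + tp p (j, 0)) := by
  refine Finset.sum_nbij' (fun j => (j : ZMod p)) ZMod.val (fun _ _ => Finset.mem_univ _)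
    (fun j _ => by simpa using ZMod.val_lt j)
    (fun j hj => ZMod.val_cast_of_lt (by simpa using hj)) (fun j _ => by simp) (fun j _ => ?_)
  congr 1
  rw [tp_apply, ZMod.toAddCircle_natCast, map_zero, add_div]
  change _ = tor (a / p) b + tor (j / p) 0
  rw [tor_add, add_zero]

lemma St_alphaR (p : ℕ) [NeZero p] (a b : ℝ) (τ : ℍ) : St (tor a b) (alphaR p • τ) =
    (∑ j : ZMod p, St (tor (a / p) b + tp p (j, 0))) τ := by
  rw [← sum_range_eq_sum_tp, St_tor, coe_alphaR_smul, S_div τ.im_pos (NeZero.ne p),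
    Finset.sum_apply]
  simp only [St_tor]

lemma Pt_alphaR (p : ℕ) [NeZero p] (a b : ℝ) (τ : ℍ) : Pt (tor a b) (alphaR p • τ) =
    (∑ j : ZMod p, Pt (tor (a / p) b + tp p (j, 0))) τ := by
  rw [← sum_range_eq_sum_tp, Pt_tor, coe_alphaR_smul, P_div τ.im_pos (NeZero.ne p),
    Finset.sum_apply]
  simp only [Pt_tor]

lemma act_inv_tp (p : ℕ) [NeZero p] (γ : SL(2, ℤ)) (j : ZMod p) :
    act ((γ⁻¹ : SL(2, ℤ)) : Matrix (Fin 2) (Fin 2) ℤ)ᵀ (tp p (j, 0)) =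
      tp p (j • (((γ 1 1 : ℤ) : ZMod p), -((γ 0 1 : ℤ) : ZMod p))) := by
  rw [act_tp]
  congr 1
  have e : ∀ i, (γ⁻¹ : SL(2, ℤ)) 0 i = !![γ 1 1, -γ 0 1; -γ 1 0, γ 0 0] 0 i := by
    intro i
    change (γ : Matrix (Fin 2) (Fin 2) ℤ).adjugate 0 i = _
    rw [Matrix.adjugate_fin_two]
  simp only [act_apply, transpose_apply, e, zsmul_zmod]
  simp [mul_comm]

/-- Each factor at τ/p is a sum over p torsion translates in one direction, by `S_div`, and γ⁻¹
rotates that direction. The two factors vary independently, so here w runs and e is fixed: the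
reverse of `pairForm_hecke`. -/
lemma slash_hecke {l p : ℕ} [NeZero l] [NeZero p] {γ : SL(2, ℤ)} (hγ : γ ∈ Gamma1 l) (a b : ℤ) :
    ((St (tor 0 (a / l)) * St (tor 0 (b / l))) ∣[(2 : ℤ)] alphaR p) ∣[(2 : ℤ)] γ⁻¹ =
      (p : ℂ)⁻¹ • ∑ w, Th p (tor 0 (a / l)) (tor 0 (b / l)) w
        (((γ 1 1 : ℤ) : ZMod p), -((γ 0 1 : ℤ) : ZMod p)) := by
  have h : (St (tor 0 (a / l)) * St (tor 0 (b / l))) ∣[(2 : ℤ)] alphaR p =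
      (p : ℂ)⁻¹ • ∑ w : ZMod p × ZMod p,
        (St (tor 0 (a / l) + tp p (w.1, 0)) * St (tor 0 (b / l) + tp p (w.2, 0))) := by
    ext τ
    rw [slash_alphaR, Pi.mul_apply, St_alphaR, St_alphaR, ← Pi.mul_apply, Finset.sum_mul_sum,
      zero_div, Fintype.sum_prod_type]
    rfl
  rw [h, ModularForm.SL_smul_slash, SlashAction.sum_slash]
  congr 1
  refine Finset.sum_congr rfl fun w _ => ?_
  rw [mul_slash_St, map_add, map_add, act_tor_zero_of_mem (inv_mem hγ),
    act_tor_zero_of_mem (inv_mem hγ), act_inv_tp, act_inv_tp]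
  rfl

lemma smul_heckeForm_prodForm {l p : ℕ} [NeZero l] [hp : Fact p.Prime] (hpl : ¬p ∣ l) (a b : ℤ) :
    (p - 1) • (heckeForm l p (prodForm l a b) : ℍ → ℂ) +
      (p : ℂ)⁻¹ • ∑ w, Th p (tor 0 (a / l)) (tor 0 (b / l)) w 0 =
      (p : ℂ)⁻¹ • ∑ e, ∑ w, Th p (tor 0 (a / l)) (tor 0 (b / l)) w e := by
  let _ := Fintype.ofFinite ((Gamma1 l).map (mapGL ℝ) ⧸
    (toConjAct (alphaR p)⁻¹ • (Gamma1 l).map (mapGL ℝ)).subgroupOf ((Gamma1 l).map (mapGL ℝ)))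
  have h := sum_cosets hpl (mapGL ℝ) (toConjAct (alphaR p)⁻¹ • (Gamma1 l).map (mapGL ℝ))
    (fun γ hγ => mem_conj_diagonal_iff (coe_alphaR p) hγ)
    (SlashInvariantForm.quotientFunc (ModularForm.translate (prodForm l a b) (alphaR p)))
    (fun v => (p : ℂ)⁻¹ • ∑ w, Th p (tor 0 (a / l)) (tor 0 (b / l)) w v)
    (fun c hc v => by
      simp only [← Th_smul]
      rw [sum_smul_left hc (fun w => Th p (tor 0 (a / l)) (tor 0 (b / l)) w v)])
    (fun γ hγ _ => by
      rw [← slash_hecke hγ]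
      change ((⇑(prodForm l a b) : ℍ → ℂ) ∣[(2 : ℤ)] alphaR p) ∣[(2 : ℤ)] (mapGL ℝ γ)⁻¹ = _
      rw [← map_inv]
      rfl)
  rw [← Finset.smul_sum] at h
  rw [← h]
  rfl

lemma symbolMap_hecke_maninSymbol {l p : ℕ} [NeZero l] [hp : Fact p.Prime] (hpl : ¬p ∣ l)
    {a b : ℤ} (hab : Int.gcd (Int.gcd a b) l = 1) :
    symbolMap l (heckeSymb l p (maninSymbol l a b)) =
      formMap l ((eisSpace l).mkQ (heckeForm l p (prodForm l a b))) := by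
  obtain ⟨g, ha, hb⟩ := exists_SL_bottom_row hab
  have h1 := smul_symbolMap_hecke hpl g
  have h2 := smul_heckeForm_prodForm hpl a b
  have e : maninSymbol l (g 1 0) (g 1 1) = maninSymbol l a b := by
    rw [maninSymbol_eq l _ _ g rfl rfl, maninSymbol_eq l _ _ g ha hb]
  -- Exchanging the sums over w and e identifies the two double sums. The terms at w = 0 and at e =
  -- 0 are the same multiple of St x St y and cancel.
  rw [e, tor_intCast_div ha, tor_intCast_div hb, Finset.sum_comm, ← h2, map_add] at h1
  simp only [Th_zero_left, Th_zero_right] at h1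
  have h3 := add_right_cancel h1
  rw [map_nsmul, ← Nat.cast_smul_eq_nsmul ℂ, ← Nat.cast_smul_eq_nsmul ℂ] at h3
  have hp1 : ((p - 1 : ℕ) : ℂ) ≠ 0 := by
    have := hp.out.two_le
    exact_mod_cast (by omega : p - 1 ≠ 0)
  exact smul_right_injective _ hp1 h3

lemma symbolMap_hecke_maninMinus {l p : ℕ} [NeZero l] [hp : Fact p.Prime] (hpl : ¬p ∣ l)
    {a b : ℤ} (hab : Int.gcd (Int.gcd a b) l = 1) :
    symbolMap l (heckeSymb l p (maninMinus l a b)) =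
      formMap l ((eisSpace l).mkQ (heckeForm l p (prodForm l a b))) := by
  change symbolMap l (heckeSymb l p ((1 / 2 : ℂ) • (maninSymbol l a b - maninSymbol l (-a) b))) = _
  rw [map_smul, map_sub, map_smul, map_sub, symbolMap_hecke_maninSymbol hpl hab,
    symbolMap_hecke_maninSymbol hpl (gcd_neg_left hab), prodForm_neg_left, map_neg, map_neg,
    map_neg, sub_neg_eq_add, ← two_smul ℂ, smul_smul]
  norm_num

/-! ### The Hecke operator and the involution -/

lemma epsilon_mul_self : epsilon * epsilon = 1 := by
  ext i j
  fin_cases i <;> fin_cases j <;>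
    simp [epsilon, GeneralLinearGroup.mkOfDetNeZero, Matrix.mul_apply, Fin.sum_univ_two]

lemma epsilon_alpha (p : ℕ) [NeZero p] : epsilon * alpha p = alpha p * epsilon := by
  ext i j
  fin_cases i <;> fin_cases j <;>
    simp [epsilon, alpha, GeneralLinearGroup.mkOfDetNeZero, Matrix.mul_apply, Fin.sum_univ_two]

lemma epsilon_conj_mem {l : ℕ} {x : GL (Fin 2) ℚ} (hx : x ∈ GammaQ l) :
    epsilon * x * epsilon ∈ GammaQ l := by
  obtain ⟨γ, hγ, rfl⟩ := hx
  rw [epsilon_mul, mul_assoc, epsilon_mul_self, mul_one]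
  exact ⟨_, conjEps_mem hγ, rfl⟩

lemma epsilon_conj_mem_conj {l p : ℕ} [NeZero p] {x : GL (Fin 2) ℚ}
    (hx : x ∈ toConjAct (alpha p)⁻¹ • GammaQ l) :
    epsilon * x * epsilon ∈ toConjAct (alpha p)⁻¹ • GammaQ l := by
  rw [toConjAct_inv, Subgroup.mem_inv_pointwise_smul_iff, toConjAct_smul] at *
  have e : alpha p * (epsilon * x * epsilon) * (alpha p)⁻¹ =
      epsilon * (alpha p * x * (alpha p)⁻¹) * epsilon := by
    have h1 : epsilon * (alpha p)⁻¹ = (alpha p)⁻¹ * epsilon := by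
      rw [eq_inv_mul_iff_mul_eq, ← mul_assoc, ← epsilon_alpha, mul_inv_cancel_right]
    simp only [mul_assoc]
    rw [h1]
    simp only [← mul_assoc]
    rw [epsilon_alpha]
  rw [e]
  exact epsilon_conj_mem hx

/-- Conjugation by `diag(-1, 1)` on the cosets of the Hecke operator. -/
def conjCoset (l p : ℕ) [NeZero p] (q : HeckeCosets l p) : HeckeCosets l p :=
  q.liftOn (fun γ => QuotientGroup.mk ⟨epsilon * γ * epsilon, epsilon_conj_mem γ.2⟩) (by
    intro γ γ' h
    rw [← Quotient.eq_iff_equiv, Quotient.eq, QuotientGroup.leftRel_apply] at h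
    have h' : (γ : GL (Fin 2) ℚ)⁻¹ * γ' ∈ toConjAct (alpha p)⁻¹ • GammaQ l := h
    rw [QuotientGroup.eq, Subgroup.mem_subgroupOf]
    change (epsilon * (γ : GL (Fin 2) ℚ) * epsilon)⁻¹ * (epsilon * γ' * epsilon) ∈ _
    have e : (epsilon * (γ : GL (Fin 2) ℚ) * epsilon)⁻¹ * (epsilon * γ' * epsilon) =
        epsilon * ((γ : GL (Fin 2) ℚ)⁻¹ * γ') * epsilon := by
      have : epsilon⁻¹ = epsilon := inv_eq_of_mul_eq_one_left epsilon_mul_self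
      rw [_root_.mul_inv_rev, _root_.mul_inv_rev]
      nth_rewrite 1 [this]
      group
    rw [e]
    exact epsilon_conj_mem_conj h')

lemma conjCoset_involutive (l p : ℕ) [NeZero p] : Function.Involutive (conjCoset l p) := by
  intro q
  induction q using Quotient.inductionOn with
  | h γ =>
    change QuotientGroup.mk _ = QuotientGroup.mk _
    congr 1
    apply Subtype.ext
    change epsilon * (epsilon * (γ : GL (Fin 2) ℚ) * epsilon) * epsilon = γ
    rw [mul_assoc, mul_assoc, epsilon_mul_self, mul_one, ← mul_assoc, epsilon_mul_self, one_mul]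

lemma iota_heckeTerm (l p : ℕ) [NeZero p] (P Q : P1) (q : HeckeCosets l p) :
    iota l (heckeTerm l p P Q q) =
      heckeTerm l p (epsilon • P) (epsilon • Q) (conjCoset l p q) := by
  induction q using Quotient.inductionOn with
  | h γ =>
    change iota l (symb l _ _) = symb l _ _
    have e : alpha p * (epsilon * (γ : GL (Fin 2) ℚ) * epsilon)⁻¹ * epsilon =
        epsilon * (alpha p * (γ : GL (Fin 2) ℚ)⁻¹) := by
      have : epsilon⁻¹ = epsilon := inv_eq_of_mul_eq_one_left epsilon_mul_self
      rw [_root_.mul_inv_rev, _root_.mul_inv_rev, this, ← mul_assoc, ← mul_assoc, mul_assoc _ epsilon epsilon,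
        epsilon_mul_self, mul_one, ← mul_assoc, epsilon_alpha]
    rw [iota, liftSymb_symb, smul_smul, smul_smul, smul_smul, smul_smul, e]

/-- The matrix diag(-1, 1) normalizes Γ₁(l) and commutes with diag(1, p), so it permutes the cosets.
-/
lemma iota_heckeSymb (l p : ℕ) [NeZero l] [NeZero p] (x : ModSym l) :
    iota l (heckeSymb l p x) = heckeSymb l p (iota l x) := by
  have : iota l ∘ₗ heckeSymb l p = heckeSymb l p ∘ₗ iota l := ext_maninSymbol fun a b hab => by
    obtain ⟨g, ha, hb⟩ := exists_SL_bottom_row hab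
    rw [maninSymbol_eq l a b g ha hb, LinearMap.comp_apply, LinearMap.comp_apply, heckeSymb,
      liftSymb_symb, map_sum, iota, liftSymb_symb, liftSymb_symb, ← iota]
    simp only [iota_heckeTerm]
    exact Equiv.sum_comp (conjCoset_involutive l p).toPerm _
  exact LinearMap.congr_fun this x

lemma heckeSymb_mem_minusSymbols (l p : ℕ) [NeZero l] [NeZero p] {x : ModSym l}
    (hx : x ∈ minusSymbols l) : heckeSymb l p x ∈ minusSymbols l := by
  change iota l (heckeSymb l p x) = -heckeSymb l p x
  have hx' : iota l x = -x := hx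
  rw [iota_heckeSymb, hx', map_neg]

end ToricHecke

/-! ### Stability of the Eisenstein space under T_p, and the compatibility of `μ`. -/

namespace ToricHecke

open Matrix Matrix.SpecialLinearGroup CongruenceSubgroup ConjAct UpperHalfPlane

/-! ### The Hecke operator on Eisenstein series -/

lemma tp_intCast (l : ℕ) [NeZero l] (a b : ℤ) :
    tp l ((a : ZMod l), (b : ZMod l)) = tor (a / l) (b / l) := by
  rw [tp_apply, ZMod.toAddCircle_intCast, ZMod.toAddCircle_intCast]
  rfl

lemma Pt_tp_mem_eisSpan (l : ℕ) [NeZero l] (v : ZMod l × ZMod l) : Pt (tp l v) ∈ eisSpan l := by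
  obtain ⟨⟨a, ha⟩, ⟨b, hb⟩⟩ := ZMod.intCast_surjective v.1, ZMod.intCast_surjective v.2
  have : v = ((a : ZMod l), (b : ZMod l)) := Prod.ext ha.symm hb.symm
  rw [this, tp_intCast]
  exact Pt_mem_eisSpan l a b

lemma exists_sum_Pt_of_mem_eisSpan {l : ℕ} [NeZero l] {f : ℍ → ℂ} (hf : f ∈ eisSpan l) :
    ∃ c : ZMod l × ZMod l → ℂ, f = ∑ v, c v • Pt (tp l v) := by
  have hle : eisSpan l ≤ Submodule.span ℂ (Set.range fun v => Pt (tp l v)) := by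
    rw [eisSpan, Submodule.span_le]
    rintro _ ⟨v, rfl⟩
    obtain ⟨⟨a, ha⟩, ⟨b, hb⟩⟩ := ZMod.intCast_surjective v.1, ZMod.intCast_surjective v.2
    have : v = ((a : ZMod l), (b : ZMod l)) := Prod.ext ha.symm hb.symm
    rw [this, eisG_eq, ← tp_intCast]
    exact Submodule.smul_mem _ _ (Submodule.subset_span ⟨_, rfl⟩)
  obtain ⟨c, hc⟩ := (Submodule.mem_span_range_iff_exists_fun ℂ).mp (hle hf)
  exact ⟨c, hc.symm⟩

lemma act_tp_of_mem_Gamma {l : ℕ} [NeZero l] {γ : SL(2, ℤ)} (hγ : γ ∈ Gamma l)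
    (v : ZMod l × ZMod l) : act (γ : Matrix (Fin 2) (Fin 2) ℤ)ᵀ (tp l v) = tp l v := by
  rw [Gamma_mem] at hγ
  rw [act_tp]
  congr 1
  simp [act_apply, hγ]

/-- The element `(1, 0; l, 1)` of `Γ(l)`. -/
def lowerUnipotent (l : ℕ) : SL(2, ℤ) := ⟨!![1, 0; l, 1], by simp⟩

lemma lowerUnipotent_mem (l : ℕ) : lowerUnipotent l ∈ Gamma l := by
  refine Gamma_mem.mpr ?_
  simp [lowerUnipotent]

lemma Gamma_le_Gamma1 {l : ℕ} {γ : SL(2, ℤ)} (hγ : γ ∈ Gamma l) : γ ∈ Gamma1 l := by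
  rw [Gamma_mem] at hγ
  rw [Gamma1_mem]
  tauto

lemma slash_eq_of_mem {l : ℕ} (f : MForm l) {γ : SL(2, ℤ)} (hγ : γ ∈ Gamma1 l) :
    (f : ℍ → ℂ) ∣[(2 : ℤ)] γ = f :=
  f.slash_action_eq' _ ⟨γ, hγ, rfl⟩

/-- All the `Pt` have the same quasi-modular defect `D2`, and it is non-zero at (1, 0; l, 1), an
element of Γ(l) that fixes the torsion points. Invariance under this element forces the sum to
vanish. -/
lemma sum_coeff_eq_zero {l : ℕ} [NeZero l] {f : MForm l} {c : ZMod l × ZMod l → ℂ}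
    (hf : (f : ℍ → ℂ) = ∑ v, c v • Pt (tp l v)) : ∑ v, c v = 0 := by
  have h := slash_eq_of_mem f (Gamma_le_Gamma1 (lowerUnipotent_mem l))
  rw [hf, SlashAction.sum_slash] at h
  simp only [ModularForm.SL_smul_slash, Pt_slash, act_tp_of_mem_Gamma (lowerUnipotent_mem l),
    smul_add, Finset.sum_add_distrib, add_eq_left, ← Finset.sum_smul] at h
  refine (smul_eq_zero.mp h).resolve_right ?_
  have hpi : ((2 * Real.pi * Complex.I) ^ 2 : ℂ)⁻¹ ≠ 0 := by simp [Real.pi_ne_zero]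
  refine smul_ne_zero hpi fun h0 => ?_
  have h1 := congrFun h0 UpperHalfPlane.I
  rw [EisensteinSeries.D2, Pi.zero_apply, div_eq_zero_iff] at h1
  refine h1.elim (fun h2 => ?_) (denom_ne_zero _ _)
  have hl : (l : ℂ) ≠ 0 := by exact_mod_cast NeZero.ne l
  simp [lowerUnipotent, Real.pi_ne_zero, NeZero.ne l] at h2

lemma Pt_slash_alphaR {l p : ℕ} [NeZero l] [NeZero p] (u : ZMod l × ZMod l) :
    Pt (tp l ((p : ZMod l) * u.1, u.2)) ∣[(2 : ℤ)] alphaR p =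
      (p : ℂ)⁻¹ • ∑ j : ZMod p, Pt (tp l u + tp p (j, 0)) := by
  obtain ⟨⟨a, ha⟩, ⟨b, hb⟩⟩ := ZMod.intCast_surjective u.1, ZMod.intCast_surjective u.2
  have hu : u = ((a : ZMod l), (b : ZMod l)) := Prod.ext ha.symm hb.symm
  have hp : (p : ℝ) ≠ 0 := by exact_mod_cast NeZero.ne p
  have e : ((p : ZMod l) * u.1, u.2) = (((p * a : ℤ) : ZMod l), (b : ZMod l)) := by
    rw [hu]; push_cast; rfl
  ext τ
  rw [slash_alphaR, e, tp_intCast, Pt_alphaR, hu, tp_intCast]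
  have e2 : ((p * a : ℤ) : ℝ) / l / p = a / l := by push_cast; field_simp
  rw [e2]
  rfl

lemma slash_hecke_Pt {l p : ℕ} [NeZero l] [NeZero p] {γ : SL(2, ℤ)} (hγ : γ ∈ Gamma l)
    (u : ZMod l × ZMod l) :
    (Pt (tp l ((p : ZMod l) * u.1, u.2)) ∣[(2 : ℤ)] alphaR p) ∣[(2 : ℤ)] γ⁻¹ =
      (p : ℂ)⁻¹ • ∑ j : ZMod p,
        Pt (tp l u + tp p (j • (((γ 1 1 : ℤ) : ZMod p), -((γ 0 1 : ℤ) : ZMod p)))) +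
      ((2 * Real.pi * Complex.I) ^ 2 : ℂ)⁻¹ • EisensteinSeries.D2 γ⁻¹ := by
  have hp : (p : ℂ) ≠ 0 := by exact_mod_cast NeZero.ne p
  rw [Pt_slash_alphaR, ModularForm.SL_smul_slash, SlashAction.sum_slash]
  simp only [Pt_slash, map_add, act_tp_of_mem_Gamma (inv_mem hγ), act_inv_tp,
    Finset.sum_add_distrib, Finset.sum_const, Finset.card_univ, ZMod.card, smul_add]
  rw [← Nat.cast_smul_eq_nsmul ℂ, smul_smul (p : ℂ)⁻¹, inv_mul_cancel₀ hp, one_smul]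

lemma slash_hecke_eisenstein {l p : ℕ} [NeZero l] [NeZero p] (hpl : Nat.Coprime p l) {f : MForm l}
    {c : ZMod l × ZMod l → ℂ} (hf : (f : ℍ → ℂ) = ∑ v, c v • Pt (tp l v)) {γ : SL(2, ℤ)}
    (hγ : γ ∈ Gamma l) : ((f : ℍ → ℂ) ∣[(2 : ℤ)] alphaR p) ∣[(2 : ℤ)] γ⁻¹ =
      ∑ v : ZMod l × ZMod l, c v • (p : ℂ)⁻¹ • ∑ j : ZMod p, Pt (tp l ((p : ZMod l)⁻¹ * v.1, v.2) +
        tp p (j • (((γ 1 1 : ℤ) : ZMod p), -((γ 0 1 : ℤ) : ZMod p)))) := by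
  have hσ : ∀ z : ℂ, UpperHalfPlane.σ (alphaR p) z = z := fun z => by
    rw [UpperHalfPlane.σ, if_pos (det_alphaR_pos p)]; rfl
  -- As p is invertible modulo l, every l-torsion index has the form (p u₁, u₂) required by
  -- `slash_hecke_Pt`.
  have hv : ∀ v : ZMod l × ZMod l,
      v = ((p : ZMod l) * ((p : ZMod l)⁻¹ * v.1, v.2).1, ((p : ZMod l)⁻¹ * v.1, v.2).2) := by
    intro v
    rw [← mul_assoc, ZMod.coe_mul_inv_eq_one p hpl, one_mul]
  have h1 : ∀ v, (Pt (tp l v) ∣[(2 : ℤ)] alphaR p) ∣[(2 : ℤ)] γ⁻¹ = _ := fun v =>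
    (congrArg (fun w => (Pt (tp l w) ∣[(2 : ℤ)] alphaR p) ∣[(2 : ℤ)] γ⁻¹) (hv v)).trans
      (slash_hecke_Pt hγ _)
  rw [hf, SlashAction.sum_slash, SlashAction.sum_slash]
  simp only [ModularForm.smul_slash, hσ, ModularForm.SL_smul_slash, h1]
  simp only [smul_add, Finset.sum_add_distrib, ← Finset.sum_smul, sum_coeff_eq_zero hf, zero_smul,
    add_zero]

/-- For j ≠ 0 the points u + jw are all the p-division points of pu, and the distribution relation
sums them to a level l series. For j = 0 the sum is a multiple of one such series. -/
lemma sum_Pt_tp_mem_eisSpan {l p : ℕ} [NeZero l] [hp : Fact p.Prime] (u : ZMod l × ZMod l)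
    (j : ZMod p) : ∑ w, Pt (tp l u + tp p (j • w)) ∈ eisSpan l := by
  rcases eq_or_ne j 0 with rfl | hj
  · simp only [zero_smul, map_zero, add_zero, Finset.sum_const]
    exact (eisSpan l).smul_of_tower_mem _ (Pt_tp_mem_eisSpan l u)
  · rw [sum_smul_left hj (fun w => Pt (tp l u + tp p w))]
    have h := Pt_distribution (NeZero.ne p) (p • tp l u)
    have hset : {z : Tor | p • z = p • tp l u} = Set.range fun w => tp l u + tp p w := by
      ext z
      rw [Set.mem_ofPred_eq, ← sub_eq_zero, ← smul_sub]
      have h1 : z - tp l u ∈ Set.range (tp p) ↔ p • (z - tp l u) = 0 := by rw [range_tp]; rfl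
      rw [← h1]
      constructor
      · rintro ⟨w, hw⟩
        exact ⟨w, by simp only [hw]; abel⟩
      · rintro ⟨w, rfl⟩
        exact ⟨w, by simp⟩
    rw [hset, finsum_mem_range, finsum_eq_sum_of_fintype] at h
    · rw [h, ← map_nsmul]
      exact Submodule.smul_mem _ _ (Pt_tp_mem_eisSpan l _)
    · exact (add_right_injective _).comp (tp_injective p)

lemma heckeForm_mem_eisSpace {l p : ℕ} [NeZero l] [hp : Fact p.Prime] (hpl : ¬p ∣ l) {f : MForm l}
    (hf : f ∈ eisSpace l) : heckeForm l p f ∈ eisSpace l := by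
  obtain ⟨c, hc⟩ := exists_sum_Pt_of_mem_eisSpan hf
  have hcop := (Nat.Prime.coprime_iff_not_dvd hp.out).mpr hpl
  let _ := Fintype.ofFinite ((Gamma1 l).map (mapGL ℝ) ⧸
    (toConjAct (alphaR p)⁻¹ • (Gamma1 l).map (mapGL ℝ)).subgroupOf ((Gamma1 l).map (mapGL ℝ)))
  set F' : ZMod p × ZMod p → ℍ → ℂ := fun w => ∑ v : ZMod l × ZMod l, c v • (p : ℂ)⁻¹ •
    ∑ j : ZMod p, Pt (tp l ((p : ZMod l)⁻¹ * v.1, v.2) + tp p (j • w)) with hF'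
  have h := sum_cosets hpl (mapGL ℝ) (toConjAct (alphaR p)⁻¹ • (Gamma1 l).map (mapGL ℝ))
    (fun γ hγ => mem_conj_diagonal_iff (coe_alphaR p) hγ)
    (SlashInvariantForm.quotientFunc (ModularForm.translate f (alphaR p))) F'
    (fun a ha w => by
      simp only [hF', smul_smul _ a]
      refine Finset.sum_congr rfl fun v _ => ?_
      congr 2
      exact Equiv.sum_comp (Equiv.mulRight₀ a ha)
        (fun j => Pt (tp l ((p : ZMod l)⁻¹ * v.1, v.2) + tp p (j • w))))
    (fun γ hγ1 hγ => by
      refine Eq.trans ?_ (slash_hecke_eisenstein hcop hc hγ)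
      change ((f : ℍ → ℂ) ∣[(2 : ℤ)] alphaR p) ∣[(2 : ℤ)] (mapGL ℝ γ)⁻¹ = _
      rw [← map_inv]
      rfl)
  have h1 : ∑ w, F' w ∈ eisSpan l := by
    rw [hF', Finset.sum_comm]
    refine Submodule.sum_mem _ fun v _ => ?_
    simp only [← Finset.smul_sum]
    refine Submodule.smul_mem _ _ (Submodule.smul_mem _ _ ?_)
    rw [Finset.sum_comm]
    exact Submodule.sum_mem _ fun j _ => sum_Pt_tp_mem_eisSpan _ j
  have h2 : F' 0 ∈ eisSpan l := by
    refine Submodule.sum_mem _ fun v _ => Submodule.smul_mem _ _ (Submodule.smul_mem _ _ ?_)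
    refine Submodule.sum_mem _ fun j _ => ?_
    rw [smul_zero, map_zero, add_zero]
    exact Pt_tp_mem_eisSpan l _
  rw [← h] at h1
  have h3 := (Submodule.add_mem_iff_left _ h2).mp h1
  rw [← Nat.cast_smul_eq_nsmul ℂ] at h3
  have hp1 : ((p - 1 : ℕ) : ℂ) ≠ 0 := by
    have := hp.out.two_le
    exact_mod_cast (by omega : p - 1 ≠ 0)
  exact (Submodule.smul_mem_iff _ hp1).mp h3

/-! ### Compatibility of `μ` with the Hecke operators -/

lemma IsToricMap.map_hecke {l p : ℕ} [NeZero l] [hp : Fact p.Prime] (hpl : ¬p ∣ l)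
    (hM : ∀ x ∈ minusSymbols l, heckeSymb l p x ∈ minusSymbols l)
    (hE : eisSpace l ≤ (eisSpace l).comap (heckeForm l p))
    {μ : minusSymbols l →ₗ[ℂ] MForm l ⧸ eisSpace l} (hμ : IsToricMap l μ) (x : minusSymbols l) :
    μ ((heckeSymb l p).restrict hM x) =
      (eisSpace l).mapQ (eisSpace l) (heckeForm l p) hE (μ x) := by
  have : μ ∘ₗ (heckeSymb l p).restrict hM =
      (eisSpace l).mapQ (eisSpace l) (heckeForm l p) hE ∘ₗ μ := ext_maninMinus fun a b h => by
    apply formMap_injective l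
    rw [LinearMap.comp_apply, LinearMap.comp_apply, hμ.formMap_apply,
      (isToricMap_iff μ).mp hμ a b h]
    exact symbolMap_hecke_maninMinus hpl h
  exact LinearMap.congr_fun this x

end ToricHecke

end

theorem theorem3p11 (l : ℕ) [NeZero l] (hl : 1 < l) :
    (∃! μ : minusSymbols l →ₗ[ℂ] MForm l ⧸ eisSpace l, IsToricMap l μ) ∧
    ∀ p : ℕ, [Fact p.Prime] → ¬ p ∣ l →
      ∃ (hM : ∀ x ∈ minusSymbols l, heckeSymb l p x ∈ minusSymbols l)
        (hE : eisSpace l ≤ (eisSpace l).comap (heckeForm l p)),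
        ∀ μ : minusSymbols l →ₗ[ℂ] MForm l ⧸ eisSpace l, IsToricMap l μ →
          ∀ x : minusSymbols l,
            μ ((heckeSymb l p).restrict hM x) =
              (eisSpace l).mapQ (eisSpace l) (heckeForm l p) hE (μ x) := by
  obtain ⟨μ₀, hμ₀⟩ := exists_isToricMap l
  refine ⟨⟨μ₀, hμ₀, fun ν hν => hν.unique hμ₀⟩, fun p _ hpl => ?_⟩
  have hM : ∀ x ∈ minusSymbols l, heckeSymb l p x ∈ minusSymbols l :=
    fun x hx => heckeSymb_mem_minusSymbols l p hx
  have hE : eisSpace l ≤ (eisSpace l).comap (heckeForm l p) :=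
    fun f hf => heckeForm_mem_eisSpace hpl hf
  exact ⟨hM, hE, fun μ hμ x => hμ.map_hecke hpl hM hE x⟩
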